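/- Let $m,n\ge 1$ be integers and let $\boldsymbol\omega=(\boldsymbol\alpha,\boldsymbol\beta)$ be any weight vector, i.e. $\boldsymbol\alpha\in\mathbb R_{>0}^m$, $\boldsymbol\beta\in\mathbb R_{>0}^n$ with $\sum_{i=1}^m\alpha_i=\sum_{j=1}^n\beta_j=1$. For $\mathbf x\in\mathbb R^m$ and $\mathbf y\in\mathbb R^n$ put $\|\mathbf x\|_{\boldsymbol\alpha}=\max_i|x_i|^{1/\alpha_i}$ and $\|\mathbf y\|_{\boldsymbol\beta}=\max_j|y_j|^{1/\beta_j}$. Let $$\mathbf{BA}_{\boldsymbol\omega}=\Big\{A\in M_{m\times n}(\mathbb R):\ \inf_{\mathbf p\in\mathbb Z^m,\ \mathbf q\in\mathbb Z^n\smallsetminus\{\mathbf 0\}}\|A\mathbf q-\mathbf p\|_{\boldsymbol\alpha}\,\|\mathbf q\|_{\boldsymbol\beta}>0\Big\}$$ be the set of $\boldsymbol\omega$-badly approximable matrices, and let $\mathbf{DI}_{\infty,\boldsymbol\omega}$ be the set of weighted Dirichlet-improvable matrices for the supremum norm, that is, of all $A\in M_{m\times n}(\mathbb R)$ for which there is $c\in(0,1)$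 such that for all sufficiently large real $t$ the system $$\|A\mathbf q-\mathbf p\|_{\boldsymbol\alpha}<\frac ct,\qquad \|\mathbf q\|_{\boldsymbol\beta}<t$$ has a solution $\mathbf p\in\mathbb Z^m$, $\mathbf q\in\mathbb Z^n\smallsetminus\{\mathbf 0\}$. Then $$\mathbf{BA}_{\boldsymbol\omega}\subseteq\mathbf{DI}_{\infty,\boldsymbol\omega}.$$ Moreover, $\mathbf{BA}_{\boldsymbol\omega}$ is thick, and hence so is $\mathbf{DI}_{\infty,\boldsymbol\omega}$. Here a set $S\subseteq M_{m\times n}(\mathbb R)$ is called thick if $\dim_H(S\cap U)=mn$ for every non-empty open set $U\subseteq M_{m\times n}(\mathbb R)$, where $\dim_H$ denotes Hausdorff dimension. -/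

import Mathlib

open Filter Matrix

open scoped ENNReal

-- Real matrices carry the norm given by the largest absolute value of an entry.
attribute [local instance] Matrix.normedAddCommGroup

namespace WeightedDirichlet

/-- A weight vector `ω = (α, β)`: two tuples of positive reals, each with sum `1`.
(The sum conditions force `m` and `n` to be positive.) -/
structure Weights (m n : ℕ) where
  α : Fin m → ℝ
  β : Fin n → ℝ
  α_pos : ∀ i, 0 < α i
  β_pos : ∀ j, 0 < β j
  α_sum : ∑ i, α i = 1
  β_sum : ∑ j, β j = 1

/-- The quasi-norm `max_i |x_i| ^ (1 / a_i)` attached to the tuple `a`. -/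
noncomputable def quasiNorm {k : ℕ} (a : Fin k → ℝ) (x : Fin k → ℝ) : ℝ :=
  ⨆ i, |x i| ^ (1 / a i)

/-- The vector `A q - p`, for integer vectors `p` and `q`. -/
def linForm {m n : ℕ} (A : Matrix (Fin m) (Fin n) ℝ) (p : Fin m → ℤ) (q : Fin n → ℤ) :
    Fin m → ℝ :=
  A *ᵥ (fun j => (q j : ℝ)) - fun i => (p i : ℝ)

/-- The set of `(ψ, ω)`-Dirichlet matrices for the supremum norm: for all sufficiently large `t`
the system `‖A q - p‖_α < ψ t`, `‖q‖_β < t` has a solution `p ∈ ℤ^m`, `q ∈ ℤ^n \ {0}`. -/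
def dirichletSet {m n : ℕ} (ω : Weights m n) (ψ : ℝ → ℝ) : Set (Matrix (Fin m) (Fin n) ℝ) :=
  {A | ∀ᶠ t : ℝ in atTop, ∃ (p : Fin m → ℤ) (q : Fin n → ℤ), q ≠ 0 ∧
    quasiNorm ω.α (linForm A p q) < ψ t ∧ quasiNorm ω.β (fun j => (q j : ℝ)) < t}

/-- The set of weighted Dirichlet-improvable matrices for the supremum norm: the union over
`0 < c < 1` of the sets of `(c / t, ω)`-Dirichlet matrices. -/
def dirichletImprovable {m n : ℕ} (ω : Weights m n) : Set (Matrix (Fin m) (Fin n) ℝ) :=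
  ⋃ c ∈ Set.Ioo (0 : ℝ) 1, dirichletSet ω (fun t => c * (1 / t))

/-- The set of `ω`-badly approximable matrices: those for which the infimum of
`‖A q - p‖_α * ‖q‖_β` over `p ∈ ℤ^m`, `q ∈ ℤ^n \ {0}` is positive. -/
def badlyApproximable {m n : ℕ} (ω : Weights m n) : Set (Matrix (Fin m) (Fin n) ℝ) :=
  {A | 0 < ⨅ x : (Fin m → ℤ) × {q : Fin n → ℤ // q ≠ 0},
    quasiNorm ω.α (linForm A x.1 x.2.1) * quasiNorm ω.β (fun j => (x.2.1 j : ℝ))}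

/-- A set of `m × n` matrices is thick if it has full Hausdorff dimension `m n` at every point,
that is, its intersection with every non-empty open set has Hausdorff dimension `m n`. -/
def IsThick {m n : ℕ} (S : Set (Matrix (Fin m) (Fin n) ℝ)) : Prop :=
  ∀ U : Set (Matrix (Fin m) (Fin n) ℝ), IsOpen U → U.Nonempty →
    dimH (S ∩ U) = ((m * n : ℕ) : ℝ≥0∞)

end WeightedDirichlet

namespace WeightedDirichlet

section Hajos

variable {G : Type*} [AddCommGroup G]

/-- The basis element of the group ring attached to a group element. -/
noncomputable def delta (g : G) : AddMonoidAlgebra ℤ G := AddMonoidAlgebra.single g 1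

lemma delta_zero : delta (0 : G) = 1 := rfl

lemma delta_add (g h : G) : delta (g + h) = delta g * delta h := by
  simp [delta, AddMonoidAlgebra.single_mul_single]

lemma coeff_mul_delta (Y : AddMonoidAlgebra ℤ G) (g x : G) :
    (Y * delta g).coeff x = Y.coeff (x - g) := by
  simp [delta, AddMonoidAlgebra.coeff_mul_single_apply, sub_eq_add_neg]

lemma coeff_delta_zero {g : G} (hg : g ≠ 0) : (delta g).coeff 0 = 0 := by
  simp [delta, hg]

lemma coeff_one_of_ne_zero {g : G} (hg : g ≠ 0) :
    (1 : AddMonoidAlgebra ℤ G).coeff g = 0 := by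
  simp [AddMonoidAlgebra.one_def, hg.symm]

/-- `Y` is supported on the subgroup `K`. -/
def SupportedOn (K : AddSubgroup G) (Y : AddMonoidAlgebra ℤ G) : Prop :=
  ∀ x, x ∉ K → Y.coeff x = 0

lemma SupportedOn.mono {K K' : AddSubgroup G} {Y : AddMonoidAlgebra ℤ G} (h : SupportedOn K Y)
    (hK : K ≤ K') : SupportedOn K' Y := fun x hx => h x fun hx' => hx (hK hx')

lemma SupportedOn.mul_one_add {K : AddSubgroup G} {Y : AddMonoidAlgebra ℤ G} (h : SupportedOn K Y)
    {a : G} (ha : a ∈ K) : SupportedOn K (Y * (1 + delta a)) := by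
  intro x hx
  have h1 : x - a ∉ K := fun h2 => hx (by simpa using K.add_mem h2 ha)
  rw [mul_add, mul_one, AddMonoidAlgebra.coeff_add, Finsupp.add_apply, coeff_mul_delta, h x hx, h _ h1]
  simp

lemma SupportedOn.mul_one_sub {K : AddSubgroup G} {Y : AddMonoidAlgebra ℤ G} (h : SupportedOn K Y)
    {a : G} (ha : a ∈ K) : SupportedOn K (Y * (1 - delta a)) := by
  intro x hx
  have h1 : x - a ∉ K := fun h2 => hx (by simpa using K.add_mem h2 ha)
  rw [mul_sub, mul_one, AddMonoidAlgebra.coeff_sub, Finsupp.sub_apply, coeff_mul_delta, h x hx, h _ h1]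
  simp

lemma SupportedOn.mul_prod {ι : Type*} {K : AddSubgroup G} {Y : AddMonoidAlgebra ℤ G}
    (h : SupportedOn K Y) (a : ι → G) (s : Finset ι) (ha : ∀ i ∈ s, a i ∈ K) :
    SupportedOn K (Y * ∏ i ∈ s, (1 + delta (a i))) := by
  classical
  induction s using Finset.induction_on with
  | empty => simpa using h
  | insert i s hi ih =>
    rw [Finset.prod_insert hi, mul_left_comm, mul_comm]
    exact (ih fun j hj => ha j (Finset.mem_insert_of_mem hj)).mul_one_add
      (ha i (Finset.mem_insert_self _ _))

lemma SupportedOn.mem_of_mul_one_add_eq_zero {K : AddSubgroup G} {Y : AddMonoidAlgebra ℤ G}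
    (h : SupportedOn K Y) (hY : Y ≠ 0) {a : G} (h0 : Y * (1 + delta a) = 0) : a ∈ K := by
  by_contra ha
  apply hY
  ext x
  by_cases hx : x ∈ K
  · have h1 : x - a ∉ K := fun h2 => ha (by simpa using K.sub_mem hx h2)
    have := congrArg (fun Z => Z.coeff x) h0
    simpa [mul_add, coeff_mul_delta, h _ h1] using this
  · simpa using h x hx

lemma SupportedOn.mem_of_mul_one_sub_eq_zero {K : AddSubgroup G} {Y : AddMonoidAlgebra ℤ G}
    (h : SupportedOn K Y) (hY : Y ≠ 0) {a : G} (h0 : Y * (1 - delta a) = 0) : a ∈ K := by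
  by_contra ha
  apply hY
  ext x
  by_cases hx : x ∈ K
  · have h1 : x - a ∉ K := fun h2 => ha (by simpa using K.sub_mem hx h2)
    have := congrArg (fun Z => Z.coeff x) h0
    simpa [mul_sub, coeff_mul_delta, h _ h1] using this
  · simpa using h x hx

/-- If `X` is annihilated by `1 + a`, it is invariant under translation by multiples of `2 a`. -/
lemma mul_one_sub_single_eq_zero {X : AddMonoidAlgebra ℤ G} {a : G}
    (h : X * (1 + delta a) = 0) (n : ℕ) : X * (1 - delta (n • (2 • a))) = 0 := by
  have h2 : X * (1 - delta (2 • a)) = 0 := by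
    have : (1 - delta (2 • a) : AddMonoidAlgebra ℤ G) =
        (1 + delta a) * (1 - delta a) := by
      rw [two_nsmul, delta_add]
      ring
    rw [this, ← mul_assoc, h, zero_mul]
  induction n with
  | zero => simp [delta_zero]
  | succ n ih =>
    have h3 : (delta ((n + 1) • (2 • a)) : AddMonoidAlgebra ℤ G) =
        delta (n • (2 • a)) * delta (2 • a) := by
      rw [← delta_add, succ_nsmul]
    rw [h3]
    linear_combination ih * delta (2 • a) + h2

lemma card_sup_zmultiples_le [Finite G] (K : AddSubgroup G) {a : G} (ha : 2 • a ∈ K) :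
    Nat.card ↥(K ⊔ AddSubgroup.zmultiples a) ≤ 2 * Nat.card K := by
  have : Function.Surjective (fun x : Fin 2 × K =>
      (⟨(x.1 : ℕ) • a + x.2, add_mem
        (AddSubgroup.mem_sup_right (nsmul_mem (AddSubgroup.mem_zmultiples a) _))
        (AddSubgroup.mem_sup_left x.2.2)⟩ : ↥(K ⊔ AddSubgroup.zmultiples a))) := by
    rintro ⟨x, hx⟩
    obtain ⟨k, hk, z, hz, rfl⟩ := AddSubgroup.mem_sup.1 hx
    obtain ⟨n, rfl⟩ := AddSubgroup.mem_zmultiples_iff.1 hz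
    have h2 : ∀ l : ℤ, (2 * l) • a ∈ K := fun l => by
      rw [mul_comm, mul_zsmul]
      exact K.zsmul_mem (by rwa [ofNat_zsmul]) l
    rcases Int.even_or_odd' n with ⟨l, rfl | rfl⟩
    · exact ⟨(0, ⟨k + (2 * l) • a, K.add_mem hk (h2 l)⟩), by simp⟩
    · refine ⟨(1, ⟨k + (2 * l) • a, K.add_mem hk (h2 l)⟩), ?_⟩
      simp only [Fin.val_one, one_smul, Subtype.mk.injEq, add_smul]
      abel
  have := Nat.card_le_card_of_surjective _ this
  simpa using this

lemma exists_minimal_prod_eq_zero {ι : Type*} (Y : AddMonoidAlgebra ℤ G) (a : ι → G)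
    (s : Finset ι) (h : Y * ∏ i ∈ s, (1 + delta (a i)) = 0) :
    ∃ J ⊆ s, Y * ∏ i ∈ J, (1 + delta (a i)) = 0 ∧
      ∀ t ⊂ J, Y * ∏ i ∈ t, (1 + delta (a i)) ≠ 0 := by
  classical
  induction s using Finset.strongInduction with
  | H s ih =>
    by_cases h' : ∀ t ⊂ s, Y * ∏ i ∈ t, (1 + delta (a i)) ≠ 0
    · exact ⟨s, subset_rfl, h, h'⟩
    · push Not at h'
      obtain ⟨t, hts, ht⟩ := h'
      obtain ⟨J, hJ, h1⟩ := ih t hts ht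
      exact ⟨J, hJ.trans hts.subset, h1⟩

/-- In a `2`-group, an element whose double is outside `K` has a multiple outside `K`, by a positive
power of two, whose double is in `K`. -/
lemma exists_two_pow_nsmul_notMem (K : AddSubgroup G) {a : G} (hG : ∃ k : ℕ, 2 ^ k • a = 0)
    (ha : 2 • a ∉ K) : ∃ n : ℕ, n • (2 • a) ∉ K ∧ 2 • (n • (2 • a)) ∈ K := by
  classical
  have hex : ∃ k : ℕ, 2 ^ k • (2 • a) ∈ K := by
    obtain ⟨k, hk⟩ := hG
    exact ⟨k, by rw [smul_comm, hk]; simp⟩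
  have h0 : Nat.find hex ≠ 0 := fun h => by
    have := Nat.find_spec hex
    rw [h] at this
    exact ha (by simpa using this)
  obtain ⟨k, hk⟩ := Nat.exists_eq_succ_of_ne_zero h0
  refine ⟨2 ^ k, Nat.find_min hex (by omega), ?_⟩
  have := Nat.find_spec hex
  rw [hk, pow_succ', mul_smul] at this
  exact this

lemma two_mul_card_sup_closure_le [Finite G] {ι : Type*} (a : ι → G)
    (ha : ∀ i, ∃ k : ℕ, 2 ^ k • a i = 0) (s : Finset ι) :
    ∀ (K : AddSubgroup G) (Y : AddMonoidAlgebra ℤ G), Y ≠ 0 → SupportedOn K Y →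
      Y * ∏ i ∈ s, (1 + delta (a i)) = 0 →
      (∀ t ⊂ s, Y * ∏ i ∈ t, (1 + delta (a i)) ≠ 0) →
      2 * Nat.card ↥(K ⊔ AddSubgroup.closure (a '' s)) ≤ 2 ^ s.card * Nat.card K := by
  classical
  induction s using Finset.strongInduction with
  | H s ih =>
    intro K Y hY hK h0 hmin
    have hs : s.Nonempty := by
      rw [Finset.nonempty_iff_ne_empty]
      rintro rfl
      exact hY (by simpa using h0)
    obtain ⟨i, hi⟩ := hs
    have hss : s.erase i ⊂ s := Finset.erase_ssubset hi
    have hcard : (s.erase i).card + 1 = s.card := Finset.card_erase_add_one hi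
    have hX : (Y * ∏ j ∈ s.erase i, (1 + delta (a j))) * (1 + delta (a i)) = 0 := by
      rw [mul_assoc, Finset.prod_erase_mul _ _ hi, h0]
    have hcardmono : ∀ {A B : AddSubgroup G}, A ≤ B → Nat.card A ≤ Nat.card B := fun h =>
      Nat.card_le_card_of_injective _ (AddSubgroup.inclusion_injective h)
    by_cases h2 : 2 • a i ∈ K
    · rcases (s.erase i).eq_empty_or_nonempty with hE | hE
      · have hs1 : s = {i} := by
          rw [← Finset.insert_erase hi, hE]; rfl
        subst hs1
        have hai : a i ∈ K := hK.mem_of_mul_one_add_eq_zero hY (by simpa using h0)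
        have : K ⊔ AddSubgroup.closure (a '' (({i} : Finset ι) : Set ι)) = K := by
          simpa using hai
        rw [this]; simp
      · have hK1 : K ≤ K ⊔ AddSubgroup.zmultiples (a i) := le_sup_left
        have hai : a i ∈ K ⊔ AddSubgroup.zmultiples (a i) :=
          AddSubgroup.mem_sup_right (AddSubgroup.mem_zmultiples _)
        have key := ih (s.erase i) hss (K ⊔ AddSubgroup.zmultiples (a i))
          (Y * (1 + delta (a i))) (by
            have := hmin {i} (by
              rw [Finset.ssubset_iff_subset_ne]
              refine ⟨by simpa using hi, ?_⟩
              rintro rfl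
              simp at hE)
            simpa using this) ((hK.mono hK1).mul_one_add hai)
          (by rw [mul_right_comm]; exact hX) (by
            intro t ht
            have hit : i ∉ t := fun h => by simpa using ht.subset h
            rw [mul_assoc, ← Finset.prod_insert (f := fun j => 1 + delta (a j)) hit]
            refine hmin _ ?_
            rw [Finset.ssubset_iff_subset_ne]
            refine ⟨Finset.insert_subset hi (ht.subset.trans hss.subset), ?_⟩
            rintro rfl
            rw [Finset.erase_insert hit] at ht
            exact ht.ne rfl)
        have hle : K ⊔ AddSubgroup.closure (a '' s) ≤
            K ⊔ AddSubgroup.zmultiples (a i) ⊔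
              AddSubgroup.closure (a '' ((s.erase i : Finset ι) : Set ι)) := by
          refine sup_le (hK1.trans le_sup_left) ?_
          rw [AddSubgroup.closure_le]
          rintro _ ⟨j, hj, rfl⟩
          by_cases hji : j = i
          · subst hji
            exact AddSubgroup.mem_sup_left hai
          · exact AddSubgroup.mem_sup_right (AddSubgroup.subset_closure
              ⟨j, by simpa [hji] using hj, rfl⟩)
        calc _ ≤ _ := Nat.mul_le_mul_left 2 (hcardmono hle)
          _ ≤ _ := key
          _ ≤ 2 ^ (s.erase i).card * (2 * Nat.card K) :=
            Nat.mul_le_mul_left _ (card_sup_zmultiples_le K h2)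
          _ = _ := by rw [← hcard, pow_succ]; ring
    · obtain ⟨n, hn1, hn2⟩ := exists_two_pow_nsmul_notMem K (ha i) h2
      set h := n • (2 • a i) with hh
      have hXh := mul_one_sub_single_eq_zero hX n
      rw [← hh] at hXh
      set K2 := K ⊔ AddSubgroup.zmultiples h with hK2
      have hKK2 : K ≤ K2 := le_sup_left
      have hhK2 : h ∈ K2 := AddSubgroup.mem_sup_right (AddSubgroup.mem_zmultiples _)
      have hY2 : Y * (1 - delta h) ≠ 0 := fun h' => hn1 (hK.mem_of_mul_one_sub_eq_zero hY h')
      obtain ⟨J, hJs, hJ0, hJmin⟩ := exists_minimal_prod_eq_zero (Y * (1 - delta h)) a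
        (s.erase i) (by rw [mul_right_comm]; exact hXh)
      have hJne : J.Nonempty := by
        rw [Finset.nonempty_iff_ne_empty]
        rintro rfl
        exact hY2 (by simpa using hJ0)
      have hJs' : J ⊂ s := Finset.ssubset_of_subset_of_ssubset hJs hss
      have key1 := ih J hJs' K2 (Y * (1 - delta h)) hY2
        ((hK.mono hKK2).mul_one_sub hhK2) hJ0 hJmin
      set K3 := K2 ⊔ AddSubgroup.closure (a '' J) with hK3
      have hdis : Disjoint J (s \ J) := Finset.disjoint_sdiff
      have key2 := ih (s \ J) (Finset.sdiff_ssubset hJs'.subset hJne) K3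
        (Y * ∏ j ∈ J, (1 + delta (a j))) (hmin J hJs')
        ((hK.mono (hKK2.trans le_sup_left)).mul_prod a J fun j hj =>
          AddSubgroup.mem_sup_right (AddSubgroup.subset_closure ⟨j, hj, rfl⟩))
        (by rw [mul_assoc, ← Finset.prod_union hdis, Finset.union_sdiff_of_subset hJs'.subset, h0])
        (by
          intro t ht
          have hd : Disjoint J t := hdis.mono_right ht.subset
          rw [mul_assoc, ← Finset.prod_union hd]
          refine hmin _ ?_
          obtain ⟨x, hx, hxt⟩ := Finset.exists_of_ssubset ht
          rw [Finset.mem_sdiff] at hx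
          rw [Finset.ssubset_iff_of_subset
            (Finset.union_subset hJs'.subset (ht.subset.trans Finset.sdiff_subset))]
          exact ⟨x, hx.1, by simp [hx.2, hxt]⟩)
      have hle : K ⊔ AddSubgroup.closure (a '' s) ≤
          K3 ⊔ AddSubgroup.closure (a '' ((s \ J : Finset ι) : Set ι)) := by
        refine sup_le ((hKK2.trans le_sup_left).trans le_sup_left) ?_
        rw [AddSubgroup.closure_le]
        rintro _ ⟨j, hj, rfl⟩
        by_cases hjJ : j ∈ J
        · exact AddSubgroup.mem_sup_left (AddSubgroup.mem_sup_right
            (AddSubgroup.subset_closure ⟨j, hjJ, rfl⟩))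
        · exact AddSubgroup.mem_sup_right (AddSubgroup.subset_closure
            ⟨j, by simpa [hjJ] using hj, rfl⟩)
      have hc : (s \ J).card + J.card = s.card := Finset.card_sdiff_add_card_eq_card hJs'.subset
      have h3 : Nat.card K3 ≤ 2 ^ J.card * Nat.card K := by
        have h4 := Nat.mul_le_mul_left (2 ^ J.card) (card_sup_zmultiples_le K hn2)
        rw [← hK2] at h4
        linarith
      calc _ ≤ _ := Nat.mul_le_mul_left 2 (hcardmono hle)
        _ ≤ _ := key2
        _ ≤ 2 ^ (s \ J).card * (2 ^ J.card * Nat.card K) := Nat.mul_le_mul_left _ h3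
        _ = _ := by rw [← hc, pow_add]; ring

/-- **Hajós' theorem** for `2`-groups: if a `2`-group is the direct sum of the two-element subsets
`{0, a i}`, then one of these is a subgroup. -/
theorem exists_two_nsmul_eq_zero [Finite G] {ι : Type*} (a : ι → G)
    (ha : ∀ i, ∃ k : ℕ, 2 ^ k • a i = 0) (s : Finset ι) (hs : s.Nonempty)
    (hinj : ∀ t ⊆ s, ∀ u ⊆ s, ∑ i ∈ t, a i = ∑ i ∈ u, a i → t = u) :
    ∀ H : AddSubgroup G, (∀ i ∈ s, a i ∈ H) → Nat.card H ≤ 2 ^ s.card →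
      ∃ i ∈ s, 2 • a i = 0 := by
  classical
  induction s using Finset.strongInduction with
  | H s ih =>
    intro H haH hcard
    obtain ⟨i, hi⟩ := hs
    by_contra! hcon
    have hss : s.erase i ⊂ s := Finset.erase_ssubset hi
    have hprod : ∀ g ∈ H, (∏ j ∈ s, (1 + delta (a j))) * delta g =
        ∏ j ∈ s, (1 + delta (a j)) := by
      have hsum : ∏ j ∈ s, (1 + delta (a j)) =
          ∑ t ∈ s.powerset, delta (∑ j ∈ t, a j) := by
        rw [Finset.prod_one_add]
        refine Finset.sum_congr rfl fun t ht => ?_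
        clear ht
        induction t using Finset.induction_on with
        | empty => simp [delta_zero]
        | insert j t hj ih => rw [Finset.prod_insert hj, ih, Finset.sum_insert hj, delta_add]
      let S : Finset G := s.powerset.image fun t => ∑ j ∈ t, a j
      have hinjOn : Set.InjOn (fun t : Finset ι => ∑ j ∈ t, a j) (s.powerset : Set (Finset ι)) :=
        fun t ht u hu h => hinj t (by simpa using ht) u (by simpa using hu) h
      have hScard : S.card = 2 ^ s.card := by
        rw [Finset.card_image_of_injOn hinjOn, Finset.card_powerset]
      have hSH : (S : Set G) = H := by
        have hsub : (S : Set G) ⊆ H := by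
          intro x hx
          obtain ⟨t, ht, rfl⟩ := Finset.mem_image.1 hx
          exact H.sum_mem fun j hj => haH j (Finset.mem_powerset.1 ht hj)
        refine Set.eq_of_subset_of_ncard_le hsub ?_ (Set.toFinite _)
        rw [Set.ncard_coe_finset, hScard]
        exact hcard
      have hSsum : ∏ j ∈ s, (1 + delta (a j)) = ∑ x ∈ S, delta x := by
        rw [hsum, Finset.sum_image hinjOn]
      intro g hg
      rw [hSsum, Finset.sum_mul]
      have hmem : ∀ x, x ∈ S ↔ x ∈ H := fun x => by
        rw [← Finset.mem_coe, hSH]; rfl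
      refine Finset.sum_bij (fun x _ => x + g) (fun x hx => ?_) (fun x _ y _ h => by simpa using h)
        (fun x hx => ⟨x - g, ?_, by simp⟩) (fun x _ => by rw [delta_add])
      · rw [hmem] at hx ⊢
        exact H.add_mem hx hg
      · rw [hmem] at hx ⊢
        exact H.sub_mem hx hg
    obtain ⟨n, hn1, hn2⟩ := exists_two_pow_nsmul_notMem (⊥ : AddSubgroup G) (ha i)
      (by simpa using hcon i hi)
    have hX : (∏ j ∈ s.erase i, (1 + delta (a j))) * (1 - delta (2 • a i)) = 0 := by
      have h1 : (1 - delta (2 • a i) : AddMonoidAlgebra ℤ G) =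
          (1 + delta (a i)) * (1 - delta (a i)) := by
        rw [two_nsmul, delta_add]
        ring
      rw [h1, ← mul_assoc, Finset.prod_erase_mul _ _ hi, mul_sub, mul_one, hprod _ (haH i hi),
        sub_self]
    have hXn : ∀ n : ℕ, (∏ j ∈ s.erase i, (1 + delta (a j))) *
        (1 - delta (n • (2 • a i))) = 0 := by
      intro n
      induction n with
      | zero => simp [delta_zero]
      | succ n ih =>
        have h3 : (delta ((n + 1) • (2 • a i)) : AddMonoidAlgebra ℤ G) =
            delta (n • (2 • a i)) * delta (2 • a i) := by
          rw [← delta_add, succ_nsmul]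
        rw [h3]
        linear_combination ih * delta (2 • a i) + hX
    set h := n • (2 • a i) with hh
    have hY : (1 - delta h : AddMonoidAlgebra ℤ G) ≠ 0 := by
      intro h0
      have := congrArg (fun Z => Z.coeff 0) h0
      have hne : h ≠ 0 := by simpa using hn1
      simp [coeff_delta_zero hne] at this
    have hsup : SupportedOn (AddSubgroup.zmultiples h) (1 - delta h : AddMonoidAlgebra ℤ G) := by
      have h1 : SupportedOn (AddSubgroup.zmultiples h) (1 : AddMonoidAlgebra ℤ G) := by
        intro x hx
        have : x ≠ 0 := by
          rintro rfl
          exact hx (zero_mem _)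
        exact coeff_one_of_ne_zero this
      simpa using h1.mul_one_sub (AddSubgroup.mem_zmultiples h)
    obtain ⟨J, hJs, hJ0, hJmin⟩ := exists_minimal_prod_eq_zero (1 - delta h) a
        (s.erase i) (by rw [mul_comm]; exact hXn n)
    have hJne : J.Nonempty := by
      rw [Finset.nonempty_iff_ne_empty]
      rintro rfl
      exact hY (by simpa using hJ0)
    have hJs' : J ⊂ s := Finset.ssubset_of_subset_of_ssubset hJs hss
    have key := two_mul_card_sup_closure_le a ha J _ _ hY hsup hJ0 hJmin
    have hcz : Nat.card (AddSubgroup.zmultiples h) ≤ 2 := by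
      have := card_sup_zmultiples_le ⊥ hn2
      rw [bot_sup_eq] at this
      simpa using this
    obtain ⟨j, hj, hj2⟩ := ih J hJs' hJne
      (fun t ht u hu => hinj t (ht.trans hJs'.subset) u (hu.trans hJs'.subset))
      (AddSubgroup.zmultiples h ⊔ AddSubgroup.closure (a '' J))
      (fun j hj => AddSubgroup.mem_sup_right (AddSubgroup.subset_closure ⟨j, hj, rfl⟩))
      (by nlinarith [Nat.mul_le_mul_left (2 ^ J.card) hcz])
    exact hcon j (hJs'.subset hj) hj2

end Hajos

section Tiling

variable {ι κ : Type*}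

/-- The half-open unit cube with corner `t`. -/
def unitCube (t : ι → ℝ) : Set (ι → ℝ) := {x | ∀ i, t i ≤ x i ∧ x i < t i + 1}

/-- The unit cubes with corners `τ k` tile the space. -/
def IsCubeTiling (τ : κ → ι → ℝ) : Prop := ∀ x, ∃! k, x ∈ unitCube (τ k)

variable [DecidableEq ι]

lemma IsCubeTiling.exists_next {τ : κ → ι → ℝ} (h : IsCubeTiling τ) {x : ι → ℝ} {k : κ}
    (hk : x ∈ unitCube (τ k)) (i : ι) :
    ∃ l, τ l i = τ k i + 1 ∧ Function.update x i (τ k i + 1) ∈ unitCube (τ l) := by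
  obtain ⟨l, hl, -⟩ := h (Function.update x i (τ k i + 1))
  refine ⟨l, ?_, hl⟩
  have hli := hl i
  simp only [Function.update_self] at hli
  refine le_antisymm hli.1 (not_lt.1 fun hlt => ?_)
  obtain ⟨p, -, hp⟩ := h (Function.update x i (τ l i))
  have h1 : l = p := hp l fun j => by
    by_cases hj : j = i
    · subst hj; simp
    · simpa [hj] using hl j
  have h2 : k = p := hp k fun j => by
    by_cases hj : j = i
    · subst hj
      simp only [Function.update_self]
      constructor <;> linarith
    · simpa [hj] using hk j
  rw [h1, ← h2] at hli
  rw [h1, ← h2] at hlt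
  linarith

lemma IsCubeTiling.exists_add_nat {τ : κ → ι → ℝ} (h : IsCubeTiling τ) {x : ι → ℝ} {k : κ}
    (hk : x ∈ unitCube (τ k)) (i : ι) (n : ℕ) :
    ∃ l, τ l i = τ k i + n ∧ Function.update x i (τ k i + n) ∈ unitCube (τ l) := by
  induction n with
  | zero =>
    refine ⟨k, by simp, fun j => ?_⟩
    by_cases hj : j = i
    · subst hj; simp
    · simpa [hj] using hk j
  | succ n ih =>
    obtain ⟨l, hl, hx⟩ := ih
    obtain ⟨p, hp, hy⟩ := h.exists_next hx i
    refine ⟨p, by rw [hp, hl]; push_cast; ring, ?_⟩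
    rw [hl, Function.update_idem] at hy
    push_cast
    rwa [← add_assoc]

/-- In a cube tiling, the cubes met by a line parallel to a coordinate axis have corners that are
congruent modulo `1` in that coordinate. -/
lemma IsCubeTiling.exists_int_of_column {τ : κ → ι → ℝ} (h : IsCubeTiling τ) {x y : ι → ℝ}
    {k l : κ} (hk : x ∈ unitCube (τ k)) (hl : y ∈ unitCube (τ l)) (i : ι)
    (hxy : ∀ j, j ≠ i → x j = y j) : ∃ n : ℤ, τ l i = τ k i + n := by
  have key : ∀ (x y : ι → ℝ) (k l : κ), x ∈ unitCube (τ k) → y ∈ unitCube (τ l) →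
      (∀ j, j ≠ i → x j = y j) → τ k i ≤ y i → ∃ n : ℤ, τ l i = τ k i + n := by
    intro x y k l hk hl hxy hle
    obtain ⟨p, hp, hx⟩ := h.exists_add_nat hk i ⌊y i - τ k i⌋₊
    obtain ⟨q, -, hq⟩ := h y
    have h1 : p = q := hq p fun j => by
      by_cases hj : j = i
      · subst hj
        rw [hp]
        have h2 := Nat.floor_le (sub_nonneg.2 hle)
        have h3 := Nat.lt_floor_add_one (y j - τ k j)
        constructor <;> linarith
      · simpa [hj, hxy j hj] using hx j
    have h2 : l = q := hq l hl
    exact ⟨⌊y i - τ k i⌋₊, by rw [h2, ← h1, hp]; simp⟩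
  by_cases hle : τ k i ≤ y i
  · exact key x y k l hk hl hxy hle
  · have h1 := (hl i).1
    have h2 := (hk i).1
    obtain ⟨n, hn⟩ := key y x l k hl hk (fun j hj => (hxy j hj).symm) (by linarith)
    exact ⟨-n, by rw [hn]; push_cast; ring⟩

open Classical in
/-- Shifting all cubes of a tiling that lie in one congruence class in the direction `i`. -/
noncomputable def shiftClass (τ : κ → ι → ℝ) (i : ι) (c δ : ℝ) (k : κ) : ι → ℝ :=
  if ∃ n : ℤ, τ k i = c + n then Function.update (τ k) i (τ k i + δ) else τ k

lemma mem_unitCube_update_add {t x : ι → ℝ} {i : ι} {δ : ℝ} :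
    x ∈ unitCube (Function.update t i (t i + δ)) ↔
      Function.update x i (x i - δ) ∈ unitCube t := by
  refine forall_congr' fun j => ?_
  by_cases hj : j = i
  · subst hj
    simp only [Function.update_self]
    constructor <;> rintro ⟨h1, h2⟩ <;> constructor <;> linarith
  · simp [hj]

lemma IsCubeTiling.shiftClass {τ : κ → ι → ℝ} (h : IsCubeTiling τ) (i : ι) (c δ : ℝ) :
    IsCubeTiling (shiftClass τ i c δ) := by
  intro x
  obtain ⟨k, hk, hku⟩ := h x
  obtain ⟨l, hl, hlu⟩ := h (Function.update x i (x i - δ))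
  have hline : ∀ j, j ≠ i → x j = Function.update x i (x i - δ) j := fun j hj => by simp [hj]
  by_cases hc : ∃ n : ℤ, τ k i = c + n
  · have hcl : ∃ n : ℤ, τ l i = c + n := by
      obtain ⟨n, hn⟩ := h.exists_int_of_column hk hl i hline
      obtain ⟨m, hm⟩ := hc
      exact ⟨m + n, by rw [hn, hm]; push_cast; ring⟩
    refine ⟨l, ?_, fun p hp => ?_⟩
    · simp only [WeightedDirichlet.shiftClass, if_pos hcl]
      exact mem_unitCube_update_add.2 hl
    · by_cases hcp : ∃ n : ℤ, τ p i = c + n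
      · simp only [WeightedDirichlet.shiftClass, if_pos hcp] at hp
        exact hlu p (mem_unitCube_update_add.1 hp)
      · simp only [WeightedDirichlet.shiftClass, if_neg hcp] at hp
        rw [hku p hp] at hcp
        exact absurd hc hcp
  · refine ⟨k, ?_, fun p hp => ?_⟩
    · simp only [WeightedDirichlet.shiftClass, if_neg hc]
      exact hk
    · by_cases hcp : ∃ n : ℤ, τ p i = c + n
      · simp only [WeightedDirichlet.shiftClass, if_pos hcp] at hp
        obtain ⟨n, hn⟩ := h.exists_int_of_column hk (mem_unitCube_update_add.1 hp) i hline
        obtain ⟨m, hm⟩ := hcp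
        exact absurd ⟨m - n, by push_cast; linarith⟩ hc
      · simp only [WeightedDirichlet.shiftClass, if_neg hcp] at hp
        exact hku p hp

/-- **Keller's theorem**: the corners of two different cubes of a tiling have some coordinate in
which they differ by a nonzero integer. -/
theorem IsCubeTiling.exists_int_sub [Fintype ι] {τ : κ → ι → ℝ} (h : IsCubeTiling τ) {k l : κ}
    (hkl : k ≠ l) : ∃ i, ∃ n : ℤ, n ≠ 0 ∧ τ k i - τ l i = n := by
  induction hd : (Finset.univ.filter fun i => τ k i ≠ τ l i).card using Nat.strong_induction_on
    generalizing τ with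
  | _ d ih =>
    by_contra! hcon
    by_cases hE : ∃ i, τ k i ≠ τ l i
    · obtain ⟨i, hi⟩ := hE
      have hni : ¬ ∃ n : ℤ, τ k i = τ l i + n := by
        rintro ⟨n, hn⟩
        refine hcon i n ?_ (by rw [hn]; ring)
        rintro rfl
        exact hi (by simpa using hn)
      set τ' := WeightedDirichlet.shiftClass τ i (τ l i) (τ k i - τ l i) with hτ'
      have h1 : τ' k = τ k := by
        simp only [hτ', WeightedDirichlet.shiftClass, if_neg hni]
      have h2 : τ' l = Function.update (τ l) i (τ k i) := by
        have : ∃ n : ℤ, τ l i = τ l i + n := ⟨0, by simp⟩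
        simp only [hτ', WeightedDirichlet.shiftClass, if_pos this, add_sub_cancel]
      have hT : IsCubeTiling τ' := h.shiftClass i (τ l i) (τ k i - τ l i)
      obtain ⟨j, n, hn, hj⟩ := ih (Finset.univ.filter fun j => τ' k j ≠ τ' l j).card (by
        rw [← hd]
        refine Finset.card_lt_card ?_
        rw [Finset.ssubset_iff_of_subset]
        · exact ⟨i, by simp [hi], by simp [h1, h2]⟩
        · intro j
          simp only [Finset.mem_filter, Finset.mem_univ, true_and, h1, h2]
          intro hj hj'
          by_cases hji : j = i
          · subst hji; simp at hj
          · simp [hji, hj'] at hj) hT rfl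
      rw [h1, h2] at hj
      by_cases hji : j = i
      · subst hji
        simp at hj
        exact hn (by exact_mod_cast hj.symm)
      · exact hcon j n hn (by simpa [hji] using hj)
    · push Not at hE
      obtain ⟨p, -, hp⟩ := h (τ k)
      exact hkl ((hp k fun i => by simp).trans (hp l fun i => by simp [hE]).symm)

end Tiling

section Perturbation

open MeasureTheory

variable {ι : Type*}

/-- The real vector with the coordinates of an integer vector. -/
def toReal (z : ι → ℤ) : ι → ℝ := fun i => (z i : ℝ)

lemma toReal_injective : Function.Injective (toReal : (ι → ℤ) → ι → ℝ) := fun z w h => by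
  ext i
  exact Int.cast_injective (congrFun h i)

@[simp] lemma toReal_apply (z : ι → ℤ) (i : ι) : toReal z i = z i := rfl

lemma toReal_sub (z w : ι → ℤ) : toReal (z - w) = toReal z - toReal w := by
  ext i; simp

lemma toReal_add (z w : ι → ℤ) : toReal (z + w) = toReal z + toReal w := by
  ext i; simp

lemma toReal_zero : toReal (0 : ι → ℤ) = 0 := by
  ext i; simp

variable [Fintype ι]

lemma mulVec_toReal_eq_zero [DecidableEq ι] {M : Matrix ι ι ℝ} (hM : M.det ≠ 0) {z : ι → ℤ}
    (h : M *ᵥ toReal z = 0) : z = 0 :=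
  toReal_injective ((Matrix.eq_zero_of_mulVec_eq_zero hM h).trans toReal_zero.symm)

/-- **Blichfeldt's theorem** for the lattice spanned by the columns of a matrix. -/
lemma exists_sub_eq_mulVec [DecidableEq ι] {M : Matrix ι ι ℝ} (hM : M.det ≠ 0) {S : Set (ι → ℝ)}
    (hS : MeasurableSet S) (hvol : ENNReal.ofReal |M.det| < volume S) :
    ∃ u ∈ S, ∃ v ∈ S, ∃ z : ι → ℤ, z ≠ 0 ∧ u - v = M *ᵥ toReal z := by
  have hunit : IsUnit M.det := isUnit_iff_ne_zero.2 hM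
  let b : Module.Basis ι ℝ (ι → ℝ) :=
    (Pi.basisFun ℝ ι).map (Matrix.toLinearEquiv' M (Matrix.invertibleOfIsUnitDet M hunit))
  have hb : ∀ i, b i = M.col i := fun i => by
    simp only [b, Module.Basis.map_apply, Pi.basisFun_apply]
    exact Matrix.mulVec_single_one M i
  have hdet : (Matrix.of b).det = M.det := by
    rw [← Matrix.det_transpose]
    congr 1
    ext i j
    simp [hb]
  have : Countable (Submodule.span ℤ (Set.range b)).toAddSubgroup :=
    (inferInstance : Countable (Submodule.span ℤ (Set.range b)))
  obtain ⟨x, y, hxy, hd⟩ := exists_pair_mem_lattice_not_disjoint_vadd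
    (L := (Submodule.span ℤ (Set.range b)).toAddSubgroup) (ZSpan.isAddFundamentalDomain' b volume)
    hS.nullMeasurableSet (by rwa [ZSpan.volume_fundamentalDomain, hdet])
  rw [Set.not_disjoint_iff] at hd
  obtain ⟨w, ⟨u, hu, hu'⟩, v, hv, hv'⟩ := hd
  have hxyw : u - v = ((y - x : (Submodule.span ℤ (Set.range b)).toAddSubgroup) : ι → ℝ) := by
    have h1 : (x : ι → ℝ) + u = w := hu'
    have h2 : (y : ι → ℝ) + v = w := hv'
    rw [AddSubgroup.coe_sub, sub_eq_sub_iff_add_eq_add, add_comm u, h1, h2]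
  obtain ⟨c, hc⟩ := (Submodule.mem_span_range_iff_exists_fun ℤ).1 (y - x).2
  have hc' : M *ᵥ toReal c = ((y - x : (Submodule.span ℤ (Set.range b)).toAddSubgroup) : ι → ℝ) := by
    rw [← hc, Matrix.mulVec_eq_sum]
    refine Finset.sum_congr rfl fun i _ => ?_
    ext j
    simp [hb, mul_comm]
  refine ⟨u, hu, v, hv, c, ?_, hxyw.trans hc'.symm⟩
  rintro rfl
  rw [toReal_zero, Matrix.mulVec_zero] at hc'
  exact hxy (sub_eq_zero.1 (Subtype.ext hc'.symm)).symm

lemma volume_Ico_cube (x : ι → ℝ) {s : ℝ} (hs : 0 ≤ s) :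
    volume (Set.univ.pi fun i => Set.Ico (x i) (x i + s)) =
      ENNReal.ofReal (s ^ Fintype.card ι) := by
  rw [volume_pi_pi]
  simp [ENNReal.ofReal_pow hs]

/-- Every nonzero vector of the lattice spanned by the columns of `M` has a coordinate that is a
nonzero integer. -/
def HasIntegerCoord (M : Matrix ι ι ℝ) : Prop :=
  ∀ z : ι → ℤ, z ≠ 0 → ∃ i, ∃ n : ℤ, n ≠ 0 ∧ (M *ᵥ toReal z) i = n

lemma dotProduct_map_toReal (f : ℝ →ₗ[ℚ] ℝ) (r : ι → ℝ) (z : ι → ℤ) :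
    (fun j => f (r j)) ⬝ᵥ toReal z = f (r ⬝ᵥ toReal z) := by
  simp only [dotProduct, toReal_apply, map_sum]
  refine Finset.sum_congr rfl fun j _ => ?_
  rw [mul_comm, mul_comm (r j), ← zsmul_eq_mul, ← zsmul_eq_mul, map_zsmul]

variable [DecidableEq ι]

lemma HasIntegerCoord.one_le_abs_det {M : Matrix ι ι ℝ} (h : HasIntegerCoord M)
    (hM : M.det ≠ 0) : 1 ≤ |M.det| := by
  by_contra! hlt
  obtain ⟨u, hu, v, hv, z, hz, hzuv⟩ := exists_sub_eq_mulVec hM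
    (S := Set.univ.pi fun _ => Set.Ico 0 (0 + 1))
    (MeasurableSet.univ_pi fun _ => measurableSet_Ico) (by
      rw [volume_Ico_cube (fun _ => 0) zero_le_one, one_pow]
      exact (ENNReal.ofReal_lt_ofReal_iff one_pos).2 hlt)
  obtain ⟨i, n, hn, hi⟩ := h z hz
  rw [← hzuv, Pi.sub_apply] at hi
  have h1 := hu i trivial
  have h2 := hv i trivial
  simp only [zero_add, Set.mem_Ico] at h1 h2
  have h3 : |(n : ℝ)| < 1 := by
    rw [← hi, abs_lt]
    constructor <;> linarith
  have h4 : |n| < 1 := by exact_mod_cast h3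
  exact hn (Int.abs_lt_one_iff.1 h4)

lemma HasIntegerCoord.updateRow {M : Matrix ι ι ℝ} (h : HasIntegerCoord M) (f : ℝ →ₗ[ℚ] ℝ)
    (hf : f 1 = 1) (i : ι) : HasIntegerCoord (M.updateRow i fun j => f (M i j)) := by
  intro z hz
  obtain ⟨k, n, hn, hk⟩ := h z hz
  refine ⟨k, n, hn, ?_⟩
  by_cases hki : k = i
  · subst hki
    have h1 : ((M.updateRow k fun j => f (M k j)) *ᵥ toReal z) k =
        (fun j => f (M k j)) ⬝ᵥ toReal z := by
      simp [mulVec]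
    rw [h1, dotProduct_map_toReal, show M k ⬝ᵥ toReal z = n from hk]
    have := map_zsmul f n 1
    simpa [hf] using this
  · rw [← hk]
    simp [mulVec, hki]

/-- Transforming a row of a matrix with integer coordinates by an additive map that fixes `1` does
not change the determinant. -/
lemma HasIntegerCoord.det_updateRow {M : Matrix ι ι ℝ} (h : HasIntegerCoord M)
    (f : ℝ →ₗ[ℚ] ℝ) (hf : f 1 = 1) (i : ι) :
    (M.updateRow i fun j => f (M i j)).det = M.det := by
  by_contra hne
  set D := (M.updateRow i fun j => f (M i j)).det with hD
  have hdet : ∀ s : ℝ, (M.updateRow i fun j => ((1 - s) * M i j + s * f (M i j))).det =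
      (1 - s) * M.det + s * D := by
    intro s
    have : (fun j => ((1 - s) * M i j + s * f (M i j))) =
        (1 - s) • M i + s • fun j => f (M i j) := by
      ext j; simp
    rw [this, Matrix.det_updateRow_add, Matrix.det_updateRow_smul, Matrix.det_updateRow_smul,
      Matrix.updateRow_eq_self]
  have hs : ∀ s : ℝ, (1 - s) * M.det + s * D ≠ 0 → 1 ≤ |(1 - s) * M.det + s * D| := by
    intro s h0
    let g : ℝ →ₗ[ℚ] ℝ := (LinearMap.mulLeft ℚ (1 - s)) + (LinearMap.mulLeft ℚ s) ∘ₗ f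
    have h1 := h.updateRow g (by simp [g, hf]) i
    have h2 := h1.one_le_abs_det (by
      have := hdet s
      simp only [g, LinearMap.add_apply, LinearMap.mulLeft_apply, LinearMap.comp_apply]
      rwa [this])
    simp only [g, LinearMap.add_apply, LinearMap.mulLeft_apply, LinearMap.comp_apply] at h2
    rwa [hdet] at h2
  have hDM : D - M.det ≠ 0 := sub_ne_zero.2 hne
  have h3 : (1 - (1 / 2 - M.det) / (D - M.det)) * M.det + (1 / 2 - M.det) / (D - M.det) * D =
      1 / 2 := by
    field_simp
    ring
  have := hs ((1 / 2 - M.det) / (D - M.det)) (by rw [h3]; norm_num)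
  rw [h3] at this
  norm_num [abs_of_pos] at this

lemma HasIntegerCoord.map {M : Matrix ι ι ℝ} (h : HasIntegerCoord M)
    (f : ℝ →ₗ[ℚ] ℝ) (hf : f 1 = 1) :
    HasIntegerCoord (M.map f) ∧ (M.map f).det = M.det := by
  have key : ∀ s : Finset ι, ∃ N : Matrix ι ι ℝ, (∀ i ∈ s, ∀ j, N i j = f (M i j)) ∧
      (∀ i, i ∉ s → ∀ j, N i j = M i j) ∧ HasIntegerCoord N ∧ N.det = M.det := by
    intro s
    induction s using Finset.induction_on with
    | empty => exact ⟨M, by simp, by simp, h, rfl⟩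
    | insert i s hi ih =>
      obtain ⟨N, h1, h2, h3, h4⟩ := ih
      refine ⟨N.updateRow i fun j => f (N i j), ?_, ?_, h3.updateRow f hf i,
        (h3.det_updateRow f hf i).trans h4⟩
      · intro k hk j
        by_cases hki : k = i
        · subst hki
          simp [h2 k hi]
        · simp [hki, h1 k (by simpa [hki] using hk)]
      · intro k hk j
        simp only [Finset.mem_insert, not_or] at hk
        simp [hk.1, h2 k hk.2]
  obtain ⟨N, h1, -, h3, h4⟩ := key Finset.univ
  have : N = M.map f := by
    ext i j
    simp [h1 i (Finset.mem_univ i)]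
  rw [← this]
  exact ⟨h3, h4⟩

/-- Finitely many real numbers can be approximated by an additive map that fixes `1` and takes
dyadic values up to a fixed odd denominator. -/
lemma exists_odd_forall_exists_linearMap (F : Finset ℝ) :
    ∃ N : ℕ, Odd N ∧ ∀ ε : ℝ, 0 < ε → ∃ f : ℝ →ₗ[ℚ] ℝ, f 1 = 1 ∧
      ∀ x ∈ F, |f x - x| < ε ∧ ∃ v : ℕ, ∃ n : ℤ, 2 ^ v * (N * f x) = n := by
  obtain ⟨I, b, i₀, hi₀⟩ : ∃ (I : Type) (b : Module.Basis I ℚ ℝ) (i₀ : I), b i₀ = 1 := by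
    have hli : LinearIndepOn ℚ id ({1} : Set ℝ) := LinearIndepOn.singleton one_ne_zero
    have h1 : (1 : ℝ) ∈ Set.range (Module.Basis.extend hli) := by
      rw [Module.Basis.range_extend]
      exact hli.subset_extend _ rfl
    exact ⟨_, _, h1⟩
  set D : ℕ := ∏ x ∈ F, ∏ i ∈ (b.repr x).support, (b.repr x i).den with hD
  have hD0 : D ≠ 0 := Finset.prod_ne_zero_iff.2 fun x _ =>
    Finset.prod_ne_zero_iff.2 fun i _ => (b.repr x i).den_nz
  obtain ⟨v, N, hN, hDN⟩ := Nat.exists_eq_two_pow_mul_odd hD0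
  refine ⟨N, hN, fun ε hε => ?_⟩
  set B : ℝ := ∑ x ∈ F, ∑ i ∈ (b.repr x).support, |(b.repr x i : ℝ)| with hB
  have hB0 : 0 ≤ B := Finset.sum_nonneg fun x _ => Finset.sum_nonneg fun i _ => abs_nonneg _
  obtain ⟨w, hw⟩ := pow_unbounded_of_one_lt (B / ε) (one_lt_two : (1 : ℝ) < 2)
  have h2w : (0 : ℝ) < 2 ^ w := by positivity
  set t : ℝ → ℝ := fun y => ⌊y * 2 ^ w⌋ / 2 ^ w with ht
  have htb : ∀ y, |t y - y| ≤ 1 / 2 ^ w := by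
    intro y
    have h1 : t y - y = - (Int.fract (y * 2 ^ w) / 2 ^ w) := by
      rw [ht, Int.fract]
      field_simp
      ring
    rw [h1, abs_neg, abs_of_nonneg (by positivity)]
    gcongr
    exact (Int.fract_lt_one _).le
  refine ⟨b.constr ℚ fun i => t (b i), ?_, fun x hx => ⟨?_, v + w,
    ∑ i ∈ (b.repr x).support, (D * b.repr x i).num * ⌊b i * 2 ^ w⌋, ?_⟩⟩
  · conv_lhs => rw [← hi₀]
    rw [Module.Basis.constr_basis, hi₀, ht]
    have : ((1 : ℝ) * 2 ^ w) = ((2 ^ w : ℤ) : ℝ) := by push_cast; ring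
    simp only [this, Int.floor_intCast]
    push_cast
    exact div_self h2w.ne'
  · have hxs : x = ∑ i ∈ (b.repr x).support, (b.repr x i : ℝ) * b i := by
      conv_lhs => rw [← b.linearCombination_repr x, Finsupp.linearCombination_apply, Finsupp.sum]
      exact Finset.sum_congr rfl fun i _ => Rat.smul_def _ _
    have hfx : b.constr ℚ (fun i => t (b i)) x =
        ∑ i ∈ (b.repr x).support, (b.repr x i : ℝ) * t (b i) := by
      rw [Module.Basis.constr_apply, Finsupp.sum]
      exact Finset.sum_congr rfl fun i _ => Rat.smul_def _ _
    have h1 : b.constr ℚ (fun i => t (b i)) x - x =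
        ∑ i ∈ (b.repr x).support, (b.repr x i : ℝ) * (t (b i) - b i) := by
      simp only [mul_sub, Finset.sum_sub_distrib]
      rw [hfx, ← hxs]
    rw [h1]
    calc _ ≤ ∑ i ∈ (b.repr x).support, |(b.repr x i : ℝ) * (t (b i) - b i)| :=
          Finset.abs_sum_le_sum_abs _ _
      _ ≤ ∑ i ∈ (b.repr x).support, |(b.repr x i : ℝ)| * (1 / 2 ^ w) := by
          refine Finset.sum_le_sum fun i _ => ?_
          rw [abs_mul]
          exact mul_le_mul_of_nonneg_left (htb _) (abs_nonneg _)
      _ = (∑ i ∈ (b.repr x).support, |(b.repr x i : ℝ)|) * (1 / 2 ^ w) := by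
          rw [Finset.sum_mul]
      _ ≤ B * (1 / 2 ^ w) := by
          refine mul_le_mul_of_nonneg_right ?_ (by positivity)
          exact Finset.single_le_sum (f := fun x => ∑ i ∈ (b.repr x).support, |(b.repr x i : ℝ)|)
            (fun x _ => Finset.sum_nonneg fun i _ => abs_nonneg _) hx
      _ < ε := by
          rw [mul_one_div, div_lt_iff₀ h2w]
          rwa [div_lt_iff₀ hε, mul_comm] at hw
  · rw [Module.Basis.constr_apply, Finsupp.sum, Finset.mul_sum, Finset.mul_sum]
    push_cast
    refine Finset.sum_congr rfl fun i hi => ?_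
    have hden : (b.repr x i).den ∣ D := (Finset.dvd_prod_of_mem _ hi).trans
      (Finset.dvd_prod_of_mem (fun x => ∏ i ∈ (b.repr x).support, (b.repr x i).den) hx)
    have hnum : (((D * b.repr x i : ℚ).num : ℚ) : ℝ) = D * (b.repr x i : ℝ) := by
      obtain ⟨e, he⟩ := hden
      have h1 : (D * b.repr x i : ℚ) = ((e * (b.repr x i).num : ℤ) : ℚ) := by
        rw [he]
        push_cast
        rw [mul_comm ((b.repr x i).den : ℚ), mul_assoc, Rat.den_mul_eq_num]
      have h2 : ((D * b.repr x i : ℚ).num : ℚ) = D * b.repr x i := by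
        rw [h1, Rat.num_intCast]
      rw [h2]
      push_cast
      ring
    rw [Rat.cast_intCast] at hnum
    rw [hnum, hDN, Rat.smul_def, ht]
    push_cast
    rw [pow_add]
    field_simp

end Perturbation

section Dyadic

variable {ι : Type*}

lemma isClosed_range_toReal : IsClosed (Set.range (toReal : (ι → ℤ) → ι → ℝ)) := by
  have : Set.range (toReal : (ι → ℤ) → ι → ℝ) =
      Set.univ.pi fun _ => Set.range ((↑) : ℤ → ℝ) := by
    ext x
    simp only [Set.mem_range, Set.mem_pi, Set.mem_univ, true_implies]
    constructor
    · rintro ⟨z, rfl⟩ i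
      exact ⟨z i, rfl⟩
    · intro h
      choose z hz using h
      exact ⟨z, funext hz⟩
  rw [this]
  exact isClosed_set_pi fun _ _ => Int.isClosedEmbedding_coe_real.isClosed_range

variable [DecidableEq ι]

/-- In a finite abelian group of order `2 ^ k * D` with `D` odd, the multiples of `D` form a
subgroup of order at most `2 ^ k`. -/
lemma card_range_nsmul_le {G : Type*} [AddCommGroup G] {k D : ℕ} (hD : Odd D)
    (hG : Nat.card G = 2 ^ k * D) :
    Nat.card (nsmulAddMonoidHom D : G →+ G).range ≤ 2 ^ k := by
  have hfin : Finite G := Nat.finite_of_card_ne_zero (by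
    rw [hG]
    exact mul_ne_zero (by positivity) hD.pos.ne')
  have hp : IsPGroup 2 (Multiplicative (nsmulAddMonoidHom D : G →+ G).range) := by
    intro x
    refine ⟨k, ?_⟩
    obtain ⟨⟨_, y, rfl⟩, rfl⟩ := Multiplicative.ofAdd.surjective x
    rw [← ofAdd_nsmul, ← ofAdd_zero]
    congr 1
    ext
    have := card_nsmul_eq_zero' (G := G) (x := y)
    rw [hG, mul_smul] at this
    simpa using this
  have : Fact (Nat.Prime 2) := ⟨Nat.prime_two⟩
  obtain ⟨n, hn⟩ := IsPGroup.iff_card.1 hp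
  have hn' : Nat.card (nsmulAddMonoidHom D : G →+ G).range = 2 ^ n := hn
  have hdvd : 2 ^ n ∣ 2 ^ k * D := by
    rw [← hG, ← hn']
    exact AddSubgroup.card_addSubgroup_dvd_card _
  have h2 : 2 ^ n ∣ 2 ^ k :=
    (Nat.Coprime.pow_left n (Nat.coprime_two_left.2 hD)).dvd_of_dvd_mul_right hdvd
  rw [hn']
  exact Nat.le_of_dvd (by positivity) h2

/-- The integer vector with binary digits in a given set of positions. -/
def bitVector {v : ℕ} (t : Finset (ι × Fin v)) (i : ι) : ℕ :=
  ∑ l ∈ (t.filter fun p => p.1 = i).image fun p => (p.2 : ℕ), 2 ^ l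

lemma bitVector_lt {v : ℕ} (t : Finset (ι × Fin v)) (i : ι) : bitVector t i < 2 ^ v := by
  refine Nat.geomSum_lt le_rfl fun l hl => ?_
  obtain ⟨p, -, rfl⟩ := Finset.mem_image.1 hl
  exact p.2.2

lemma bitVector_injective {v : ℕ} :
    Function.Injective (bitVector : Finset (ι × Fin v) → ι → ℕ) := by
  intro t u h
  have key : ∀ i, ((t.filter fun p => p.1 = i).image fun p => (p.2 : ℕ)) =
      ((u.filter fun p => p.1 = i).image fun p => (p.2 : ℕ)) := fun i =>
    Finset.geomSum_injective le_rfl (congrFun h i)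
  have key2 : ∀ (t : Finset (ι × Fin v)) (i : ι) (l : Fin v), (i, l) ∈ t ↔
      (l : ℕ) ∈ ((t.filter fun p => p.1 = i).image fun p => (p.2 : ℕ)) := by
    intro t i l
    simp only [Finset.mem_image, Finset.mem_filter]
    constructor
    · exact fun h => ⟨(i, l), ⟨h, rfl⟩, rfl⟩
    · rintro ⟨⟨j, m⟩, ⟨h1, rfl⟩, h2⟩
      rwa [← Fin.ext h2]
  ext ⟨i, l⟩
  rw [key2 t, key2 u, key]

lemma sum_single_two_pow {v : ℕ} (t : Finset (ι × Fin v)) :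
    ∑ p ∈ t, (Pi.single p.1 (2 ^ (p.2 : ℕ)) : ι → ℤ) = fun i => (bitVector t i : ℤ) := by
  ext i
  rw [Finset.sum_apply, bitVector, Finset.sum_image, Finset.sum_filter]
  · push_cast
    refine Finset.sum_congr rfl fun p _ => ?_
    by_cases h : p.1 = i
    · subst h; simp
    · simp [h, Ne.symm h]
  · rintro ⟨i, l⟩ hp ⟨j, k⟩ hq h
    simp only [Finset.coe_filter, Set.mem_ofPred_eq] at hp hq
    rw [Prod.mk.injEq]
    exact ⟨hp.2.trans hq.2.symm, Fin.ext h⟩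

variable [Fintype ι]

lemma card_quotient_range_mulVecLin {L : Matrix ι ι ℤ} (hL : L.det ≠ 0) :
    Nat.card ((ι → ℤ) ⧸ LinearMap.range L.mulVecLin) = L.det.natAbs := by
  have hinj : Function.Injective L.mulVecLin := by
    rw [← LinearMap.ker_eq_bot, LinearMap.ker_eq_bot']
    exact fun z hz => Matrix.eq_zero_of_mulVec_eq_zero hL hz
  rw [← Submodule.natAbs_det_equiv _ (LinearEquiv.ofInjective _ hinj)]
  congr 1
  rw [← LinearMap.det_toLin' L]
  rfl

lemma HasIntegerCoord.exists_mulVec_eq_single_of_dyadic [Nonempty ι] {M : Matrix ι ι ℝ}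
    (h : HasIntegerCoord M) {v D : ℕ} (hv : v ≠ 0) (hD : Odd D) (hdet : |M.det| = D)
    (L : Matrix ι ι ℤ) (hL : ∀ i j, 2 ^ v * M i j = L i j) :
    ∃ (i : ι) (z : ι → ℤ), M *ᵥ toReal z = Pi.single i (D : ℝ) := by
  have hLM : L.map (Int.cast : ℤ → ℝ) = (2 ^ v : ℝ) • M := by
    ext i j
    simp [hL]
  have hLz : ∀ z : ι → ℤ, toReal (L *ᵥ z) = (2 ^ v : ℝ) • (M *ᵥ toReal z) := by
    intro z
    rw [← Matrix.smul_mulVec, ← hLM]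
    ext i
    simp [mulVec, dotProduct]
  have hLdet : L.det.natAbs = 2 ^ (v * Fintype.card ι) * D := by
    have h1 : ((L.det : ℤ) : ℝ) = (2 ^ v) ^ Fintype.card ι * M.det := by
      rw [← Matrix.det_smul, ← hLM]
      exact (Int.castRingHom ℝ).map_det L
    have h2 : ((L.det.natAbs : ℕ) : ℝ) = 2 ^ (v * Fintype.card ι) * D := by
      rw [Nat.cast_natAbs, Int.cast_abs, h1, abs_mul, hdet, pow_mul, abs_of_pos (by positivity)]
    exact_mod_cast h2
  have hL0 : L.det ≠ 0 := by
    rw [← Int.natAbs_ne_zero, hLdet]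
    exact mul_ne_zero (by positivity) hD.pos.ne'
  set N := LinearMap.range L.mulVecLin with hN
  have hcard : Nat.card ((ι → ℤ) ⧸ N) = 2 ^ (v * Fintype.card ι) * D :=
    (card_quotient_range_mulVecLin hL0).trans hLdet
  have hfin : Finite ((ι → ℤ) ⧸ N) := Nat.finite_of_card_ne_zero (by
    rw [hcard]
    exact mul_ne_zero (by positivity) hD.pos.ne')
  let a : ι × Fin v → (ι → ℤ) ⧸ N := fun p => D • N.mkQ (Pi.single p.1 (2 ^ (p.2 : ℕ)))
  have hsum : ∀ t : Finset (ι × Fin v),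
      ∑ p ∈ t, a p = N.mkQ (D • fun i => (bitVector t i : ℤ)) := by
    intro t
    simp only [a]
    rw [← Finset.smul_sum, ← map_sum, sum_single_two_pow, map_nsmul]
  have ha : ∀ p, ∃ k : ℕ, 2 ^ k • a p = 0 := by
    intro p
    refine ⟨v * Fintype.card ι, ?_⟩
    simp only [a]
    rw [← mul_smul, ← hcard]
    exact card_nsmul_eq_zero'
  have hne : (Finset.univ : Finset (ι × Fin v)).Nonempty := by
    have : NeZero v := ⟨hv⟩
    exact Finset.univ_nonempty
  obtain ⟨⟨i, l⟩, -, hil⟩ := exists_two_nsmul_eq_zero a ha Finset.univ hne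
    (by
      intro t _ u _ htu
      rw [hsum, hsum, ← sub_eq_zero, ← map_sub, Submodule.mkQ_apply,
        Submodule.Quotient.mk_eq_zero] at htu
      obtain ⟨z, hz⟩ := htu
      have hz' : ∀ i, (D : ℤ) * ((bitVector t i : ℤ) - bitVector u i) = (L *ᵥ z) i := by
        intro i
        have := congrFun hz i
        simp only [Matrix.mulVecLin_apply, Pi.sub_apply, Pi.smul_apply] at this
        rw [this, nsmul_eq_mul, nsmul_eq_mul]; ring
      have hz0 : z = 0 := by
        by_contra hz0
        obtain ⟨i, n, hn, hi⟩ := h z hz0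
        have h1 : (L *ᵥ z) i = 2 ^ v * n := by
          have := congrFun (hLz z) i
          rw [toReal_apply, Pi.smul_apply, hi, smul_eq_mul] at this
          exact_mod_cast this
        rw [← hz'] at h1
        have h2 : (2 ^ v : ℤ) ∣ (bitVector t i : ℤ) - bitVector u i := by
          refine IsCoprime.dvd_of_dvd_mul_left (y := (D : ℤ)) (IsCoprime.pow_left ?_) ⟨n, h1⟩
          exact_mod_cast Nat.isCoprime_iff_coprime.2 (Nat.coprime_two_left.2 hD)
        have h3 := bitVector_lt t i
        have h4 := bitVector_lt u i
        have h5 : (bitVector t i : ℤ) - bitVector u i = 0 := by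
          refine Int.eq_zero_of_abs_lt_dvd h2 ?_
          zify at h3 h4
          rw [abs_lt]
          constructor <;> linarith
        rw [h5, mul_zero] at h1
        have : (2 ^ v : ℤ) ≠ 0 := by positivity
        exact (mul_ne_zero this hn) h1.symm
      refine bitVector_injective (funext fun i => ?_)
      have := hz' i
      rw [hz0, Matrix.mulVec_zero, Pi.zero_apply, mul_eq_zero] at this
      rcases this with h1 | h1
      · exact absurd h1 (by exact_mod_cast hD.pos.ne')
      · zify
        linarith)
    (nsmulAddMonoidHom D : ((ι → ℤ) ⧸ N) →+ ((ι → ℤ) ⧸ N)).range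
    (fun p _ => ⟨_, rfl⟩)
    (by
      rw [Finset.card_univ, Fintype.card_prod, Fintype.card_fin, mul_comm]
      exact card_range_nsmul_le hD hcard)
  simp only [a] at hil
  rw [← map_nsmul, ← map_nsmul, Submodule.mkQ_apply, Submodule.Quotient.mk_eq_zero] at hil
  obtain ⟨z, hz⟩ := hil
  rw [Matrix.mulVecLin_apply] at hz
  refine ⟨i, 2 ^ (v - (l + 1)) • z, ?_⟩
  have h1 := hLz z
  rw [hz] at h1
  have h2 : (2 ^ v : ℝ) ≠ 0 := by positivity
  have h3 : (2 ^ v : ℝ) • (M *ᵥ toReal (2 ^ (v - (l + 1)) • z)) =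
      (2 ^ v : ℝ) • Pi.single i (D : ℝ) := by
    have h4 : toReal ((2 ^ (v - ((l : ℕ) + 1)) : ℕ) • z) =
        (2 ^ (v - ((l : ℕ) + 1)) : ℝ) • toReal z := by
      ext j; simp
    have h5 : v = v - ((l : ℕ) + 1) + 1 + l := by omega
    rw [h4, Matrix.mulVec_smul, smul_comm, ← h1]
    ext j
    simp only [toReal_apply, Pi.smul_apply]
    by_cases hj : j = i
    · subst hj
      simp only [Pi.single_eq_same, smul_eq_mul, nsmul_eq_mul]
      push_cast
      conv_rhs => rw [h5]
      ring
    · simp [hj]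
  exact smul_right_injective _ h2 h3

/-- A lattice of covolume `1` all of whose nonzero vectors have a nonzero integer coordinate contains
a nonzero vector on a coordinate axis. -/
theorem HasIntegerCoord.exists_mulVec_axis [Nonempty ι] {M : Matrix ι ι ℝ}
    (h : HasIntegerCoord M) (hdet : |M.det| = 1) :
    ∃ (i : ι) (z : ι → ℤ), z ≠ 0 ∧ ∀ j, j ≠ i → (M *ᵥ toReal z) j = 0 := by
  have hsq : M.det * M.det = 1 := by
    rw [← abs_mul_abs_self, hdet, one_mul]
  obtain ⟨N, hN, hf⟩ := exists_odd_forall_exists_linearMap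
    (Finset.univ.image fun p : ι × ι => M p.1 p.2)
  have hN0 : (N : ℝ) ≠ 0 := by exact_mod_cast hN.pos.ne'
  set c : ℝ := (N : ℝ) ^ Fintype.card ι / N with hc
  have hc0 : c ≠ 0 := by positivity
  let Φ : ι → Matrix ι ι ℝ → ι → ℝ := fun i X => M.det • (X.adjugate *ᵥ Pi.single i c)
  have hΦ : ∀ i, Continuous (Φ i) := fun i => by
    have h1 : Continuous fun X : Matrix ι ι ℝ => X.adjugate *ᵥ (Pi.single i c : ι → ℝ) :=
      (Continuous.matrix_adjugate continuous_id).matrix_mulVec continuous_const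
    exact (continuous_const (y := M.det)).smul h1
  have hex : ∃ i, Φ i M ∈ Set.range (toReal : (ι → ℤ) → ι → ℝ) := by
    by_contra! hcon
    have hev : ∀ᶠ X in nhds M, ∀ i, Φ i X ∉ Set.range (toReal : (ι → ℤ) → ι → ℝ) :=
      eventually_all.2 fun i =>
        (hΦ i).continuousAt.eventually (isClosed_range_toReal.isOpen_compl.mem_nhds (hcon i))
    choose f hf1 hf2 using fun k : ℕ => hf (1 / ((k : ℝ) + 1)) (by positivity)
    have htend : Tendsto (fun k => M.map (f k)) atTop (nhds M) := by
      refine tendsto_pi_nhds.2 fun i => tendsto_pi_nhds.2 fun j => ?_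
      rw [tendsto_iff_dist_tendsto_zero]
      refine squeeze_zero (fun _ => dist_nonneg) (fun k => ?_)
        tendsto_one_div_add_atTop_nhds_zero_nat
      rw [Real.dist_eq]
      exact (hf2 k _ (Finset.mem_image_of_mem _ (Finset.mem_univ (i, j)))).1.le
    obtain ⟨k, hk⟩ := (htend.eventually hev).exists
    obtain ⟨hX, hXdet⟩ := h.map (f k) (hf1 k)
    set X := M.map (f k) with hXdef
    choose v n hvn using fun p : ι × ι =>
      (hf2 k _ (Finset.mem_image_of_mem (fun p : ι × ι => M p.1 p.2) (Finset.mem_univ p))).2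
    have hle : ∀ p, v p ≤ (∑ p, v p) + 1 := fun p =>
      (Finset.single_le_sum (f := v) (fun _ _ => Nat.zero_le _) (Finset.mem_univ p)).trans
        (Nat.le_succ _)
    have hNX : HasIntegerCoord ((N : ℝ) • X) := by
      intro z hz
      obtain ⟨i, l, hl, hi⟩ := hX z hz
      refine ⟨i, N * l, mul_ne_zero (by exact_mod_cast hN.pos.ne') hl, ?_⟩
      rw [Matrix.smul_mulVec, Pi.smul_apply, hi]
      push_cast
      rfl
    obtain ⟨i, z, hz⟩ := hNX.exists_mulVec_eq_single_of_dyadic (v := (∑ p, v p) + 1)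
      (D := N ^ Fintype.card ι) (by omega) hN.pow
      (by rw [Matrix.det_smul, abs_mul, hXdet, hdet, mul_one, abs_pow, Nat.abs_cast]; simp)
      (fun i j => 2 ^ ((∑ p, v p) + 1 - v (i, j)) * n (i, j)) (by
        intro i j
        have := hvn (i, j)
        push_cast
        rw [← this, ← mul_assoc, ← pow_add, Nat.sub_add_cancel (hle _)]
        rfl)
    refine hk i ⟨z, ?_⟩
    have h1 : X *ᵥ toReal z = Pi.single i c := by
      rw [Matrix.smul_mulVec] at hz
      have : (N : ℝ) • (X *ᵥ toReal z) = (N : ℝ) • Pi.single i c := by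
        rw [hz, ← Pi.single_smul, smul_eq_mul, hc, mul_div_cancel₀ _ hN0]
        push_cast
        rfl
      exact smul_right_injective _ hN0 this
    simp only [Φ]
    rw [← h1, Matrix.mulVec_mulVec, Matrix.adjugate_mul, hXdet, Matrix.smul_mulVec,
      Matrix.one_mulVec, smul_smul, hsq, one_smul]
  obtain ⟨i, z, hz⟩ := hex
  have hMz : M *ᵥ toReal z = Pi.single i c := by
    rw [hz]
    simp only [Φ]
    rw [Matrix.mulVec_smul, Matrix.mulVec_mulVec, Matrix.mul_adjugate, Matrix.smul_mulVec,
      Matrix.one_mulVec, smul_smul, hsq, one_smul]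
  refine ⟨i, z, ?_, fun j hj => by rw [hMz]; simp [hj]⟩
  rintro rfl
  rw [toReal_zero, Matrix.mulVec_zero] at hMz
  have := congrFun hMz i
  simp [hc0.symm] at this

end Dyadic

section LatticeTiling

open MeasureTheory

variable {ι : Type*} [Fintype ι]

/-- A subgroup whose translates of the half-open unit cube tile the space is spanned by the columns
of a matrix of determinant `±1`. -/
lemma exists_matrix_of_tiling [DecidableEq ι] (Λ : Submodule ℤ (ι → ℝ))
    (hsep : ∀ x ∈ Λ, (∀ i, |x i| < 1) → x = 0) (hcov : ∀ x, ∃ y ∈ Λ, x ∈ unitCube y) :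
    ∃ M : Matrix ι ι ℝ, |M.det| = 1 ∧ (∀ z, M *ᵥ toReal z ∈ Λ) ∧ HasIntegerCoord M := by
  have huniq : ∀ x, ∀ y ∈ Λ, ∀ y' ∈ Λ, x ∈ unitCube y → x ∈ unitCube y' → y = y' := by
    intro x y hy y' hy' h h'
    refine sub_eq_zero.1 (hsep _ (Λ.sub_mem hy hy') fun i => ?_)
    have h1 := h i
    have h2 := h' i
    rw [Pi.sub_apply, abs_lt]
    constructor <;> linarith
  have hdisc : DiscreteTopology Λ := by
    refine discreteTopology_of_isOpen_singleton_zero ?_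
    have : ({0} : Set Λ) = (fun x : Λ => (x : ι → ℝ)) ⁻¹' (Metric.ball 0 1) := by
      ext x
      simp only [Set.mem_singleton_iff, Set.mem_preimage, mem_ball_zero_iff]
      constructor
      · rintro rfl
        simp
      · intro h
        refine Subtype.ext (hsep x x.2 fun i => ?_)
        rw [← Real.norm_eq_abs]
        exact (norm_le_pi_norm _ i).trans_lt h
    rw [this]
    exact Metric.isOpen_ball.preimage continuous_subtype_val
  have hspan : Submodule.span ℝ (Λ : Set (ι → ℝ)) = ⊤ := by
    by_contra hne
    obtain ⟨f, hf0, hf⟩ := Submodule.exists_le_ker_of_lt_top _ (lt_top_iff_ne_top.2 hne)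
    apply hf0
    have hbound : ∀ x, |f x| ≤ ∑ i, |f (Pi.single i 1)| := by
      intro x
      obtain ⟨y, hy, hxy⟩ := hcov x
      have h1 : f x = f (x - y) := by
        rw [map_sub, show f y = 0 from hf (Submodule.subset_span hy), sub_zero]
      rw [h1, LinearMap.pi_apply_eq_sum_univ f (x - y)]
      refine (Finset.abs_sum_le_sum_abs _ _).trans (Finset.sum_le_sum fun i _ => ?_)
      rw [smul_eq_mul, abs_mul]
      have h2 := hxy i
      have h3 : |(x - y) i| ≤ 1 := by
        rw [Pi.sub_apply, abs_le]
        constructor <;> linarith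
      have h4 : (fun j => if i = j then (1 : ℝ) else 0) = Pi.single i 1 := by
        ext j
        simp [Pi.single_apply, eq_comm]
      rw [h4]
      exact mul_le_of_le_one_left (abs_nonneg _) h3
    ext i
    simp only [LinearMap.comp_apply, LinearMap.zero_apply, LinearMap.single_apply]
    by_contra h0
    set a := f (Pi.single i 1) with ha
    set C := ∑ i, |f (Pi.single i 1)| with hC
    have h5 := hbound (((C + 1) / |a|) • Pi.single i 1)
    rw [map_smul, ← ha, smul_eq_mul, abs_mul, abs_div, abs_abs,
      div_mul_cancel₀ _ (abs_ne_zero.2 h0)] at h5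
    have := le_abs_self (C + 1)
    linarith
  have hZ : IsZLattice ℝ Λ := ⟨hspan⟩
  have hfree : Module.Free ℤ Λ := ZLattice.module_free ℝ Λ
  have hfinite : Module.Finite ℤ Λ := ZLattice.module_finite ℝ Λ
  have hrank : Module.finrank ℤ Λ = Fintype.card ι := by
    rw [ZLattice.rank ℝ Λ, Module.finrank_fintype_fun_eq_card]
  let b : Module.Basis ι ℤ Λ := (Module.finBasis ℤ Λ).reindex
    (Fintype.equivOfCardEq (by rw [Fintype.card_fin, hrank]))
  let M : Matrix ι ι ℝ := fun i j => (b j : ι → ℝ) i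
  have hMz : ∀ z : ι → ℤ, M *ᵥ toReal z = ((b.equivFun.symm z : Λ) : ι → ℝ) := by
    intro z
    rw [Module.Basis.equivFun_symm_apply, Submodule.coe_sum]
    ext i
    simp [mulVec, dotProduct, M, mul_comm]
  have hfund : IsAddFundamentalDomain Λ (Set.univ.pi fun _ => Set.Ico (0 : ℝ) (0 + 1) : Set (ι → ℝ))
      volume := by
    refine IsAddFundamentalDomain.mk' (MeasurableSet.univ_pi fun _ =>
      measurableSet_Ico).nullMeasurableSet fun x => ?_
    have hmem : ∀ g : Λ, g +ᵥ x ∈ (Set.univ.pi fun _ => Set.Ico (0 : ℝ) (0 + 1) : Set (ι → ℝ)) ↔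
        x ∈ unitCube (-(g : ι → ℝ)) := by
      intro g
      simp only [Set.mem_pi, Set.mem_univ, true_implies]
      refine forall_congr' fun i => ?_
      have : (g +ᵥ x) i = (g : ι → ℝ) i + x i := rfl
      rw [this, Set.mem_Ico, Pi.neg_apply]
      constructor <;> rintro ⟨h1, h2⟩ <;> constructor <;> linarith
    obtain ⟨y, hy, hxy⟩ := hcov x
    refine ⟨-⟨y, hy⟩, ?_, fun g hg => ?_⟩
    · simp only [hmem]
      simpa using hxy
    · simp only [hmem] at hg
      have := huniq x _ (Λ.neg_mem g.2) y hy hg hxy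
      ext1
      rw [neg_eq_iff_eq_neg.1 this]
      rfl
  have hdet : |M.det| = 1 := by
    have h1 := ZLattice.covolume_eq_det Λ b
    rw [ZLattice.covolume_eq_measure_fundamentalDomain Λ volume hfund, measureReal_def,
      volume_Ico_cube (fun _ => 0) zero_le_one, one_pow, ENNReal.ofReal_one,
      ENNReal.toReal_one] at h1
    rw [h1, ← Matrix.det_transpose]
    rfl
  refine ⟨M, hdet, fun z => by rw [hMz]; exact (b.equivFun.symm z).2, fun z hz => ?_⟩
  have htil : IsCubeTiling fun z : ι → ℤ => M *ᵥ toReal z := by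
    intro x
    obtain ⟨y, hy, hxy⟩ := hcov x
    refine ⟨b.equivFun ⟨y, hy⟩, ?_, fun w hw => ?_⟩
    · simp only [hMz, LinearEquiv.symm_apply_apply]
      exact hxy
    · simp only [hMz] at hw
      have := huniq x _ (b.equivFun.symm w).2 y hy hw hxy
      rw [← LinearEquiv.symm_apply_eq]
      exact Subtype.ext this
  obtain ⟨i, n, hn, hi⟩ := htil.exists_int_sub hz
  refine ⟨i, n, hn, ?_⟩
  rw [← hi]
  simp [toReal_zero]

/-- The set of limits, along a filter, of sequences of points of the lattices spanned by the columns
of the matrices `M k`. -/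
def limitLattice (l : Filter ℕ) (M : ℕ → Matrix ι ι ℝ) : Submodule ℤ (ι → ℝ) :=
  AddSubgroup.toIntSubmodule
    { carrier := {x | ∃ z : ℕ → ι → ℤ, Tendsto (fun k => M k *ᵥ toReal (z k)) l (nhds x)}
      zero_mem' := ⟨0, by simpa [toReal_zero] using tendsto_const_nhds⟩
      add_mem' := by
        rintro x y ⟨z, hz⟩ ⟨w, hw⟩
        refine ⟨z + w, ?_⟩
        simpa [toReal_add, Matrix.mulVec_add] using hz.add hw
      neg_mem' := by
        rintro x ⟨z, hz⟩
        refine ⟨-z, ?_⟩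
        have : ∀ k, toReal (-z k) = - toReal (z k) := fun k => by ext; simp
        simpa [this, Matrix.mulVec_neg] using hz.neg }

variable [DecidableEq ι]

/-- Blichfeldt's theorem for a lattice without nonzero points in a cube of side `s`: the cubes of
side a little larger than `s` cover. -/
lemma exists_mulVec_near {M : Matrix ι ι ℝ} (hM : |M.det| = 1) {s η : ℝ} (hη : 0 < η) (hηs : η ≤ s)
    (hvol : 1 < s ^ Fintype.card ι + η ^ Fintype.card ι)
    (hsep : ∀ z : ι → ℤ, z ≠ 0 → ∃ i, s ≤ |(M *ᵥ toReal z) i|) (x : ι → ℝ) :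
    ∃ z : ι → ℤ, ∀ i, -η < x i - (M *ᵥ toReal z) i ∧ x i - (M *ᵥ toReal z) i < s := by
  have hs : 0 < s := hη.trans_le hηs
  set S : Set (ι → ℝ) := Set.univ.pi fun _ => Set.Ico (0 : ℝ) (0 + s) with hS
  set Q : Set (ι → ℝ) := Set.univ.pi fun i => Set.Ico (x i) (x i + η) with hQ
  by_cases hdis : Disjoint S Q
  · have hmS : MeasurableSet S := MeasurableSet.univ_pi fun _ => measurableSet_Ico
    have hmQ : MeasurableSet Q := MeasurableSet.univ_pi fun _ => measurableSet_Ico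
    obtain ⟨u, hu, v, hv, z, hz, hzuv⟩ := exists_sub_eq_mulVec (M := M) (S := S ∪ Q)
      (fun h => by simp [h] at hM) (hmS.union hmQ) (by
        rw [measure_union hdis hmQ, hS, hQ, volume_Ico_cube _ hs.le, volume_Ico_cube _ hη.le, hM,
          ← ENNReal.ofReal_add (by positivity) (by positivity)]
        exact (ENNReal.ofReal_lt_ofReal_iff (by positivity)).2 hvol)
    obtain ⟨j, hj⟩ := hsep z hz
    rw [← hzuv, Pi.sub_apply] at hj
    rcases hu with hu | hu <;> rcases hv with hv | hv
    · have h1 := hu j trivial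
      have h2 := hv j trivial
      simp only [zero_add, Set.mem_Ico] at h1 h2
      exact absurd hj (not_le.2 (abs_lt.2 ⟨by linarith, by linarith⟩))
    · refine ⟨-z, fun i => ?_⟩
      have h3 : (M *ᵥ toReal (-z)) i = -(u i - v i) := by
        have : toReal (-z) = - toReal z := by ext; simp
        rw [this, Matrix.mulVec_neg, ← hzuv]
        rfl
      have h1 := hu i trivial
      have h2 := hv i trivial
      simp only [zero_add, Set.mem_Ico] at h1 h2
      rw [h3]
      constructor <;> linarith
    · refine ⟨z, fun i => ?_⟩
      have h1 := hu i trivial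
      have h2 := hv i trivial
      simp only [zero_add, Set.mem_Ico] at h1 h2
      rw [← hzuv, Pi.sub_apply]
      constructor <;> linarith
    · have h1 := hu j trivial
      have h2 := hv j trivial
      simp only [Set.mem_Ico] at h1 h2
      exact absurd hj (not_le.2 (abs_lt.2 ⟨by linarith, by linarith⟩))
  · obtain ⟨u, hu, hu'⟩ := Set.not_disjoint_iff.1 hdis
    refine ⟨0, fun i => ?_⟩
    have h1 := hu i trivial
    have h2 := hu' i trivial
    simp only [zero_add, Set.mem_Ico] at h1 h2
    rw [toReal_zero, Matrix.mulVec_zero, Pi.zero_apply]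
    constructor <;> linarith

/-- A sequence of unimodular lattices without nonzero points in cubes whose sides tend to `1`
accumulates at a nonzero vector on a coordinate axis. -/
theorem exists_tendsto_axis [Nonempty ι] (M : ℕ → Matrix ι ι ℝ) (hM : ∀ k, |(M k).det| = 1) (s : ℕ → ℝ)
    (hs : Tendsto s atTop (nhds 1))
    (hsep : ∀ k, ∀ z : ι → ℤ, z ≠ 0 → ∃ i, s k ≤ |(M k *ᵥ toReal z) i|) :
    ∃ (l : Filter ℕ) (i : ι) (x : ι → ℝ) (z : ℕ → ι → ℤ), l.NeBot ∧ l ≤ atTop ∧ x ≠ 0 ∧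
      (∀ j, j ≠ i → x j = 0) ∧ Tendsto (fun k => M k *ᵥ toReal (z k)) l (nhds x) := by
  set l : Ultrafilter ℕ := Filter.hyperfilter ℕ with hl
  have hle : (l : Filter ℕ) ≤ atTop := Nat.hyperfilter_le_atTop
  have hsl : Tendsto s l (nhds 1) := hs.mono_left hle
  set Λ := limitLattice (l : Filter ℕ) M with hΛ
  have hsepΛ : ∀ x ∈ Λ, (∀ i, |x i| < 1) → x = 0 := by
    rintro x ⟨z, hz⟩ hx
    have h1 : ∀ᶠ k in (l : Filter ℕ), ∀ i, |(M k *ᵥ toReal (z k)) i| < s k :=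
      eventually_all.2 fun i => ((tendsto_pi_nhds.1 hz i).abs).eventually_lt hsl (hx i)
    have h2 : ∀ᶠ k in (l : Filter ℕ), M k *ᵥ toReal (z k) = 0 := by
      filter_upwards [h1] with k hk
      by_cases hzk : z k = 0
      · rw [hzk, toReal_zero, Matrix.mulVec_zero]
      · obtain ⟨i, hi⟩ := hsep k _ hzk
        exact absurd (hk i) (not_lt.2 hi)
    exact tendsto_nhds_unique hz (tendsto_const_nhds.congr' (h2.mono fun k hk => hk.symm))
  have hcov1 : ∀ (x : ι → ℝ) (η : ℝ), 0 < η → η < 1 →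
      ∃ y ∈ Λ, ∀ i, -η ≤ x i - y i ∧ x i - y i ≤ 1 := by
    intro x η hη hη1
    have hev : ∀ᶠ k in (l : Filter ℕ), ∃ z : ι → ℤ,
        ∀ i, -η < x i - (M k *ᵥ toReal z) i ∧ x i - (M k *ᵥ toReal z) i < s k := by
      have h1 : ∀ᶠ k in (l : Filter ℕ), 1 < s k ^ Fintype.card ι + η ^ Fintype.card ι := by
        refine Tendsto.eventually_const_lt (u := 1) ?_ ((hsl.pow _).add_const _)
        rw [one_pow]
        linarith [pow_pos hη (Fintype.card ι)]
      filter_upwards [h1, hsl.eventually_const_lt hη1] with k hk1 hk2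
      exact exists_mulVec_near (hM k) hη hk2.le hk1 (hsep k) x
    obtain ⟨z, hz⟩ := hev.choice
    have hK : IsCompact (Set.univ.pi fun i => Set.Icc (x i - 2) (x i + η)) :=
      isCompact_univ_pi fun i => isCompact_Icc
    obtain ⟨y, -, hy⟩ := hK.ultrafilter_le_nhds (l.map fun k => M k *ᵥ toReal (z k)) (by
      rw [le_principal_iff, Ultrafilter.coe_map, mem_map]
      filter_upwards [hz, hsl.eventually_lt_const (by norm_num : (1 : ℝ) < 2)] with k hk hk2 i _
      have := hk i
      constructor <;> linarith)
    have hy' : Tendsto (fun k => M k *ᵥ toReal (z k)) l (nhds y) := hy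
    refine ⟨y, ⟨z, hy'⟩, fun i => ⟨?_, ?_⟩⟩
    · refine ge_of_tendsto ((tendsto_pi_nhds.1 hy' i).const_sub (x i)) ?_
      filter_upwards [hz] with k hk using (hk i).1.le
    · refine le_of_tendsto_of_tendsto ((tendsto_pi_nhds.1 hy' i).const_sub (x i)) hsl ?_
      filter_upwards [hz] with k hk using (hk i).2.le
  have hcov : ∀ x, ∃ y ∈ Λ, x ∈ unitCube y := by
    intro x
    by_contra! hcon
    set F : Set (ι → ℝ) := {y | y ∈ Λ ∧ ∀ i, |x i - y i| ≤ 3} with hF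
    have hfin : F.Finite := by
      refine Set.Finite.of_injOn (f := fun y i => ⌊y i⌋)
        (t := Set.univ.pi fun i => Set.Icc (⌊x i - 3⌋) (⌊x i + 3⌋)) ?_ ?_
        (Set.Finite.pi fun i => Set.finite_Icc _ _)
      · intro y hy i _
        have := abs_le.1 (hy.2 i)
        exact ⟨Int.floor_le_floor (by linarith), Int.floor_le_floor (by linarith)⟩
      · intro y hy y' hy' h
        refine sub_eq_zero.1 (hsepΛ _ (Λ.sub_mem hy.1 hy'.1) fun i => ?_)
        exact Int.abs_sub_lt_one_of_floor_eq_floor (congrFun h i)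
    have hev : ∀ᶠ η in nhdsWithin (0 : ℝ) (Set.Ioi 0), ∀ y ∈ F,
        ¬ ∀ i, -η ≤ x i + 2 * η - y i ∧ x i + 2 * η - y i ≤ 1 := by
      rw [eventually_all_finite hfin]
      intro y hy
      obtain ⟨i, hi⟩ := not_forall.1 (hcon y hy.1)
      by_cases hlt : x i < y i
      · have h0 : 0 < (y i - x i) / 3 := by linarith
        filter_upwards [Ioo_mem_nhdsGT h0] with η hη h
        have := (h i).1
        have := hη.2
        linarith
      · have h1 : y i + 1 ≤ x i := by
          by_contra! h
          exact hi ⟨not_lt.1 hlt, h⟩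
        filter_upwards [self_mem_nhdsWithin] with η hη h
        have h2 := (h i).2
        have h3 : 0 < η := hη
        linarith
    obtain ⟨η, hη, h0, h1⟩ := (hev.and (Ioo_mem_nhdsGT (zero_lt_one' ℝ))).exists
    obtain ⟨y, hy, hxy⟩ := hcov1 (fun i => x i + 2 * η) η h0 h1
    refine hη y ⟨hy, fun i => ?_⟩ hxy
    have := hxy i
    rw [abs_le]
    constructor <;> linarith
  obtain ⟨N, hN, hNΛ, hNint⟩ := exists_matrix_of_tiling Λ hsepΛ hcov
  obtain ⟨i, w, hw, hwi⟩ := hNint.exists_mulVec_axis hN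
  obtain ⟨z, hz⟩ := hNΛ w
  refine ⟨l, i, N *ᵥ toReal w, z, inferInstance, hle, fun h => hw ?_, hwi, hz⟩
  exact mulVec_toReal_eq_zero (fun h => by simp [h] at hN) h

end LatticeTiling

section Flow

lemma quasiNorm_lt_iff {k : ℕ} [Nonempty (Fin k)] {a x : Fin k → ℝ} (ha : ∀ i, 0 < a i) {r : ℝ}
    (hr : 0 < r) : quasiNorm a x < r ↔ ∀ i, |x i| < r ^ a i := by
  have h1 : ∀ i, |x i| ^ (1 / a i) < r ↔ |x i| < r ^ a i := fun i => by
    rw [one_div, Real.rpow_inv_lt_iff_of_pos (abs_nonneg _) hr.le (ha i)]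
  constructor
  · intro h i
    rw [← h1]
    exact (le_ciSup (f := fun i => |x i| ^ (1 / a i)) (Set.finite_range _).bddAbove i).trans_lt h
  · intro h
    obtain ⟨i, hi⟩ := exists_eq_ciSup_of_finite (f := fun i => |x i| ^ (1 / a i))
    rw [quasiNorm, ← hi, h1]
    exact h i

lemma quasiNorm_nonneg {k : ℕ} (a x : Fin k → ℝ) : 0 ≤ quasiNorm a x :=
  Real.iSup_nonneg fun _ => Real.rpow_nonneg (abs_nonneg _) _

variable {m n : ℕ}

lemma Weights.nonempty_left (ω : Weights m n) : Nonempty (Fin m) := by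
  by_contra h
  rw [not_nonempty_iff] at h
  simpa using ω.α_sum

lemma Weights.nonempty_right (ω : Weights m n) : Nonempty (Fin n) := by
  by_contra h
  rw [not_nonempty_iff] at h
  simpa using ω.β_sum

lemma Weights.α_le_one (ω : Weights m n) (i : Fin m) : ω.α i ≤ 1 := by
  rw [← ω.α_sum]
  exact Finset.single_le_sum (fun i _ => (ω.α_pos i).le) (Finset.mem_univ i)

lemma Weights.β_le_one (ω : Weights m n) (j : Fin n) : ω.β j ≤ 1 := by
  rw [← ω.β_sum]
  exact Finset.single_le_sum (fun i _ => (ω.β_pos i).le) (Finset.mem_univ j)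

lemma mem_badlyApproximable_iff (ω : Weights m n) {A : Matrix (Fin m) (Fin n) ℝ} :
    A ∈ badlyApproximable ω ↔ ∃ c : ℝ, 0 < c ∧ ∀ (p : Fin m → ℤ) (q : Fin n → ℤ), q ≠ 0 →
      c ≤ quasiNorm ω.α (linForm A p q) * quasiNorm ω.β (fun j => (q j : ℝ)) := by
  have := ω.nonempty_right
  have hne : Nonempty ((Fin m → ℤ) × {q : Fin n → ℤ // q ≠ 0}) :=
    ⟨0, 1, fun h => by simpa using congrFun h (Classical.arbitrary _)⟩
  constructor
  · intro h
    refine ⟨_, h, fun p q hq => ?_⟩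
    exact ciInf_le (f := fun x : (Fin m → ℤ) × {q : Fin n → ℤ // q ≠ 0} =>
      quasiNorm ω.α (linForm A x.1 x.2.1) * quasiNorm ω.β (fun j => (x.2.1 j : ℝ)))
      ⟨0, by
        rintro _ ⟨x, rfl⟩
        exact mul_nonneg (quasiNorm_nonneg _ _) (quasiNorm_nonneg _ _)⟩ (p, ⟨q, hq⟩)
  · rintro ⟨c, hc, h⟩
    exact hc.trans_le (le_ciInf fun x => h x.1 x.2.1 x.2.2)

/-- The matrix of the lattice attached to `A` at time `t`, under the weighted diagonal flow: it maps
`(p, q)` to the vector with coordinates `t ^ α i * (A q - p) i` and `t ^ (-β j) * q j`. -/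
noncomputable def flowMatrix (ω : Weights m n) (A : Matrix (Fin m) (Fin n) ℝ) (t : ℝ) :
    Matrix (Fin m ⊕ Fin n) (Fin m ⊕ Fin n) ℝ :=
  fromBlocks (-diagonal fun i => t ^ ω.α i) ((diagonal fun i => t ^ ω.α i) * A) 0
    (diagonal fun j => t ^ (-ω.β j))

lemma flowMatrix_mulVec_inl (ω : Weights m n) (A : Matrix (Fin m) (Fin n) ℝ) (t : ℝ)
    (z : Fin m ⊕ Fin n → ℤ) (i : Fin m) :
    (flowMatrix ω A t *ᵥ toReal z) (Sum.inl i) =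
      t ^ ω.α i * linForm A (z ∘ Sum.inl) (z ∘ Sum.inr) i := by
  rw [flowMatrix, fromBlocks_mulVec, Sum.elim_inl, Pi.add_apply, neg_mulVec, ← mulVec_mulVec,
    Pi.neg_apply, mulVec_diagonal, mulVec_diagonal, linForm, Pi.sub_apply]
  simp only [Function.comp_apply, toReal_apply, Function.comp_def]
  ring

lemma flowMatrix_mulVec_inr (ω : Weights m n) (A : Matrix (Fin m) (Fin n) ℝ) (t : ℝ)
    (z : Fin m ⊕ Fin n → ℤ) (j : Fin n) :
    (flowMatrix ω A t *ᵥ toReal z) (Sum.inr j) = t ^ (-ω.β j) * z (Sum.inr j) := by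
  rw [flowMatrix, fromBlocks_mulVec, Sum.elim_inr, Pi.add_apply, mulVec_diagonal, zero_mulVec]
  simp

lemma abs_det_flowMatrix (ω : Weights m n) (A : Matrix (Fin m) (Fin n) ℝ) {t : ℝ} (ht : 0 < t) :
    |(flowMatrix ω A t).det| = 1 := by
  rw [flowMatrix, det_fromBlocks_zero₂₁, det_neg, det_diagonal, det_diagonal,
    ← Real.rpow_sum_of_pos ht, ← Real.rpow_sum_of_pos ht, ω.α_sum, Finset.sum_neg_distrib, ω.β_sum,
    mul_assoc, ← Real.rpow_add ht]
  simp [abs_pow]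

/-- A lower bound for the product of the quasi-norms, in terms of the lattice at time `t`. -/
lemma lt_mul_of_flowMatrix (ω : Weights m n) {A : Matrix (Fin m) (Fin n) ℝ} {c : ℝ}
    (hA : ∀ (p : Fin m → ℤ) (q : Fin n → ℤ), q ≠ 0 →
      c ≤ quasiNorm ω.α (linForm A p q) * quasiNorm ω.β (fun j => (q j : ℝ)))
    {t ε R : ℝ} (ht : 0 < t) (hε : 0 < ε) (hR : 0 < R) {z : Fin m ⊕ Fin n → ℤ}
    (hz : z ∘ Sum.inr ≠ 0)
    (h1 : ∀ i, |(flowMatrix ω A t *ᵥ toReal z) (Sum.inl i)| < ε ^ ω.α i)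
    (h2 : ∀ j, |(flowMatrix ω A t *ᵥ toReal z) (Sum.inr j)| < R ^ ω.β j) : c < ε * R := by
  have := ω.nonempty_left
  have := ω.nonempty_right
  have h3 : quasiNorm ω.α (linForm A (z ∘ Sum.inl) (z ∘ Sum.inr)) < ε / t := by
    rw [quasiNorm_lt_iff ω.α_pos (by positivity)]
    intro i
    have := h1 i
    have hti : 0 < t ^ ω.α i := Real.rpow_pos_of_pos ht _
    rw [flowMatrix_mulVec_inl, abs_mul, abs_of_pos hti] at this
    rw [Real.div_rpow hε.le ht.le, lt_div_iff₀ hti, mul_comm]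
    exact this
  have h4 : quasiNorm ω.β (fun j => ((z ∘ Sum.inr) j : ℝ)) < R * t := by
    rw [quasiNorm_lt_iff ω.β_pos (by positivity)]
    intro j
    have := h2 j
    have htj : 0 < t ^ ω.β j := Real.rpow_pos_of_pos ht _
    rw [flowMatrix_mulVec_inr, Real.rpow_neg ht.le, abs_mul, abs_inv, abs_of_pos htj,
      inv_mul_lt_iff₀ htj] at this
    rw [Real.mul_rpow hR.le ht.le, mul_comm]
    exact this
  calc c ≤ _ := hA _ _ hz
    _ ≤ ε / t * quasiNorm ω.β (fun j => ((z ∘ Sum.inr) j : ℝ)) :=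
      mul_le_mul_of_nonneg_right h3.le (quasiNorm_nonneg _ _)
    _ < ε / t * (R * t) := mul_lt_mul_of_pos_left h4 (by positivity)
    _ = ε * R := by field_simp

lemma one_le_abs_intCast {k : ℤ} (hk : k ≠ 0) : (1 : ℝ) ≤ |(k : ℝ)| := by
  exact_mod_cast Int.one_le_abs hk

lemma exists_abs_flowMatrix_ge_of_inr_eq_zero (ω : Weights m n) (A : Matrix (Fin m) (Fin n) ℝ)
    {t : ℝ} (ht : 0 < t) {z : Fin m ⊕ Fin n → ℤ} (hz : z ≠ 0) (hq : z ∘ Sum.inr = 0) :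
    ∃ i, t ^ ω.α i ≤ |(flowMatrix ω A t *ᵥ toReal z) (Sum.inl i)| := by
  have hp : ∃ i, z (Sum.inl i) ≠ 0 := by
    by_contra! h
    refine hz (funext fun i => ?_)
    rcases i with i | j
    · exact h i
    · exact congrFun hq j
  obtain ⟨i, hi⟩ := hp
  refine ⟨i, ?_⟩
  have hti : 0 < t ^ ω.α i := Real.rpow_pos_of_pos ht _
  rw [flowMatrix_mulVec_inl, hq, linForm, abs_mul, abs_of_pos hti]
  refine le_mul_of_one_le_right hti.le ?_
  have h0 : (fun j => (((0 : Fin n → ℤ) j : ℤ) : ℝ)) = 0 := by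
    ext j; simp
  rw [h0, mulVec_zero, zero_sub, Pi.neg_apply, abs_neg]
  exact one_le_abs_intCast hi

theorem badlyApproximable_subset_dirichletImprovable (ω : Weights m n) :
    badlyApproximable ω ⊆ dirichletImprovable ω := by
  have := ω.nonempty_left
  have := ω.nonempty_right
  intro A hA
  obtain ⟨c, hc, hA⟩ := (mem_badlyApproximable_iff ω).1 hA
  by_contra hDI
  have hfreq : ∀ k : ℕ, ∃ t : ℝ, (k : ℝ) + 1 ≤ t ∧ ∀ (p : Fin m → ℤ) (q : Fin n → ℤ), q ≠ 0 →
      quasiNorm ω.α (linForm A p q) < (1 - 1 / ((k : ℝ) + 2)) * (1 / t) →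
      t ≤ quasiNorm ω.β (fun j => (q j : ℝ)) := by
    intro k
    have hk : (1 : ℝ) - 1 / ((k : ℝ) + 2) ∈ Set.Ioo (0 : ℝ) 1 := by
      have h1 : 1 / ((k : ℝ) + 2) < 1 := by
        rw [div_lt_one (by positivity)]
        linarith [(Nat.cast_nonneg k : (0 : ℝ) ≤ k)]
      have h2 : 0 < 1 / ((k : ℝ) + 2) := by positivity
      constructor <;> linarith
    have h1 : A ∉ dirichletSet ω (fun t => (1 - 1 / ((k : ℝ) + 2)) * (1 / t)) := fun h =>
      hDI (Set.mem_biUnion hk h)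
    have h2 := (not_eventually.1 h1).and_eventually (eventually_ge_atTop ((k : ℝ) + 1))
    obtain ⟨t, ht1, ht2⟩ := h2.exists
    push Not at ht1
    exact ⟨t, ht2, ht1⟩
  choose t htk ht using hfreq
  have htpos : ∀ k, 0 < t k := fun k => lt_of_lt_of_le (by positivity) (htk k)
  have htop : Tendsto t atTop atTop := tendsto_atTop_mono (fun k => (lt_add_one (k : ℝ)).le.trans
    (htk k)) tendsto_natCast_atTop_atTop
  have hs : Tendsto (fun k : ℕ => (1 : ℝ) - 1 / ((k : ℝ) + 2)) atTop (nhds 1) := by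
    have h1 : Tendsto (fun k : ℕ => 1 / ((k : ℝ) + 2)) atTop (nhds 0) :=
      tendsto_const_nhds.div_atTop
        (tendsto_atTop_add_const_right _ _ tendsto_natCast_atTop_atTop)
    simpa using h1.const_sub 1
  obtain ⟨l, i, x, z, hl, hle, hx0, hxi, hz⟩ := exists_tendsto_axis
    (fun k => flowMatrix ω A (t k)) (fun k => abs_det_flowMatrix ω A (htpos k)) _ hs (by
      intro k z hz
      set s : ℝ := 1 - 1 / ((k : ℝ) + 2) with hsdef
      have hs1 : s ≤ 1 := by
        have : 0 ≤ 1 / ((k : ℝ) + 2) := by positivity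
        linarith
      have hs0 : 0 < s := by
        have : 1 / ((k : ℝ) + 2) < 1 := by
          rw [div_lt_one (by positivity)]
          linarith [(Nat.cast_nonneg k : (0 : ℝ) ≤ k)]
        linarith
      have ht1 : 1 ≤ t k := le_trans (by simp) (htk k)
      by_cases hq : z ∘ Sum.inr = 0
      · obtain ⟨i, hi⟩ := exists_abs_flowMatrix_ge_of_inr_eq_zero ω A (htpos k) hz hq
        exact ⟨Sum.inl i, (hs1.trans (Real.one_le_rpow ht1 (ω.α_pos i).le)).trans hi⟩
      · by_contra! hcon
        have h1 : quasiNorm ω.α (linForm A (z ∘ Sum.inl) (z ∘ Sum.inr)) < s * (1 / t k) := by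
          rw [quasiNorm_lt_iff ω.α_pos (mul_pos hs0 (one_div_pos.2 (htpos k)))]
          intro i
          have hti : 0 < t k ^ ω.α i := Real.rpow_pos_of_pos (htpos k) _
          have h2 := hcon (Sum.inl i)
          rw [flowMatrix_mulVec_inl, abs_mul, abs_of_pos hti] at h2
          rw [mul_one_div, Real.div_rpow hs0.le (htpos k).le, lt_div_iff₀ hti, mul_comm]
          refine h2.trans_le ?_
          calc s = s ^ (1 : ℝ) := (Real.rpow_one s).symm
            _ ≤ s ^ ω.α i := Real.rpow_le_rpow_of_exponent_ge hs0 hs1 (ω.α_le_one i)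
        have h2 := ht k _ _ hq h1
        rw [← not_lt, quasiNorm_lt_iff ω.β_pos (htpos k)] at h2
        apply h2
        intro j
        have h3 := hcon (Sum.inr j)
        have htj : 0 < t k ^ ω.β j := Real.rpow_pos_of_pos (htpos k) _
        rw [flowMatrix_mulVec_inr, Real.rpow_neg (htpos k).le, abs_mul, abs_inv, abs_of_pos htj,
          inv_mul_lt_iff₀ htj] at h3
        exact h3.trans_le (mul_le_of_le_one_right htj.le hs1))
  have hzi := tendsto_pi_nhds.1 hz
  have hxi0 : x i ≠ 0 := fun h => hx0 (funext fun j => by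
    by_cases hj : j = i
    · rw [hj, h]; rfl
    · rw [hxi j hj]; rfl)
  have hlt : ∀ j, ∀ r : ℝ, |x j| < r →
      ∀ᶠ k in l, |(flowMatrix ω A (t k) *ᵥ toReal (z k)) j| < r := fun j r hr =>
    (hzi j).abs.eventually_lt_const hr
  rcases i with i | j
  · set R : ℝ := (|x (Sum.inl i)| + 1) ^ (1 / ω.α i) with hR
    have hRpos : 0 < R := by positivity
    have h1 : ∀ᶠ k in l, ∀ i', |(flowMatrix ω A (t k) *ᵥ toReal (z k)) (Sum.inl i')| <
        R ^ ω.α i' := by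
      refine eventually_all.2 fun i' => hlt _ _ ?_
      by_cases hi : i' = i
      · subst hi
        rw [hR, ← Real.rpow_mul (by positivity), one_div, inv_mul_cancel₀ (ω.α_pos i').ne',
          Real.rpow_one]
        linarith
      · rw [hxi _ (by simpa using hi), abs_zero]
        positivity
    have h2 : ∀ᶠ k in l, ∀ j, |(flowMatrix ω A (t k) *ᵥ toReal (z k)) (Sum.inr j)| <
        (c / R) ^ ω.β j := by
      refine eventually_all.2 fun j => hlt _ _ ?_
      rw [hxi _ (by simp), abs_zero]
      positivity
    have h3 : ∀ᶠ k in l, R < t k := hle (htop.eventually_gt_atTop R)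
    have h4 : ∀ᶠ k in l, (0 : ℝ) = (flowMatrix ω A (t k) *ᵥ toReal (z k)) (Sum.inl i) := by
      filter_upwards [h1, h2, h3] with k hk1 hk2 hk3
      by_cases hq : z k ∘ Sum.inr = 0
      · by_cases hz0 : z k = 0
        · rw [hz0, toReal_zero, mulVec_zero]
          rfl
        · obtain ⟨i', hi'⟩ := exists_abs_flowMatrix_ge_of_inr_eq_zero ω A (htpos k) hz0 hq
          have := Real.rpow_lt_rpow hRpos.le hk3 (ω.α_pos i')
          linarith [hk1 i']
      · have := lt_mul_of_flowMatrix ω hA (htpos k) hRpos (by positivity) hq hk1 hk2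
        rw [mul_div_cancel₀ _ hRpos.ne'] at this
        exact absurd this (lt_irrefl _)
    exact hxi0 (tendsto_nhds_unique (hzi _) (tendsto_const_nhds.congr' h4))
  · set R : ℝ := (|x (Sum.inr j)| + 1) ^ (1 / ω.β j) with hR
    have hRpos : 0 < R := by positivity
    have h1 : ∀ᶠ k in l, ∀ j', |(flowMatrix ω A (t k) *ᵥ toReal (z k)) (Sum.inr j')| <
        R ^ ω.β j' := by
      refine eventually_all.2 fun j' => hlt _ _ ?_
      by_cases hj : j' = j
      · subst hj
        rw [hR, ← Real.rpow_mul (by positivity), one_div, inv_mul_cancel₀ (ω.β_pos j').ne',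
          Real.rpow_one]
        linarith
      · rw [hxi _ (by simpa using hj), abs_zero]
        positivity
    have h2 : ∀ᶠ k in l, ∀ i, |(flowMatrix ω A (t k) *ᵥ toReal (z k)) (Sum.inl i)| <
        (c / R) ^ ω.α i := by
      refine eventually_all.2 fun i => hlt _ _ ?_
      rw [hxi _ (by simp), abs_zero]
      positivity
    have h4 : ∀ᶠ k in l, (0 : ℝ) = (flowMatrix ω A (t k) *ᵥ toReal (z k)) (Sum.inr j) := by
      filter_upwards [h1, h2] with k hk1 hk2
      by_cases hq : z k ∘ Sum.inr = 0
      · rw [flowMatrix_mulVec_inr, show z k (Sum.inr j) = 0 from congrFun hq j]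
        simp
      · have := lt_mul_of_flowMatrix ω hA (htpos k) (by positivity) hRpos hq hk2 hk1
        rw [div_mul_cancel₀ _ hRpos.ne'] at this
        exact absurd this (lt_irrefl _)
    exact hxi0 (tendsto_nhds_unique (hzi _) (tendsto_const_nhds.congr' h4))

end Flow

section Counting

lemma card_le_of_abs_add_mul_lt {a b r : ℝ} (hb : b ≠ 0) (hr : 0 ≤ r) (S : Finset ℕ)
    (hS : ∀ k ∈ S, |a + k * b| < r) : (S.card : ℝ) ≤ 2 * r / |b| + 1 := by
  rcases S.eq_empty_or_nonempty with rfl | hne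
  · simp only [Finset.card_empty, Nat.cast_zero]
    positivity
  · have h1 := hS _ (S.min'_mem hne)
    have h2 := hS _ (S.max'_mem hne)
    have hle : S.min' hne ≤ S.max' hne := S.min'_le _ (S.max'_mem hne)
    have h3 : S.card ≤ S.max' hne + 1 - S.min' hne := by
      rw [← Nat.card_Icc]
      exact Finset.card_le_card fun k hk =>
        Finset.mem_Icc.2 ⟨S.min'_le _ hk, S.le_max' _ hk⟩
    have h4 : (S.card : ℝ) ≤ (S.max' hne : ℝ) - S.min' hne + 1 := by
      have : (S.card : ℝ) ≤ ((S.max' hne + 1 - S.min' hne : ℕ) : ℝ) := by exact_mod_cast h3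
      rw [Nat.cast_sub (by omega)] at this
      push_cast at this
      linarith
    have h5 : ((S.max' hne : ℝ) - S.min' hne) * |b| ≤ 2 * r := by
      rw [← abs_of_nonneg (sub_nonneg.2 (Nat.cast_le.2 hle : (S.min' hne : ℝ) ≤ S.max' hne)),
        ← abs_mul]
      have : ((S.max' hne : ℝ) - S.min' hne) * b =
          (a + S.max' hne * b) - (a + S.min' hne * b) := by ring
      rw [this]
      exact (abs_sub _ _).trans (by linarith)
    have h6 : (S.max' hne : ℝ) - S.min' hne ≤ 2 * r / |b| := by
      rwa [le_div_iff₀ (abs_pos.2 hb)]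
    linarith

/-- The number of integer points of a box at which an affine function is small. -/
lemma card_row_le {n : ℕ} (N : Fin n → ℕ) (x r : ℝ) (hr : 0 ≤ r) (b : Fin n → ℝ) (j₀ : Fin n)
    (hb : b j₀ ≠ 0) :
    (((Fintype.piFinset fun j => Finset.range (N j)).filter fun κ =>
      |x + ∑ j, κ j * b j| < r).card : ℝ) ≤
      (∏ j ∈ Finset.univ.erase j₀, (N j : ℝ)) * (2 * r / |b j₀| + 1) := by
  classical
  set S := (Fintype.piFinset fun j => Finset.range (N j)).filter fun κ =>
    |x + ∑ j, κ j * b j| < r with hS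
  set T : Finset (Fin n → ℕ) := Fintype.piFinset fun j => if j = j₀ then {0} else
    Finset.range (N j) with hT
  have hTcard : (T.card : ℝ) = ∏ j ∈ Finset.univ.erase j₀, (N j : ℝ) := by
    rw [hT, Fintype.card_piFinset, ← Finset.mul_prod_erase _ _ (Finset.mem_univ j₀)]
    simp only [if_true, Finset.card_singleton, one_mul, Nat.cast_prod]
    refine Finset.prod_congr rfl fun j hj => ?_
    rw [if_neg (Finset.ne_of_mem_erase hj), Finset.card_range]
  have hmaps : ∀ κ ∈ S, Function.update κ j₀ 0 ∈ T := by
    intro κ hκ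
    rw [hS, Finset.mem_filter, Fintype.mem_piFinset] at hκ
    rw [hT, Fintype.mem_piFinset]
    intro j
    by_cases hj : j = j₀
    · subst hj; simp
    · simpa [hj] using hκ.1 j
  rw [Finset.card_eq_sum_card_fiberwise hmaps, ← hTcard, ← nsmul_eq_mul, Nat.cast_sum]
  refine Finset.sum_le_card_nsmul _ _ _ fun τ _ => ?_
  set U := S.filter fun κ => Function.update κ j₀ 0 = τ with hU
  have hrec : ∀ κ ∈ U, κ = Function.update τ j₀ (κ j₀) := by
    intro κ hκ
    rw [← (Finset.mem_filter.1 hκ).2, Function.update_idem, Function.update_eq_self]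
  have hinj : Set.InjOn (fun κ : Fin n → ℕ => κ j₀) U := by
    intro κ hκ κ' hκ' h
    rw [hrec κ hκ, hrec κ' hκ']
    exact congrArg _ h
  rw [← Finset.card_image_of_injOn hinj]
  refine card_le_of_abs_add_mul_lt (a := x + ∑ j ∈ Finset.univ.erase j₀, τ j * b j) hb hr _ ?_
  intro k hk
  obtain ⟨κ, hκ, rfl⟩ := Finset.mem_image.1 hk
  have h1 := (Finset.mem_filter.1 (Finset.mem_filter.1 hκ).1).2
  rw [← Finset.add_sum_erase _ _ (Finset.mem_univ j₀)] at h1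
  have h2 : ∑ j ∈ Finset.univ.erase j₀, (κ j : ℝ) * b j =
      ∑ j ∈ Finset.univ.erase j₀, (τ j : ℝ) * b j := by
    refine Finset.sum_congr rfl fun j hj => ?_
    rw [hrec κ hκ, Function.update_of_ne (Finset.ne_of_mem_erase hj)]
  rw [h2] at h1
  rw [add_assoc, add_comm (∑ j ∈ Finset.univ.erase j₀, (τ j : ℝ) * b j)]
  exact h1

variable {ι : Type*} [Fintype ι] [DecidableEq ι]

/-- **Simplex lemma**: the points of a unimodular lattice in a small cube lie in a hyperplane. -/
lemma exists_hyperplane {M : Matrix ι ι ℝ} (hM : |M.det| = 1) {B : ℝ}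
    (hB : (Fintype.card ι).factorial * B ^ Fintype.card ι < 1) :
    ∃ w : ι → ℝ, w ≠ 0 ∧ ∀ z : ι → ℤ, (∀ l, |(M *ᵥ toReal z) l| ≤ B) →
      w ⬝ᵥ (M *ᵥ toReal z) = 0 := by
  set S : Set (ι → ℝ) := {v | ∃ z : ι → ℤ, v = M *ᵥ toReal z ∧ ∀ l, |v l| ≤ B} with hS
  by_cases hspan : Submodule.span ℝ S = ⊤
  · exfalso
    let b := Module.Basis.ofSpan hspan.ge
    have hbS : ∀ k, b k ∈ S := fun k => Module.Basis.ofSpan_subset hspan.ge ⟨k, rfl⟩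
    have := Module.Finite.finite_basis b
    have := Fintype.ofFinite ((linearIndepOn_empty ℝ id).extend (Set.empty_subset S))
    have hcard := Module.finrank_eq_card_basis b
    rw [Module.finrank_fintype_fun_eq_card] at hcard
    let b' := b.reindex (Fintype.equivOfCardEq hcard.symm)
    have hb' : ∀ k, b' k ∈ S := fun k => by
      simp only [b', Module.Basis.reindex_apply]
      exact hbS _
    choose z hz hzB using hb'
    let Z : Matrix ι ι ℤ := fun i k => z k i
    have hmul : M * Z.map (Int.cast : ℤ → ℝ) = fun i k => b' k i := by
      ext i k
      rw [hz]
      rfl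
    have hdet : ((Pi.basisFun ℝ ι).toMatrix b').det = M.det * (Z.det : ℝ) := by
      have h1 : (Pi.basisFun ℝ ι).toMatrix b' = M * Z.map (Int.cast : ℤ → ℝ) := by
        rw [hmul]
        ext i k
        simp [Module.Basis.toMatrix_apply]
      rw [h1, Matrix.det_mul]
      congr 1
      exact ((Int.castRingHom ℝ).map_det Z).symm
    have hunit : IsUnit ((Pi.basisFun ℝ ι).toMatrix b').det := by
      rw [← Module.Basis.det_apply]
      exact (Pi.basisFun ℝ ι).isUnit_det b'
    have h2 : |((Pi.basisFun ℝ ι).toMatrix b').det| < 1 := by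
      refine lt_of_le_of_lt ?_ hB
      rw [← nsmul_eq_mul]
      refine Matrix.det_le (abv := AbsoluteValue.abs) fun i k => ?_
      simpa [Module.Basis.toMatrix_apply] using hzB k i
    rw [hdet, abs_mul, hM, one_mul] at h2
    have h3 : Z.det = 0 := by
      have : |Z.det| < 1 := by exact_mod_cast h2
      exact Int.abs_lt_one_iff.1 this
    rw [hdet, h3] at hunit
    simp at hunit
  · obtain ⟨f, hf0, hf⟩ := Submodule.exists_le_ker_of_lt_top _ (lt_top_iff_ne_top.2 hspan)
    refine ⟨fun l => f (Pi.single l 1), fun h => hf0 ?_, fun z hz => ?_⟩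
    · ext l
      simpa using congrFun h l
    · have h1 : f (M *ᵥ toReal z) = 0 := hf (Submodule.subset_span ⟨z, rfl, hz⟩)
      rw [LinearMap.pi_apply_eq_sum_univ f] at h1
      rw [← h1]
      refine Finset.sum_congr rfl fun l _ => ?_
      have h2 : (fun j => if l = j then (1 : ℝ) else 0) = Pi.single l 1 := by
        ext j
        simp [Pi.single_apply, eq_comm]
      rw [smul_eq_mul, h2, mul_comm]

/-- The number of points of a separated lattice that lie in a box and in a hyperplane. -/
lemma exists_finset_of_hyperplane {M : Matrix ι ι ℝ} {δ : ℝ} (hδ : 0 < δ)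
    (hsep : ∀ z : ι → ℤ, z ≠ 0 → ∃ l, δ ≤ |(M *ᵥ toReal z) l|) (w : ι → ℝ) (l₀ : ι)
    (hw0 : w l₀ ≠ 0) (hw : ∀ l, |w l| ≤ |w l₀|) (s : ι → ℝ) (hs : ∀ l, 1 ≤ s l) :
    ∃ F : Finset (ι → ℤ), (∀ z : ι → ℤ, (∀ l, |(M *ᵥ toReal z) l| ≤ δ * s l) →
      w ⬝ᵥ (M *ᵥ toReal z) = 0 → z ∈ F) ∧
      (F.card : ℝ) ≤ ∏ l ∈ Finset.univ.erase l₀, (4 * Fintype.card ι * s l) := by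
  set d : ℝ := (Fintype.card ι : ℝ) with hd
  have hd1 : 1 ≤ d := by
    have : 0 < Fintype.card ι := Fintype.card_pos_iff.2 ⟨l₀⟩
    rw [hd]
    exact_mod_cast this
  set Z : Set (ι → ℤ) := {z | (∀ l, |(M *ᵥ toReal z) l| ≤ δ * s l) ∧
    w ⬝ᵥ (M *ᵥ toReal z) = 0} with hZ
  set g : (ι → ℤ) → ι → ℤ := fun z l => if l = l₀ then 0 else ⌊d * (M *ᵥ toReal z) l / δ⌋ with hg
  set T : Finset (ι → ℤ) := Fintype.piFinset fun l => if l = l₀ then {0} else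
    Finset.Icc ⌊-(d * s l)⌋ ⌊d * s l⌋ with hT
  have hmaps : Set.MapsTo g Z T := by
    intro z hz
    rw [hT, Finset.mem_coe, Fintype.mem_piFinset]
    intro l
    by_cases hl : l = l₀
    · simp [hg, hl]
    · simp only [hg, hl, if_false, Finset.mem_Icc]
      have h1 := abs_le.1 (hz.1 l)
      constructor <;> apply Int.floor_le_floor
      · rw [le_div_iff₀ hδ]
        nlinarith
      · rw [div_le_iff₀ hδ]
        nlinarith
  have hinj : Set.InjOn g Z := by
    intro z hz z' hz' h
    by_contra hne
    obtain ⟨l, hl⟩ := hsep (z - z') (sub_ne_zero.2 hne)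
    set u := M *ᵥ toReal (z - z') with hu
    have hu' : u = M *ᵥ toReal z - M *ᵥ toReal z' := by
      rw [hu, toReal_sub, Matrix.mulVec_sub]
    have h1 : ∀ l, l ≠ l₀ → |u l| < δ / d := by
      intro l hl
      have h2 := congrFun h l
      simp only [hg, hl, if_false] at h2
      have h3 := Int.abs_sub_lt_one_of_floor_eq_floor h2
      have h4 : d * (M *ᵥ toReal z) l / δ - d * (M *ᵥ toReal z') l / δ = d / δ * u l := by
        rw [hu', Pi.sub_apply]; ring
      rw [h4, abs_mul, abs_of_pos (by positivity)] at h3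
      rw [lt_div_iff₀ (by positivity)]
      rw [div_mul_eq_mul_div, div_lt_one hδ] at h3
      linarith
    have hwu : w ⬝ᵥ u = 0 := by
      rw [hu', dotProduct_sub, hz.2, hz'.2, sub_zero]
    have h5 : |u l₀| ≤ ∑ l ∈ Finset.univ.erase l₀, δ / d := by
      rw [dotProduct, ← Finset.add_sum_erase _ _ (Finset.mem_univ l₀)] at hwu
      have h6 : |w l₀| * |u l₀| ≤ |w l₀| * ∑ l ∈ Finset.univ.erase l₀, δ / d := by
        rw [← abs_mul, eq_neg_of_add_eq_zero_left hwu, abs_neg, Finset.mul_sum]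
        refine (Finset.abs_sum_le_sum_abs _ _).trans (Finset.sum_le_sum fun l hl => ?_)
        rw [abs_mul]
        exact mul_le_mul (hw l) (h1 l (Finset.ne_of_mem_erase hl)).le (abs_nonneg _)
          (abs_nonneg _)
      exact le_of_mul_le_mul_left h6 (abs_pos.2 hw0)
    have h7 : ∑ l ∈ Finset.univ.erase l₀, δ / d < δ := by
      rw [Finset.sum_const, Finset.card_erase_of_mem (Finset.mem_univ _), Finset.card_univ,
        nsmul_eq_mul, Nat.cast_sub (Fintype.card_pos_iff.2 ⟨l₀⟩), ← hd, Nat.cast_one,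
        mul_div_assoc', div_lt_iff₀ (by positivity)]
      linarith
    by_cases hll : l = l₀
    · subst hll
      linarith
    · have h8 := h1 l hll
      have h9 : δ / d ≤ δ := div_le_self hδ.le hd1
      linarith
  have hfin : Z.Finite := Set.Finite.of_injOn hmaps hinj T.finite_toSet
  refine ⟨hfin.toFinset, fun z h1 h2 => hfin.mem_toFinset.2 ⟨h1, h2⟩, ?_⟩
  have hcard : hfin.toFinset.card ≤ T.card :=
    Finset.card_le_card_of_injOn g (fun z hz => hmaps (hfin.mem_toFinset.1 hz))
      (fun z hz z' hz' => hinj (hfin.mem_toFinset.1 hz) (hfin.mem_toFinset.1 hz'))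
  refine (Nat.cast_le.2 hcard).trans ?_
  rw [hT, Fintype.card_piFinset, ← Finset.mul_prod_erase _ _ (Finset.mem_univ l₀)]
  simp only [if_true, Finset.card_singleton, one_mul, Nat.cast_prod]
  refine Finset.prod_le_prod (fun _ _ => Nat.cast_nonneg _) fun l hl => ?_
  rw [if_neg (Finset.ne_of_mem_erase hl), Int.card_Icc]
  have h1 : 1 ≤ d * s l := one_le_mul_of_one_le_of_one_le hd1 (hs l)
  have h2 : ⌊-(d * s l)⌋ ≤ ⌊d * s l⌋ := Int.floor_le_floor (by linarith)
  have h3 : (((⌊d * s l⌋ + 1 - ⌊-(d * s l)⌋).toNat : ℤ) : ℝ) =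
      ⌊d * s l⌋ + 1 - ⌊-(d * s l)⌋ := by
    rw [Int.toNat_of_nonneg (by linarith)]
    push_cast
    rfl
  have h4 := Int.floor_le (d * s l)
  have h5 := Int.lt_floor_add_one (-(d * s l))
  calc (((⌊d * s l⌋ + 1 - ⌊-(d * s l)⌋).toNat : ℕ) : ℝ) =
      ⌊d * s l⌋ + 1 - ⌊-(d * s l)⌋ := by exact_mod_cast h3
    _ ≤ 4 * d * s l := by linarith

end Counting

section Digits

variable {m n : ℕ}

/-- The number of subdivisions of the unit interval for the entry `(i, j)`. -/
noncomputable def gridSize (ω : Weights m n) (t : ℝ) (i : Fin m) (j : Fin n) : ℕ :=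
  ⌊t ^ (ω.α i + ω.β j)⌋₊

/-- The index set of the subdivision of the unit box of matrices into small boxes. -/
noncomputable def digits (ω : Weights m n) (t : ℝ) : Finset (Fin m → Fin n → ℕ) :=
  Fintype.piFinset fun i => Fintype.piFinset fun j => Finset.range (gridSize ω t i j)

/-- After translation by the corner of the box with index `κ`, the vector `v` has a small first
component. -/
def Hits (ω : Weights m n) (t δ : ℝ) (κ : Fin m → Fin n → ℕ) (v : Fin m ⊕ Fin n → ℝ) : Prop :=
  ∀ i, |v (Sum.inl i) + ∑ j, κ i j * (t ^ (-(ω.α i + ω.β j)) * v (Sum.inr j))| <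
    δ * t ^ (-ω.α i)

lemma card_digits (ω : Weights m n) (t : ℝ) :
    ((digits ω t).card : ℝ) = ∏ i, ∏ j, (gridSize ω t i j : ℝ) := by
  simp [digits]

lemma gridSize_le (ω : Weights m n) {t : ℝ} (ht : 0 ≤ t) (i : Fin m) (j : Fin n) :
    (gridSize ω t i j : ℝ) ≤ t ^ (ω.α i + ω.β j) :=
  Nat.floor_le (Real.rpow_nonneg ht _)

lemma le_two_mul_gridSize (ω : Weights m n) {t : ℝ} (ht : 1 ≤ t) (i : Fin m) (j : Fin n) :
    t ^ (ω.α i + ω.β j) ≤ 2 * gridSize ω t i j := by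
  have h1 : 1 ≤ t ^ (ω.α i + ω.β j) :=
    Real.one_le_rpow ht (add_pos (ω.α_pos i) (ω.β_pos j)).le
  have h2 : 1 ≤ gridSize ω t i j := Nat.le_floor (by exact_mod_cast h1)
  have h3 : t ^ (ω.α i + ω.β j) < gridSize ω t i j + 1 := Nat.lt_floor_add_one _
  have h4 : (1 : ℝ) ≤ gridSize ω t i j := by exact_mod_cast h2
  linarith

open Classical in
lemma card_hits_le (ω : Weights m n) {t δ : ℝ} (ht : 1 ≤ t) (hδ : 0 < δ)
    (v : Fin m ⊕ Fin n → ℝ) (j₀ : Fin n) (h0 : v (Sum.inr j₀) ≠ 0)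
    (hlt : |v (Sum.inr j₀)| < δ * t ^ ω.β j₀) :
    (((digits ω t).filter fun κ => Hits ω t δ κ v).card : ℝ) ≤
      (digits ω t).card * ∏ i, (6 * δ * t ^ (-ω.α i) / |v (Sum.inr j₀)|) := by
  have ht0 : 0 < t := by linarith
  have hset : (digits ω t).filter (fun κ => Hits ω t δ κ v) =
      Fintype.piFinset fun i => (Fintype.piFinset fun j => Finset.range (gridSize ω t i j)).filter
        fun κ : Fin n → ℕ => |v (Sum.inl i) +
          ∑ j, κ j * (t ^ (-(ω.α i + ω.β j)) * v (Sum.inr j))| < δ * t ^ (-ω.α i) := by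
    ext κ
    rw [Finset.mem_filter, digits, Fintype.mem_piFinset, Fintype.mem_piFinset]
    exact ⟨fun h i => Finset.mem_filter.2 ⟨h.1 i, h.2 i⟩,
      fun h => ⟨fun i => (Finset.mem_filter.1 (h i)).1, fun i => (Finset.mem_filter.1 (h i)).2⟩⟩
  rw [hset, Fintype.card_piFinset, card_digits, ← Finset.prod_mul_distrib, Nat.cast_prod]
  refine Finset.prod_le_prod (fun _ _ => Nat.cast_nonneg _) fun i _ => ?_
  have hY : 0 < |v (Sum.inr j₀)| := abs_pos.2 h0
  have hT : 0 < t ^ (-(ω.α i + ω.β j₀)) := Real.rpow_pos_of_pos ht0 _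
  have hA : 0 < t ^ (-ω.α i) := Real.rpow_pos_of_pos ht0 _
  have hBp : 0 < t ^ ω.β j₀ := Real.rpow_pos_of_pos ht0 _
  refine (card_row_le (gridSize ω t i) (v (Sum.inl i)) (δ * t ^ (-ω.α i)) (by positivity)
    (fun j => t ^ (-(ω.α i + ω.β j)) * v (Sum.inr j)) j₀ (mul_ne_zero hT.ne' h0)).trans ?_
  rw [← Finset.mul_prod_erase _ _ (Finset.mem_univ j₀), mul_comm (gridSize ω t i j₀ : ℝ), mul_assoc]
  refine mul_le_mul_of_nonneg_left ?_ (Finset.prod_nonneg fun _ _ => Nat.cast_nonneg _)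
  have hN := le_two_mul_gridSize ω ht i j₀
  have h1 : t ^ (-(ω.α i + ω.β j₀)) * (t ^ ω.β j₀) = t ^ (-ω.α i) := by
    rw [← Real.rpow_add ht0]
    congr 1
    ring
  have h2 : t ^ (-ω.α i) * t ^ (ω.α i + ω.β j₀) = t ^ ω.β j₀ := by
    rw [← Real.rpow_add ht0]
    congr 1
    ring
  rw [abs_mul, abs_of_pos hT]
  calc 2 * (δ * t ^ (-ω.α i)) / (t ^ (-(ω.α i + ω.β j₀)) * |v (Sum.inr j₀)|) + 1
      = 2 * δ * t ^ ω.β j₀ / |v (Sum.inr j₀)| + 1 := by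
        rw [← h1]
        field_simp
    _ ≤ 2 * δ * t ^ ω.β j₀ / |v (Sum.inr j₀)| + δ * t ^ ω.β j₀ / |v (Sum.inr j₀)| := by
        have : 1 ≤ δ * t ^ ω.β j₀ / |v (Sum.inr j₀)| := (one_le_div hY).2 hlt.le
        linarith
    _ = 3 * δ * t ^ (-ω.α i) / |v (Sum.inr j₀)| * t ^ (ω.α i + ω.β j₀) := by
        rw [← h2]
        ring
    _ ≤ 3 * δ * t ^ (-ω.α i) / |v (Sum.inr j₀)| * (2 * gridSize ω t i j₀) :=
        mul_le_mul_of_nonneg_left hN (by positivity)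
    _ = _ := by ring

lemma prod_sides_le (ω : Weights m n) {t b ρ : ℝ} (ht : 1 ≤ t) (hb : ∀ j, b ≤ ω.β j) (hρ : 1 ≤ ρ)
    (l₀ : Fin m ⊕ Fin n) :
    ∏ l ∈ Finset.univ.erase l₀,
      (Sum.elim (fun _ : Fin m => 2 * ρ) (fun j => min ρ (t ^ ω.β j)) l : ℝ) ≤
      (2 * ρ) ^ m * t ^ (1 - b) := by
  have ht0 : 0 < t := by linarith
  set s : Fin m ⊕ Fin n → ℝ := Sum.elim (fun _ => 2 * ρ) (fun j => min ρ (t ^ ω.β j)) with hs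
  have hβ : ∀ j, 0 < min ρ (t ^ ω.β j) := fun j =>
    lt_min (by linarith) (Real.rpow_pos_of_pos ht0 _)
  have hpos : 0 < s l₀ := by
    rcases l₀ with i | j
    · simp only [hs, Sum.elim_inl]
      linarith
    · exact hβ j
  have hmin : ∀ j, ∏ j', min ρ (t ^ ω.β j') ≤ min ρ (t ^ ω.β j) * t ^ (1 - b) := by
    intro j
    rw [← Finset.mul_prod_erase _ _ (Finset.mem_univ j)]
    refine mul_le_mul_of_nonneg_left ?_ (hβ j).le
    calc ∏ j' ∈ Finset.univ.erase j, min ρ (t ^ ω.β j') ≤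
        ∏ j' ∈ Finset.univ.erase j, t ^ ω.β j' :=
          Finset.prod_le_prod (fun j' _ => (hβ j').le) fun j' _ => min_le_right _ _
      _ = t ^ (∑ j' ∈ Finset.univ.erase j, ω.β j') := (Real.rpow_sum_of_pos ht0 _ _).symm
      _ ≤ t ^ (1 - b) := by
          refine Real.rpow_le_rpow_of_exponent_le ht ?_
          have := Finset.add_sum_erase Finset.univ ω.β (Finset.mem_univ j)
          rw [ω.β_sum] at this
          linarith [hb j]
  refine le_of_mul_le_mul_left ?_ hpos
  rw [Finset.mul_prod_erase _ _ (Finset.mem_univ l₀), Fintype.prod_sum_type]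
  simp only [hs, Sum.elim_inl, Sum.elim_inr, Finset.prod_const, Finset.card_univ, Fintype.card_fin]
  have hm : (0 : ℝ) ≤ (2 * ρ) ^ m := by positivity
  rcases l₀ with i | j
  · obtain ⟨j⟩ := ω.nonempty_right
    have h1 : min ρ (t ^ ω.β j) ≤ 2 * ρ := (min_le_left _ _).trans (by linarith)
    calc (2 * ρ) ^ m * ∏ j', min ρ (t ^ ω.β j')
        ≤ (2 * ρ) ^ m * (min ρ (t ^ ω.β j) * t ^ (1 - b)) :=
          mul_le_mul_of_nonneg_left (hmin j) hm
      _ ≤ (2 * ρ) ^ m * (2 * ρ * t ^ (1 - b)) := by gcongr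
      _ = _ := by simp only [Sum.elim_inl]; ring
  · calc (2 * ρ) ^ m * ∏ j', min ρ (t ^ ω.β j')
        ≤ (2 * ρ) ^ m * (min ρ (t ^ ω.β j) * t ^ (1 - b)) :=
          mul_le_mul_of_nonneg_left (hmin j) hm
      _ = _ := by simp only [Sum.elim_inr]; ring

open Classical in
/-- At most half of the small boxes contain a matrix that moves a vector of the lattice into a small
neighbourhood of the origin. -/
theorem two_mul_card_bad_le (ω : Weights m n) {t δ b : ℝ} (L : ℕ) (hb : ∀ j, b ≤ ω.β j)
    (ht : 1 ≤ t) (htα : ∀ i, 2 ≤ t ^ ω.α i) (hδ : 0 < δ) (hL : 2 * n * t ≤ 2 ^ L)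
    (hsmall : ((m + n).factorial : ℝ) * ((n + 1) * t * δ) ^ (m + n) < 1)
    (hC : 2 * ((4 * ((m + n : ℕ) : ℝ)) ^ (m + n) * (24 * n) ^ m * L * t ^ (-b)) ≤ 1)
    {M : Matrix (Fin m ⊕ Fin n) (Fin m ⊕ Fin n) ℝ} (hM : |M.det| = 1)
    (hsep : ∀ z : Fin m ⊕ Fin n → ℤ, z ≠ 0 → ∃ l, δ ≤ |(M *ᵥ toReal z) l|) :
    2 * ((digits ω t).filter fun κ => ∃ z : Fin m ⊕ Fin n → ℤ, z ≠ 0 ∧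
      (∀ j, |(M *ᵥ toReal z) (Sum.inr j)| < δ * t ^ ω.β j) ∧
        Hits ω t δ κ (M *ᵥ toReal z)).card ≤ (digits ω t).card := by
  have ht0 : 0 < t := by linarith
  have := ω.nonempty_left
  have hne := ω.nonempty_right
  have hn1 : (1 : ℝ) ≤ n := by
    have : 0 < n := Fin.pos_iff_nonempty.2 hne
    exact_mod_cast this
  have hcard : Fintype.card (Fin m ⊕ Fin n) = m + n := by simp
  obtain ⟨w, hw0, hw⟩ := exists_hyperplane hM (B := (n + 1) * t * δ) (by rwa [hcard])
  obtain ⟨l₀, hl₀⟩ := Finite.exists_max fun l => |w l|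
  have hwl₀ : w l₀ ≠ 0 := fun h => hw0 (funext fun l => by
    have := hl₀ l
    rw [h, abs_zero] at this
    exact abs_nonpos_iff.1 this)
  set s : ℕ → Fin m ⊕ Fin n → ℝ := fun l =>
    Sum.elim (fun _ => 2 * 2 ^ l) (fun j => min (2 ^ l) (t ^ ω.β j)) with hs
  have h2l : ∀ l : ℕ, (1 : ℝ) ≤ 2 ^ l := fun l => one_le_pow₀ one_le_two
  have hs1 : ∀ l k, 1 ≤ s l k := by
    intro l k
    rcases k with i | j
    · simp only [hs, Sum.elim_inl]
      linarith [h2l l]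
    · exact le_min (h2l l) (Real.one_le_rpow ht (ω.β_pos j).le)
  choose F hF hFcard using fun l : ℕ => exists_finset_of_hyperplane hδ hsep w l₀ hwl₀ hl₀ (s l)
    (hs1 l)
  set F' : ℕ → Finset (Fin m ⊕ Fin n → ℤ) := fun l => (F l).filter fun z =>
    ∃ j, |(M *ᵥ toReal z) (Sum.inr j)| < δ * t ^ ω.β j ∧
      δ * 2 ^ l / (2 * n) ≤ |(M *ᵥ toReal z) (Sum.inr j)| with hF'
  have hcover : ((digits ω t).filter fun κ => ∃ z : Fin m ⊕ Fin n → ℤ, z ≠ 0 ∧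
      (∀ j, |(M *ᵥ toReal z) (Sum.inr j)| < δ * t ^ ω.β j) ∧ Hits ω t δ κ (M *ᵥ toReal z)) ⊆
      (Finset.range L).biUnion fun l => (F' l).biUnion fun z =>
        (digits ω t).filter fun κ => Hits ω t δ κ (M *ᵥ toReal z) := by
    intro κ hκ
    obtain ⟨hκd, z, hz0, hzβ, hzκ⟩ := Finset.mem_filter.1 hκ
    set v := M *ᵥ toReal z with hv
    obtain ⟨j₀, hj₀⟩ := Finite.exists_max fun j => |v (Sum.inr j)|
    set Y := |v (Sum.inr j₀)| with hY
    have hY0 : 0 ≤ Y := abs_nonneg _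
    have hx : ∀ i, |v (Sum.inl i)| ≤ n * Y + δ / 2 := by
      intro i
      have h1 := hzκ i
      have h2 : |∑ j, (κ i j : ℝ) * (t ^ (-(ω.α i + ω.β j)) * v (Sum.inr j))| ≤ n * Y := by
        refine (Finset.abs_sum_le_sum_abs _ _).trans ?_
        have : ∀ j ∈ Finset.univ, |(κ i j : ℝ) * (t ^ (-(ω.α i + ω.β j)) * v (Sum.inr j))| ≤ Y := by
          intro j _
          have hT : 0 < t ^ (ω.α i + ω.β j) := Real.rpow_pos_of_pos ht0 _
          rw [digits, Fintype.mem_piFinset] at hκd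
          have h3 := Fintype.mem_piFinset.1 (hκd i) j
          rw [Finset.mem_range] at h3
          have h4 : (κ i j : ℝ) ≤ t ^ (ω.α i + ω.β j) :=
            (Nat.cast_le.2 h3.le).trans (gridSize_le ω ht0.le i j)
          have h5 : (κ i j : ℝ) * t ^ (-(ω.α i + ω.β j)) ≤ 1 := by
            rw [Real.rpow_neg ht0.le, ← div_eq_mul_inv, div_le_one hT]
            exact h4
          rw [← mul_assoc, abs_mul, abs_of_nonneg (by positivity)]
          exact (mul_le_of_le_one_left (abs_nonneg _) h5).trans (hj₀ j)
        simpa using Finset.sum_le_card_nsmul _ _ _ this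
      have h3 : δ * t ^ (-ω.α i) ≤ δ / 2 := by
        rw [Real.rpow_neg ht0.le, ← div_eq_mul_inv]
        exact div_le_div_of_nonneg_left hδ.le two_pos (htα i)
      have h4 : v (Sum.inl i) = (v (Sum.inl i) +
          ∑ j, κ i j * (t ^ (-(ω.α i + ω.β j)) * v (Sum.inr j))) -
            ∑ j, κ i j * (t ^ (-(ω.α i + ω.β j)) * v (Sum.inr j)) := by ring
      rw [h4]
      exact (abs_sub _ _).trans (by linarith)
    have hYlow : δ / (2 * n) ≤ Y := by
      by_contra! hlt
      have h1 : n * Y < δ / 2 := by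
        rw [lt_div_iff₀ (by positivity)] at hlt
        linarith
      obtain ⟨l, hl⟩ := hsep z hz0
      rcases l with i | j
      · linarith [hx i]
      · have h2 := hj₀ j
        have h3 : Y ≤ n * Y := le_mul_of_one_le_left hY0 hn1
        linarith
    have hYup : Y < δ * t := by
      refine (hzβ j₀).trans_le (mul_le_mul_of_nonneg_left ?_ hδ.le)
      calc t ^ ω.β j₀ ≤ t ^ (1 : ℝ) := Real.rpow_le_rpow_of_exponent_le ht (ω.β_le_one j₀)
        _ = t := Real.rpow_one t
    have hYpos : 0 < Y := lt_of_lt_of_le (by positivity) hYlow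
    obtain ⟨l, hl1, hl2⟩ := exists_nat_pow_near (x := 2 * n * Y / δ) (y := 2)
      (by
        rw [div_le_iff₀ (by positivity)] at hYlow
        rw [one_le_div hδ]
        linarith) one_lt_two
    rw [le_div_iff₀ hδ] at hl1
    rw [div_lt_iff₀ hδ] at hl2
    have hlL : l < L := by
      rw [← pow_lt_pow_iff_right₀ (one_lt_two : (1 : ℝ) < 2)]
      refine lt_of_lt_of_le ?_ hL
      refine lt_of_mul_lt_mul_right (hl1.trans_lt ?_) hδ.le
      have : 2 * n * Y < 2 * n * (δ * t) := mul_lt_mul_of_pos_left hYup (by positivity)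
      linarith
    have hYρ : n * Y < δ * 2 ^ l := by
      rw [pow_succ] at hl2
      linarith
    have hYY : Y ≤ n * Y := le_mul_of_one_le_left hY0 hn1
    refine Finset.mem_biUnion.2 ⟨l, Finset.mem_range.2 hlL, Finset.mem_biUnion.2 ⟨z, ?_,
      Finset.mem_filter.2 ⟨hκd, hzκ⟩⟩⟩
    refine Finset.mem_filter.2 ⟨hF l z ?_ (hw z ?_), j₀, hzβ j₀, ?_⟩
    · intro k
      rcases k with i | j
      · simp only [hs, Sum.elim_inl]
        have := hx i
        have := h2l l
        nlinarith
      · simp only [hs, Sum.elim_inr]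
        rw [mul_min_of_nonneg _ _ hδ.le]
        exact le_min ((hj₀ j).trans (by linarith)) (hzβ j).le
    · intro k
      rcases k with i | j
      · have := hx i
        nlinarith
      · refine (hj₀ j).trans ?_
        nlinarith [mul_pos ht0 hδ]
    · rw [div_le_iff₀ (by positivity)]
      linarith
  set D : ℝ := ((digits ω t).card : ℝ) with hD
  set d : ℝ := ((m + n : ℕ) : ℝ) with hd
  have hd1 : 1 ≤ 4 * d := by
    have : (n : ℝ) ≤ d := by rw [hd]; exact_mod_cast Nat.le_add_left n m
    linarith
  have hshell : ∀ l, (((F' l).biUnion fun z =>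
      (digits ω t).filter fun κ => Hits ω t δ κ (M *ᵥ toReal z)).card : ℝ) ≤
        D * ((4 * d) ^ (m + n) * (24 * n) ^ m * t ^ (-b)) := by
    intro l
    have h1 : ∀ z ∈ F' l, (((digits ω t).filter fun κ => Hits ω t δ κ (M *ᵥ toReal z)).card : ℝ) ≤
        D * ((12 * n / 2 ^ l) ^ m * t ^ (-1 : ℝ)) := by
      intro z hz
      obtain ⟨-, j, hj1, hj2⟩ := Finset.mem_filter.1 hz
      have hpos : 0 < |(M *ᵥ toReal z) (Sum.inr j)| := lt_of_lt_of_le (by positivity) hj2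
      refine (card_hits_le ω ht hδ _ j (abs_pos.1 hpos) hj1).trans
        (mul_le_mul_of_nonneg_left ?_ (Nat.cast_nonneg _))
      have h2 : t ^ (-1 : ℝ) = ∏ i, t ^ (-ω.α i) := by
        rw [← Real.rpow_sum_of_pos ht0, Finset.sum_neg_distrib, ω.α_sum]
      have h3 : ((12 * n / 2 ^ l) ^ m : ℝ) = ∏ _i : Fin m, (12 * n / 2 ^ l : ℝ) := by simp [div_pow]
      rw [h2, h3, ← Finset.prod_mul_distrib]
      refine Finset.prod_le_prod (fun i _ => ?_) fun i _ => ?_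
      · have : 0 < t ^ (-ω.α i) := Real.rpow_pos_of_pos ht0 _
        positivity
      · have hA : 0 < t ^ (-ω.α i) := Real.rpow_pos_of_pos ht0 _
        rw [div_le_iff₀ (by positivity)] at hj2
        rw [div_mul_eq_mul_div, div_le_div_iff₀ hpos (by positivity)]
        nlinarith
    have h2 : ((F' l).card : ℝ) ≤ (4 * d) ^ (m + n) * ((2 * 2 ^ l) ^ m * t ^ (1 - b)) := by
      have h3 : ((F' l).card : ℝ) ≤ (F l).card := by
        exact_mod_cast Finset.card_le_card (Finset.filter_subset _ _)
      refine (h3.trans (hFcard l)).trans ?_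
      rw [Finset.prod_mul_distrib, hcard, Finset.prod_const,
        Finset.card_erase_of_mem (Finset.mem_univ _), Finset.card_univ, hcard]
      refine mul_le_mul (pow_le_pow_right₀ hd1 (Nat.sub_le _ _))
        (prod_sides_le ω ht hb (h2l l) l₀)
        (Finset.prod_nonneg fun k _ => zero_le_one.trans (hs1 l k)) (by positivity)
    calc (((F' l).biUnion fun z =>
        (digits ω t).filter fun κ => Hits ω t δ κ (M *ᵥ toReal z)).card : ℝ)
        ≤ ∑ z ∈ F' l, (((digits ω t).filter fun κ => Hits ω t δ κ (M *ᵥ toReal z)).card : ℝ) := by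
          exact_mod_cast Finset.card_biUnion_le
      _ ≤ (F' l).card * (D * ((12 * n / 2 ^ l) ^ m * t ^ (-1 : ℝ))) := by
          rw [← nsmul_eq_mul]
          exact Finset.sum_le_card_nsmul _ _ _ h1
      _ ≤ ((4 * d) ^ (m + n) * ((2 * 2 ^ l) ^ m * t ^ (1 - b))) *
          (D * ((12 * n / 2 ^ l) ^ m * t ^ (-1 : ℝ))) := by
          refine mul_le_mul_of_nonneg_right h2 ?_
          positivity
      _ = D * ((4 * d) ^ (m + n) * ((2 * 2 ^ l) * (12 * n / 2 ^ l)) ^ m *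
            (t ^ (1 - b) * t ^ (-1 : ℝ))) := by rw [mul_pow (2 * 2 ^ l : ℝ)]; ring
      _ = D * ((4 * d) ^ (m + n) * (24 * n) ^ m * t ^ (-b)) := by
          rw [← Real.rpow_add ht0]
          congr 3
          · congr 1
            field_simp
            ring
          · ring
  have hfinal : (2 : ℝ) * ((digits ω t).filter fun κ => ∃ z : Fin m ⊕ Fin n → ℤ, z ≠ 0 ∧
      (∀ j, |(M *ᵥ toReal z) (Sum.inr j)| < δ * t ^ ω.β j) ∧
        Hits ω t δ κ (M *ᵥ toReal z)).card ≤ D := by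
    have h1 := Finset.card_le_card hcover
    have h2 : (((digits ω t).filter fun κ => ∃ z : Fin m ⊕ Fin n → ℤ, z ≠ 0 ∧
        (∀ j, |(M *ᵥ toReal z) (Sum.inr j)| < δ * t ^ ω.β j) ∧
          Hits ω t δ κ (M *ᵥ toReal z)).card : ℝ) ≤
        L * (D * ((4 * d) ^ (m + n) * (24 * n) ^ m * t ^ (-b))) := by
      refine (Nat.cast_le.2 (h1.trans Finset.card_biUnion_le)).trans ?_
      rw [Nat.cast_sum]
      have := Finset.sum_le_card_nsmul (Finset.range L) _ _ fun l _ => hshell l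
      rwa [Finset.card_range, nsmul_eq_mul] at this
    have hD0 : 0 ≤ D := Nat.cast_nonneg _
    nlinarith
  rw [hD] at hfinal
  exact_mod_cast hfinal

end Digits

section Mass

open MeasureTheory

/-- The measure on the branches of the `b`-ary tree that gives each node of level `k` the mass
`b ^ (-k)`. -/
noncomputable def branchMeasure (b : ℕ) [NeZero b] : Measure (ℕ → Fin b) :=
  Measure.infinitePi fun _ => (PMF.uniformOfFintype (Fin b)).toMeasure

instance (b : ℕ) [NeZero b] : IsProbabilityMeasure (branchMeasure b) := by
  unfold branchMeasure; infer_instance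

lemma branchMeasure_prefix (b : ℕ) [NeZero b] {k : ℕ} (w : Fin k → Fin b) :
    branchMeasure b {ω | (fun l : Fin k => ω l) = w} = ((b : ℝ≥0∞)⁻¹) ^ k := by
  have h : {ω : ℕ → Fin b | (fun l : Fin k => ω l) = w} =
      Set.pi (Finset.range k) fun l => {if h : l < k then w ⟨l, h⟩ else 0} := by
    ext ω
    simp only [Set.mem_ofPred_eq, funext_iff, Set.mem_pi, Finset.coe_range, Set.mem_Iio,
      Set.mem_singleton_iff]
    exact ⟨fun h l hl => by rw [dif_pos hl, ← h ⟨l, hl⟩],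
      fun h l => by rw [h l l.2, dif_pos l.2]⟩
  rw [h, branchMeasure, Measure.infinitePi_pi _ fun _ _ => measurableSet_singleton _]
  simp

lemma branchMeasure_le_of_prefix_mem {b : ℕ} [NeZero b] {k : ℕ} {S : Set (ℕ → Fin b)}
    (W : Finset (Fin k → Fin b)) (hW : ∀ ω ∈ S, (fun l : Fin k => ω l) ∈ W) {B : ℝ}
    (hB : (W.card : ℝ) ≤ B * (b : ℝ) ^ k) : branchMeasure b S ≤ ENNReal.ofReal B := by
  have hb : (0 : ℝ) < b := by exact_mod_cast Nat.pos_of_ne_zero (NeZero.ne b)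
  have h1 : S ⊆ ⋃ w ∈ W, {ω | (fun l : Fin k => ω l) = w} := fun ω hω => by
    simp only [Set.mem_iUnion]
    exact ⟨_, hW ω hω, rfl⟩
  calc branchMeasure b S ≤ branchMeasure b (⋃ w ∈ W, {ω | (fun l : Fin k => ω l) = w}) :=
        measure_mono h1
    _ ≤ ∑ w ∈ W, branchMeasure b {ω | (fun l : Fin k => ω l) = w} :=
        measure_biUnion_finset_le _ _
    _ = W.card * ((b : ℝ≥0∞)⁻¹) ^ k := by simp [branchMeasure_prefix]
    _ = ENNReal.ofReal (W.card * ((b : ℝ)⁻¹) ^ k) := by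
        rw [ENNReal.ofReal_mul (by positivity), ENNReal.ofReal_pow (by positivity),
          ENNReal.ofReal_inv_of_pos hb]
        simp
    _ ≤ ENNReal.ofReal B := by
        apply ENNReal.ofReal_le_ofReal
        rw [inv_pow, ← div_eq_mul_inv, div_le_iff₀ (by positivity)]
        exact hB

/-- The mass distribution principle for the image of the branches of a tree. -/
theorem le_dimH_range_of_card_le {X : Type*} [MetricSpace X] [MeasurableSpace X] [BorelSpace X]
    {b : ℕ} [NeZero b] {Φ : (ℕ → Fin b) → X} (hΦ : Measurable Φ) {d : NNReal} (hd : 0 < d)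
    {K r₀ : ℝ} (hK : 0 < K) (hr₀ : 0 < r₀)
    (h : ∀ (S : Set X) (r : ℝ), 0 < r → r ≤ r₀ → (∀ x ∈ S, ∀ y ∈ S, dist x y ≤ r) →
      ∃ (k : ℕ) (W : Finset (Fin k → Fin b)), (∀ ω, Φ ω ∈ S → (fun l : Fin k => ω l) ∈ W) ∧
        (W.card : ℝ) ≤ K * r ^ (d : ℝ) * (b : ℝ) ^ k) :
    (d : ℝ≥0∞) ≤ dimH (Set.range Φ) := by
  have hd' : (0 : ℝ) < d := hd
  set μ : Measure X := (branchMeasure b).map Φ with hμ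
  have h1 : ∀ (S : Set X) (r : ℝ), 0 < r → r ≤ r₀ → Metric.ediam S ≤ ENNReal.ofReal r →
      μ S ≤ ENNReal.ofReal (K * r ^ (d : ℝ)) := by
    intro S r hr hr' hS
    have hcl : ∀ x ∈ closure S, ∀ y ∈ closure S, dist x y ≤ r := fun x hx y hy => by
      have := Metric.ediam_le_iff.1 ((Metric.ediam_closure S).le.trans hS) x hx y hy
      rwa [edist_dist, ENNReal.ofReal_le_ofReal_iff hr.le] at this
    obtain ⟨k, W, hW, hcard⟩ := h (closure S) r hr hr' hcl
    calc μ S ≤ μ (closure S) := measure_mono subset_closure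
      _ = branchMeasure b (Φ ⁻¹' closure S) := Measure.map_apply hΦ isClosed_closure.measurableSet
      _ ≤ _ := branchMeasure_le_of_prefix_mem W (fun ω hω => hW ω hω) hcard
  have h2 : ∀ S : Set X, Metric.ediam S ≤ ENNReal.ofReal r₀ →
      μ S ≤ ENNReal.ofReal K * Metric.ediam S ^ (d : ℝ) := by
    intro S hS
    have hfin : Metric.ediam S ≠ ⊤ := (hS.trans_lt ENNReal.ofReal_lt_top).ne
    rcases eq_or_ne (Metric.ediam S) 0 with h0 | h0
    · have hlim : Tendsto (fun r : ℝ => ENNReal.ofReal (K * r ^ (d : ℝ)))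
          (nhdsWithin 0 (Set.Ioi 0)) (nhds 0) := by
        have hc : Tendsto (fun r : ℝ => ENNReal.ofReal (K * r ^ (d : ℝ))) (nhds 0)
            (nhds (ENNReal.ofReal (K * (0 : ℝ) ^ (d : ℝ)))) :=
          (ENNReal.tendsto_ofReal ((Real.continuousAt_rpow_const 0 _ (Or.inr hd'.le)).tendsto.const_mul K))
        rw [Real.zero_rpow hd'.ne', mul_zero, ENNReal.ofReal_zero] at hc
        exact hc.mono_left nhdsWithin_le_nhds
      refine (ge_of_tendsto hlim ?_).trans (zero_le)
      filter_upwards [Ioc_mem_nhdsGT hr₀] with r hr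
      exact h1 S r hr.1 hr.2 (by rw [h0]; exact zero_le)
    · have hpos := ENNReal.toReal_pos h0 hfin
      have := h1 S (Metric.ediam S).toReal hpos
        (by rw [← ENNReal.toReal_ofReal hr₀.le]; exact ENNReal.toReal_mono ENNReal.ofReal_ne_top hS)
        (ENNReal.ofReal_toReal hfin).ge
      rwa [ENNReal.ofReal_mul hK.le, ← ENNReal.ofReal_rpow_of_pos hpos,
        ENNReal.ofReal_toReal hfin] at this
  have hK0 : ENNReal.ofReal K ≠ 0 := by simpa using hK
  have h3 : (ENNReal.ofReal K)⁻¹ • μ ≤ μH[(d : ℝ)] := by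
    refine Measure.le_hausdorffMeasure _ _ (ENNReal.ofReal r₀) (by simpa using hr₀) fun S hS => ?_
    rw [Measure.smul_apply, smul_eq_mul]
    calc (ENNReal.ofReal K)⁻¹ * μ S
        ≤ (ENNReal.ofReal K)⁻¹ * (ENNReal.ofReal K * Metric.ediam S ^ (d : ℝ)) := by
          gcongr; exact h2 S hS
      _ = Metric.ediam S ^ (d : ℝ) := by
          rw [← mul_assoc, ENNReal.inv_mul_cancel hK0 ENNReal.ofReal_ne_top, one_mul]
  refine le_dimH_of_hausdorffMeasure_ne_zero fun h0 => ?_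
  have h4 := (h3 (Set.range Φ)).trans h0.le
  rw [Measure.smul_apply, smul_eq_mul, nonpos_iff_eq_zero, mul_eq_zero] at h4
  rcases h4 with h4 | h4
  · exact ENNReal.inv_ne_zero.2 ENNReal.ofReal_ne_top h4
  · have h5 := (Measure.le_map_apply hΦ.aemeasurable (Set.range Φ)).trans h4.le
    rw [Set.preimage_range] at h5
    simp at h5

end Mass

section Cantor

variable {m n b : ℕ}

lemma card_le_of_separated {γ : Type*} (W : Finset γ) (c : γ → Fin m → Fin n → ℝ)
    (s : Fin m → Fin n → ℝ) {r : ℝ} (hs : ∀ i j, 0 < s i j) (hsr : ∀ i j, s i j ≤ r)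
    (hsep : ∀ w ∈ W, ∀ w' ∈ W, w ≠ w' → ∃ i j, s i j ≤ |c w i j - c w' i j|)
    (x : Fin m → Fin n → ℝ)
    (hx : ∀ w ∈ W, ∀ i j, x i j - r - s i j ≤ c w i j ∧ c w i j ≤ x i j + r) :
    (W.card : ℝ) ≤ ∏ i, ∏ j, 4 * r / s i j := by
  let q : γ → Fin m → Fin n → ℝ := fun w i j => (c w i j - (x i j - r - s i j)) / s i j
  have hq0 : ∀ w ∈ W, ∀ i j, 0 ≤ q w i j := fun w hw i j =>
    div_nonneg (by linarith [(hx w hw i j).1]) (hs i j).le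
  have hq1 : ∀ w ∈ W, ∀ i j, q w i j ≤ 2 * r / s i j + 1 := fun w hw i j => by
    have := hs i j
    have h2 := (hx w hw i j).2
    rw [div_add_one this.ne', div_le_div_iff_of_pos_right this]
    linarith
  let B : Fin m → Fin n → ℕ := fun i j => ⌊2 * r / s i j + 1⌋₊ + 1
  have hcard : W.card ≤ (Fintype.piFinset fun i => Fintype.piFinset fun j =>
      Finset.range (B i j)).card := by
    refine Finset.card_le_card_of_injOn (fun w i j => ⌊q w i j⌋₊) (fun w hw => ?_) ?_
    · simp only [Finset.mem_coe, Fintype.mem_piFinset, Finset.mem_range]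
      exact fun i j => Nat.lt_succ_of_le (Nat.floor_le_floor (hq1 w hw i j))
    · intro w hw w' hw' heq
      by_contra hne
      obtain ⟨i, j, hij⟩ := hsep w hw w' hw' hne
      have hf : ⌊q w i j⌋₊ = ⌊q w' i j⌋₊ := congrFun (congrFun heq i) j
      have h1 := Nat.floor_le (hq0 w hw i j)
      have h2 := Nat.lt_floor_add_one (q w i j)
      have h3 := Nat.floor_le (hq0 w' hw' i j)
      have h4 := Nat.lt_floor_add_one (q w' i j)
      rw [hf] at h1 h2
      have h5 : |q w i j - q w' i j| < 1 := abs_sub_lt_iff.2 ⟨by linarith, by linarith⟩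
      have h6 : q w i j - q w' i j = (c w i j - c w' i j) / s i j := by
        simp only [q]; ring
      rw [h6, abs_div, abs_of_pos (hs i j), div_lt_one (hs i j)] at h5
      linarith
  rw [Fintype.card_piFinset] at hcard
  simp only [Fintype.card_piFinset, Finset.card_range] at hcard
  refine (Nat.cast_le.2 hcard).trans ?_
  push_cast
  refine Finset.prod_le_prod (fun i _ => by positivity) fun i _ =>
    Finset.prod_le_prod (fun j _ => by positivity) fun j _ => ?_
  have h1 : 1 ≤ r / s i j := (one_le_div (hs i j)).2 (hsr i j)
  have h2 : (⌊2 * r / s i j + 1⌋₊ : ℝ) ≤ 2 * r / s i j + 1 := Nat.floor_le (by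
    have := mul_div_assoc 2 r (s i j); linarith)
  simp only [B]
  push_cast
  have h3 := mul_div_assoc 2 r (s i j)
  have h4 := mul_div_assoc 4 r (s i j)
  linarith

/-- The corners of the nested boxes along a branch of a tree of boxes: at the level `k`, the box with
corner `x` has the children with corners `x + ch k x a * side (k + 1)`. -/
def corner (x₀ : Fin m → Fin n → ℝ) (side : ℕ → Fin m → Fin n → ℝ)
    (ch : ℕ → (Fin m → Fin n → ℝ) → Fin b → Fin m → Fin n → ℕ) (w : ℕ → Fin b) :
    ℕ → Fin m → Fin n → ℝ
  | 0 => x₀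
  | k + 1 => fun i j => corner x₀ side ch w k i j +
      ch k (corner x₀ side ch w k) (w k) i j * side (k + 1) i j

variable {x₀ : Fin m → Fin n → ℝ} {side : ℕ → Fin m → Fin n → ℝ}
  {ch : ℕ → (Fin m → Fin n → ℝ) → Fin b → Fin m → Fin n → ℕ}

lemma corner_congr {w w' : ℕ → Fin b} {k : ℕ} (h : ∀ l < k, w l = w' l) :
    corner x₀ side ch w k = corner x₀ side ch w' k := by
  induction k with
  | zero => rfl
  | succ k ih =>
    ext i j
    simp only [corner]
    rw [ih fun l hl => h l (hl.trans (Nat.lt_succ_self k)), h k (Nat.lt_succ_self k)]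

lemma measurable_corner [NeZero b] (k : ℕ) :
    Measurable fun w : ℕ → Fin b => corner x₀ side ch w k := by
  let e : (Fin k → Fin b) → ℕ → Fin b := fun w l => if h : l < k then w ⟨l, h⟩ else 0
  have h1 : (fun w : ℕ → Fin b => corner x₀ side ch w k) =
      (fun w : Fin k → Fin b => corner x₀ side ch (e w) k) ∘ fun w l => w l := by
    ext1 w
    exact corner_congr fun l hl => by simp [e, hl]
  rw [h1]
  exact (measurable_of_countable _).comp (measurable_pi_lambda _ fun l => measurable_pi_apply _)

lemma corner_monotone (hside : ∀ k i j, 0 < side k i j) (w : ℕ → Fin b) (i : Fin m) (j : Fin n) :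
    Monotone fun k => corner x₀ side ch w k i j := by
  refine monotone_nat_of_le_succ fun k => ?_
  simp only [corner]
  have := hside (k + 1) i j
  exact le_add_of_nonneg_right (by positivity)

lemma corner_add_side_antitone {w : ℕ → Fin b} {i : Fin m} {j : Fin n}
    (hnest : ∀ k, ((ch k (corner x₀ side ch w k) (w k) i j : ℝ) + 1) * side (k + 1) i j ≤
      side k i j) :
    Antitone fun k => corner x₀ side ch w k i j + side k i j := by
  refine antitone_nat_of_succ_le fun k => ?_
  simp only [corner]
  have := hnest k
  linarith

lemma exists_side_le_abs_corner_sub (hside : ∀ k i j, 0 < side k i j)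
    (hch : ∀ k x, Function.Injective (ch k x))
    (hnest : ∀ (w : ℕ → Fin b) i j k,
      ((ch k (corner x₀ side ch w k) (w k) i j : ℝ) + 1) * side (k + 1) i j ≤ side k i j)
    {w w' : ℕ → Fin b} {k : ℕ} (h : ∃ l < k, w l ≠ w' l) :
    ∃ i j, side k i j ≤ |corner x₀ side ch w k i j - corner x₀ side ch w' k i j| := by
  classical
  obtain ⟨hl, hne⟩ := Nat.find_spec h
  set l := Nat.find h with hldef
  have heq : ∀ l' < l, w l' = w' l' := fun l' hl' => by
    by_contra hcon
    exact Nat.find_min h hl' ⟨hl'.trans hl, hcon⟩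
  have hc := corner_congr (x₀ := x₀) (side := side) (ch := ch) heq
  set x := corner x₀ side ch w l with hx
  have hne' : ch l x (w l) ≠ ch l x (w' l) := fun h' => hne (hch l x h')
  obtain ⟨i, hi⟩ := Function.ne_iff.1 hne'
  obtain ⟨j, hij⟩ := Function.ne_iff.1 hi
  refine ⟨i, j, ?_⟩
  have key : ∀ v v' : ℕ → Fin b, corner x₀ side ch v l = x → corner x₀ side ch v' l = x →
      ch l x (v l) i j < ch l x (v' l) i j →
      side k i j ≤ corner x₀ side ch v' k i j - corner x₀ side ch v k i j := by
    intro v v' hv hv' hlt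
    have h1 := corner_monotone (x₀ := x₀) (ch := ch) hside v' i j (Nat.succ_le_of_lt hl)
    have h2 := corner_add_side_antitone (hnest v i j) (Nat.succ_le_of_lt hl)
    simp only [Nat.succ_eq_add_one, corner, hv, hv'] at h1 h2
    have h3 : (ch l x (v l) i j : ℝ) + 1 ≤ ch l x (v' l) i j := by exact_mod_cast hlt
    have h4 := mul_le_mul_of_nonneg_right h3 (hside (l + 1) i j).le
    linarith
  rcases lt_or_gt_of_ne hij with hlt | hlt
  · rw [abs_sub_comm]
    exact (key w w' hx.symm hc.symm hlt).trans (le_abs_self _)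
  · exact (key w' w hc.symm hx.symm hlt).trans (le_abs_self _)

/-- A lower bound for the Hausdorff dimension of the limit set of a tree of boxes whose side lengths
`σ i j / T i j ^ k` depend on the coordinate, when each box of the tree has at least `b` children. -/
theorem le_dimH_of_tree (hb : 0 < b) {σ T : Fin m → Fin n → ℝ} {τ : ℝ} (hσ : ∀ i j, 0 < σ i j)
    (hτ : 1 < τ) (hT : ∀ i j, τ ≤ T i j) {Good : ℕ → (Fin m → Fin n → ℝ) → Prop}
    {x₀ : Fin m → Fin n → ℝ} (h₀ : Good 0 x₀)
    (hGood : ∀ k x, Good k x → ∃ F : Finset (Fin m → Fin n → ℕ), b ≤ F.card ∧ ∀ κ ∈ F,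
      (∀ i j, (κ i j : ℝ) + 1 ≤ T i j) ∧
        Good (k + 1) fun i j => x i j + κ i j * (σ i j / T i j ^ (k + 1)))
    {d : NNReal} {e : ℝ} (hd : 0 < d) (he : 0 ≤ e) (hde : d + e = (m * n : ℕ))
    (hbT : ∏ i, ∏ j, T i j ≤ b * τ ^ e) {E : Set (Fin m → Fin n → ℝ)}
    (hE : ∀ x, (∃ c : ℕ → Fin m → Fin n → ℝ, ∀ k, Good k (c k) ∧
      ∀ i j, c k i j ≤ x i j ∧ x i j ≤ c k i j + σ i j / T i j ^ k) → x ∈ E) :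
    (d : ℝ≥0∞) ≤ dimH E := by
  classical
  have : NeZero b := ⟨hb.ne'⟩
  have hT0 : ∀ i j, 0 < T i j := fun i j => (zero_lt_one.trans hτ).trans_le (hT i j)
  set side : ℕ → Fin m → Fin n → ℝ := fun k i j => σ i j / T i j ^ k with hsidedef
  have hside : ∀ k i j, 0 < side k i j := fun k i j => div_pos (hσ i j) (pow_pos (hT0 i j) k)
  have hex : ∀ k x, ∃ f : Fin b → Fin m → Fin n → ℕ, Function.Injective f ∧ (Good k x → ∀ a,
      (∀ i j, (f a i j : ℝ) + 1 ≤ T i j) ∧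
        Good (k + 1) fun i j => x i j + f a i j * side (k + 1) i j) := by
    intro k x
    by_cases hx : Good k x
    · obtain ⟨F, hF, hF'⟩ := hGood k x hx
      obtain ⟨f⟩ : Nonempty (Fin b ↪ F) :=
        Function.Embedding.nonempty_of_card_le (by simpa using hF)
      exact ⟨fun a => f a, Subtype.val_injective.comp f.injective, fun _ a => hF' _ (f a).2⟩
    · rcases isEmpty_or_nonempty (Fin m × Fin n) with hemp | ⟨⟨i, j⟩⟩
      · exfalso
        have : (m * n : ℕ) = 0 := by
          rw [← Fintype.card_eq_zero_iff, Fintype.card_prod, Fintype.card_fin, Fintype.card_fin] at hemp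
          exact hemp
        rw [this] at hde
        have : (0 : ℝ) < d := hd
        push_cast at hde
        linarith
      · refine ⟨fun a _ _ => a, fun a a' h => ?_, fun h => absurd h hx⟩
        exact Fin.val_injective (congrFun (congrFun h i) j)
  choose ch hinj hch using hex
  have hgood : ∀ w k, Good k (corner x₀ side ch w k) := by
    intro w k
    induction k with
    | zero => exact h₀
    | succ k ih => exact (hch k _ ih (w k)).2
  have hnest : ∀ (w : ℕ → Fin b) i j k,
      ((ch k (corner x₀ side ch w k) (w k) i j : ℝ) + 1) * side (k + 1) i j ≤ side k i j := by
    intro w i j k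
    calc _ ≤ T i j * side (k + 1) i j :=
          mul_le_mul_of_nonneg_right ((hch k _ (hgood w k) (w k)).1 i j) (hside _ _ _).le
      _ = side k i j := by
          have := (hT0 i j).ne'
          simp only [hsidedef, pow_succ]
          field_simp
  have hle : ∀ w i j k l, corner x₀ side ch w l i j ≤ corner x₀ side ch w k i j + side k i j := by
    intro w i j k l
    have h1 := corner_monotone (x₀ := x₀) (ch := ch) hside w i j (le_max_left l k)
    have h2 := corner_add_side_antitone (hnest w i j) (le_max_right l k)
    have h3 := hside (max l k) i j
    simp only at h1 h2
    linarith
  let Φ : (ℕ → Fin b) → Fin m → Fin n → ℝ := fun w i j => ⨆ k, corner x₀ side ch w k i j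
  have hΦ0 : ∀ w i j k, corner x₀ side ch w k i j ≤ Φ w i j := fun w i j k =>
    le_ciSup (f := fun k => corner x₀ side ch w k i j)
      ⟨_, Set.forall_mem_range.2 fun l => hle w i j 0 l⟩ k
  have hΦ1 : ∀ w i j k, Φ w i j ≤ corner x₀ side ch w k i j + side k i j := fun w i j k =>
    ciSup_le fun l => hle w i j k l
  have hmeas : Measurable Φ := by
    refine measurable_pi_lambda _ fun i => measurable_pi_lambda _ fun j => Measurable.iSup fun k => ?_
    exact (measurable_pi_apply j).comp ((measurable_pi_apply i).comp (measurable_corner k))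
  have hsub : Set.range Φ ⊆ E := by
    rintro _ ⟨w, rfl⟩
    exact hE _ ⟨corner x₀ side ch w, fun k => ⟨hgood w k, fun i j => ⟨hΦ0 w i j k, hΦ1 w i j k⟩⟩⟩
  refine le_trans ?_ (dimH_mono hsub)
  set s₁ : ℝ := ‖σ‖ + 1 with hs₁
  have hs₁pos : 0 < s₁ := by positivity
  have hσs : ∀ i j, σ i j ≤ s₁ := fun i j =>
    (le_abs_self _).trans (((norm_le_pi_norm (σ i) j).trans (norm_le_pi_norm σ i)).trans
      (by rw [hs₁]; linarith))
  have hσprod : 0 < ∏ i, ∏ j, σ i j := Finset.prod_pos fun i _ => Finset.prod_pos fun j _ => hσ i j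
  have hτ0 : 0 < τ := zero_lt_one.trans hτ
  refine le_dimH_range_of_card_le (K := 4 ^ (m * n) / (∏ i, ∏ j, σ i j) * (τ * s₁) ^ e)
    hmeas hd (by positivity) hs₁pos fun S r hr hrs hS => ?_
  obtain ⟨k, hk, hk'⟩ := exists_nat_pow_near ((one_le_div hr).2 hrs) hτ
  have hsr : ∀ i j, side (k + 1) i j ≤ r := by
    intro i j
    simp only [hsidedef]
    rw [div_le_iff₀ (pow_pos (hT0 i j) _)]
    rw [div_lt_iff₀ hr] at hk'
    calc σ i j ≤ s₁ := hσs i j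
      _ ≤ r * τ ^ (k + 1) := by linarith
      _ ≤ r * T i j ^ (k + 1) := by
        have := pow_le_pow_left₀ hτ0.le (hT i j) (k + 1)
        gcongr
  let pre : (ℕ → Fin b) → Fin (k + 1) → Fin b := fun w l => w l
  let W : Finset (Fin (k + 1) → Fin b) :=
    Finset.univ.filter fun v => ∃ w, pre w = v ∧ Φ w ∈ S
  refine ⟨k + 1, W, fun w hw => by simpa [W] using ⟨w, rfl, hw⟩, ?_⟩
  have hWex : ∀ v : Fin (k + 1) → Fin b, ∃ w, v ∈ W → pre w = v ∧ Φ w ∈ S := by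
    intro v
    by_cases hv : v ∈ W
    · obtain ⟨w, hw⟩ := (Finset.mem_filter.1 hv).2
      exact ⟨w, fun _ => hw⟩
    · exact ⟨fun _ => 0, fun h => absurd h hv⟩
  choose rep hrep using hWex
  have hcard : (W.card : ℝ) ≤ ∏ i, ∏ j, 4 * r / side (k + 1) i j := by
    rcases W.eq_empty_or_nonempty with hemp | ⟨v₀, hv₀⟩
    · rw [hemp]
      simp only [Finset.card_empty, Nat.cast_zero]
      refine Finset.prod_nonneg fun i _ => Finset.prod_nonneg fun j _ => ?_
      have := hside (k + 1) i j
      positivity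
    · refine card_le_of_separated W (fun v => corner x₀ side ch (rep v) (k + 1)) _ (hside _) hsr
        (fun v hv v' hv' hne => ?_) (Φ (rep v₀)) fun v hv i j => ?_
      · refine exists_side_le_abs_corner_sub hside hinj hnest ?_
        by_contra! hcon
        refine hne ?_
        rw [← (hrep v hv).1, ← (hrep v' hv').1]
        exact funext fun l => hcon l l.2
      · have h1 := hS _ (hrep v hv).2 _ (hrep v₀ hv₀).2
        have h2 : |Φ (rep v) i j - Φ (rep v₀) i j| ≤ r :=
          ((dist_le_pi_dist (Φ (rep v) i) _ j).trans (dist_le_pi_dist _ _ i)).trans h1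
        rw [abs_le] at h2
        have h3 := hΦ0 (rep v) i j (k + 1)
        have h4 := hΦ1 (rep v) i j (k + 1)
        constructor <;> linarith [h2.1, h2.2]
  refine hcard.trans ?_
  have h1 : ∏ i, ∏ j, 4 * r / side (k + 1) i j =
      (4 * r) ^ (m * n) * (∏ i, ∏ j, T i j) ^ (k + 1) / ∏ i, ∏ j, σ i j := by
    have : ∀ i j, 4 * r / side (k + 1) i j = 4 * r * T i j ^ (k + 1) / σ i j := fun i j => by
      simp only [hsidedef]
      rw [div_div_eq_mul_div]
    simp only [this, Finset.prod_div_distrib, Finset.prod_mul_distrib, Finset.prod_const,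
      Finset.card_univ, Fintype.card_fin, Finset.prod_pow, ← pow_mul, mul_comm n m, mul_pow]
  have h2 : (∏ i, ∏ j, T i j) ^ (k + 1) ≤ (b : ℝ) ^ (k + 1) * (τ * s₁ / r) ^ e := by
    calc (∏ i, ∏ j, T i j) ^ (k + 1) ≤ (b * τ ^ e) ^ (k + 1) :=
          pow_le_pow_left₀ (Finset.prod_nonneg fun i _ => Finset.prod_nonneg fun j _ =>
            (hT0 i j).le) hbT _
      _ = (b : ℝ) ^ (k + 1) * (τ ^ (k + 1)) ^ e := by
          rw [mul_pow, ← Real.rpow_natCast (τ ^ e), ← Real.rpow_mul hτ0.le, mul_comm e,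
            Real.rpow_mul hτ0.le, Real.rpow_natCast]
      _ ≤ _ := by
          gcongr
          rw [pow_succ, mul_comm, mul_div_assoc]
          gcongr
  have h3 : r ^ (m * n) * (τ * s₁ / r) ^ e = (τ * s₁) ^ e * r ^ (d : ℝ) := by
    rw [Real.div_rpow (by positivity) hr.le, ← Real.rpow_natCast, ← hde, Real.rpow_add hr]
    have := (Real.rpow_pos_of_pos hr e).ne'
    field_simp
  rw [h1]
  calc (4 * r) ^ (m * n) * (∏ i, ∏ j, T i j) ^ (k + 1) / ∏ i, ∏ j, σ i j
      ≤ (4 * r) ^ (m * n) * ((b : ℝ) ^ (k + 1) * (τ * s₁ / r) ^ e) / ∏ i, ∏ j, σ i j := by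
        gcongr
    _ = 4 ^ (m * n) / (∏ i, ∏ j, σ i j) * (b : ℝ) ^ (k + 1) *
          (r ^ (m * n) * (τ * s₁ / r) ^ e) := by rw [mul_pow]; ring
    _ = _ := by rw [h3]; ring

end Cantor

section Thick

variable {m n : ℕ}

lemma flowMatrix_add_mulVec_inl (ω : Weights m n) (A D : Matrix (Fin m) (Fin n) ℝ) {s : ℝ}
    (hs : 0 < s) (z : Fin m ⊕ Fin n → ℤ) (i : Fin m) :
    (flowMatrix ω (A + D) s *ᵥ toReal z) (Sum.inl i) =
      (flowMatrix ω A s *ᵥ toReal z) (Sum.inl i) +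
        ∑ j, s ^ (ω.α i + ω.β j) * D i j * (flowMatrix ω A s *ᵥ toReal z) (Sum.inr j) := by
  simp only [flowMatrix_mulVec_inl, flowMatrix_mulVec_inr, linForm, Matrix.add_mulVec,
    Pi.sub_apply, Pi.add_apply]
  have h : ∑ j, s ^ (ω.α i + ω.β j) * D i j * (s ^ (-ω.β j) * (z (Sum.inr j) : ℝ)) =
      s ^ ω.α i * (D *ᵥ fun j => ((z ∘ Sum.inr) j : ℝ)) i := by
    rw [Matrix.mulVec, dotProduct, Finset.mul_sum]
    refine Finset.sum_congr rfl fun j _ => ?_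
    rw [Real.rpow_add hs, Real.rpow_neg hs.le]
    have := (Real.rpow_pos_of_pos hs (ω.β j)).ne'
    simp only [Function.comp_apply]
    field_simp
  rw [h]
  ring

lemma flowMatrix_mulVec_inr_congr (ω : Weights m n) (A B : Matrix (Fin m) (Fin n) ℝ) (s : ℝ)
    (z : Fin m ⊕ Fin n → ℤ) (j : Fin n) :
    (flowMatrix ω A s *ᵥ toReal z) (Sum.inr j) = (flowMatrix ω B s *ᵥ toReal z) (Sum.inr j) := by
  simp only [flowMatrix_mulVec_inr]

lemma flowMatrix_mul_mulVec_inl (ω : Weights m n) (A : Matrix (Fin m) (Fin n) ℝ) {s t : ℝ}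
    (hs : 0 < s) (ht : 0 < t) (z : Fin m ⊕ Fin n → ℤ) (i : Fin m) :
    (flowMatrix ω A (s * t) *ᵥ toReal z) (Sum.inl i) =
      t ^ ω.α i * (flowMatrix ω A s *ᵥ toReal z) (Sum.inl i) := by
  simp only [flowMatrix_mulVec_inl]
  rw [Real.mul_rpow hs.le ht.le]
  ring

lemma flowMatrix_mul_mulVec_inr (ω : Weights m n) (A : Matrix (Fin m) (Fin n) ℝ) {s t : ℝ}
    (hs : 0 < s) (ht : 0 < t) (z : Fin m ⊕ Fin n → ℤ) (j : Fin n) :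
    (flowMatrix ω A (s * t) *ᵥ toReal z) (Sum.inr j) =
      t ^ (-ω.β j) * (flowMatrix ω A s *ᵥ toReal z) (Sum.inr j) := by
  simp only [flowMatrix_mulVec_inr]
  rw [Real.mul_rpow hs.le ht.le]
  ring

/-- The lattice attached to `A` and `s` has no nonzero vector with all the coordinates smaller than
`δ`. -/
def ShortFree (ω : Weights m n) (δ : ℝ) (A : Matrix (Fin m) (Fin n) ℝ) (s : ℝ) : Prop :=
  ∀ z : Fin m ⊕ Fin n → ℤ, z ≠ 0 → ∃ l, δ ≤ |(flowMatrix ω A s *ᵥ toReal z) l|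

lemma shortFree_of_not_hits (ω : Weights m n) {A : Matrix (Fin m) (Fin n) ℝ} {s t δ : ℝ}
    (hs : 0 < s) (ht : 0 < t) {κ : Fin m → Fin n → ℕ}
    (h : ¬∃ z, z ≠ 0 ∧ (∀ j, |(flowMatrix ω A s *ᵥ toReal z) (Sum.inr j)| < δ * t ^ ω.β j) ∧
      Hits ω t δ κ (flowMatrix ω A s *ᵥ toReal z)) :
    ShortFree ω δ (A + Matrix.of fun i j => κ i j * (s * t) ^ (-(ω.α i + ω.β j))) (s * t) := by
  intro z hz
  by_contra! hcon
  refine h ⟨z, hz, fun j => ?_, fun i => ?_⟩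
  · have h1 := hcon (Sum.inr j)
    have htβ := Real.rpow_pos_of_pos ht (ω.β j)
    rw [flowMatrix_mul_mulVec_inr ω _ hs ht, flowMatrix_mulVec_inr_congr ω _ A, abs_mul,
      Real.rpow_neg ht.le, abs_of_pos (inv_pos.2 htβ), inv_mul_lt_iff₀ htβ] at h1
    linarith
  · have h1 := hcon (Sum.inl i)
    have htα := Real.rpow_pos_of_pos ht (ω.α i)
    rw [flowMatrix_mul_mulVec_inl ω _ hs ht, flowMatrix_add_mulVec_inl ω _ _ hs, abs_mul,
      abs_of_pos htα, ← lt_div_iff₀' htα] at h1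
    rw [Real.rpow_neg ht.le, ← div_eq_mul_inv]
    refine lt_of_eq_of_lt ?_ h1
    congr 2
    refine Finset.sum_congr rfl fun j _ => ?_
    rw [Matrix.of_apply, Real.mul_rpow hs.le ht.le, Real.rpow_neg hs.le]
    have := (Real.rpow_pos_of_pos hs (ω.α i + ω.β j)).ne'
    field_simp

lemma ShortFree.of_le_of_le {ω : Weights m n} {A B : Matrix (Fin m) (Fin n) ℝ} {s δ : ℝ}
    (hs : 0 < s) (hδ : 0 < δ) (h : ShortFree ω δ A s)
    (hAB : ∀ i j, A i j ≤ B i j ∧ B i j ≤ A i j + s ^ (-(ω.α i + ω.β j))) :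
    ShortFree ω (δ / (n + 1)) B s := by
  intro z hz
  by_contra! hcon
  obtain ⟨l, hl⟩ := h z hz
  have hn : (0 : ℝ) < n + 1 := by positivity
  have hy : ∀ j, |(flowMatrix ω A s *ᵥ toReal z) (Sum.inr j)| < δ / (n + 1) := fun j => by
    rw [flowMatrix_mulVec_inr_congr ω A B]; exact hcon _
  refine hl.not_gt ?_
  rcases l with i | j
  · have h1 := flowMatrix_add_mulVec_inl ω A (B - A) hs z i
    rw [add_sub_cancel] at h1
    have h2 : |∑ j, s ^ (ω.α i + ω.β j) * (B - A) i j * (flowMatrix ω A s *ᵥ toReal z) (Sum.inr j)| ≤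
        n * (δ / (n + 1)) := by
      refine (Finset.abs_sum_le_sum_abs _ _).trans ?_
      refine (Finset.sum_le_card_nsmul Finset.univ _ (δ / (n + 1)) fun j _ => ?_).trans
        (by simp)
      rw [abs_mul]
      refine (mul_le_of_le_one_left (abs_nonneg _) ?_).trans (hy j).le
      have hp := Real.rpow_pos_of_pos hs (ω.α i + ω.β j)
      have h3 := hAB i j
      rw [Real.rpow_neg hs.le] at h3
      rw [Matrix.sub_apply, abs_of_nonneg (mul_nonneg hp.le (by linarith))]
      calc s ^ (ω.α i + ω.β j) * (B i j - A i j)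
          ≤ s ^ (ω.α i + ω.β j) * (s ^ (ω.α i + ω.β j))⁻¹ := by gcongr; linarith
        _ = 1 := mul_inv_cancel₀ hp.ne'
    have h4 := hcon (Sum.inl i)
    have h5 : (flowMatrix ω A s *ᵥ toReal z) (Sum.inl i) =
        (flowMatrix ω B s *ᵥ toReal z) (Sum.inl i) -
          ∑ j, s ^ (ω.α i + ω.β j) * (B - A) i j * (flowMatrix ω A s *ᵥ toReal z) (Sum.inr j) := by
      linarith
    rw [h5]
    calc _ ≤ _ := abs_sub _ _
      _ < δ / (n + 1) + n * (δ / (n + 1)) := by linarith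
      _ = δ := by field_simp; ring
  · exact (hy j).trans_le (div_le_self hδ.le (by linarith [(Nat.cast_nonneg n : (0 : ℝ) ≤ n)]))

lemma exists_forall_le_abs_mulVec {ι : Type*} [Fintype ι] [DecidableEq ι] {M : Matrix ι ι ℝ}
    (hM : M.det ≠ 0) :
    ∃ δ > 0, ∀ z : ι → ℤ, z ≠ 0 → ∃ l, δ ≤ |(M *ᵥ toReal z) l| := by
  set C : ℝ := ∑ i, ∑ l, |M⁻¹ i l| with hC
  have hC0 : 0 ≤ C := Finset.sum_nonneg fun i _ => Finset.sum_nonneg fun l _ => abs_nonneg _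
  refine ⟨1 / (C + 1), by positivity, fun z hz => ?_⟩
  by_contra! hcon
  obtain ⟨i, hi⟩ := Function.ne_iff.1 hz
  have h1 : toReal z = M⁻¹ *ᵥ (M *ᵥ toReal z) := by
    rw [Matrix.mulVec_mulVec, Matrix.nonsing_inv_mul _ (Ne.isUnit hM), Matrix.one_mulVec]
  have h2 : (1 : ℝ) ≤ |toReal z i| := one_le_abs_intCast hi
  rw [h1, Matrix.mulVec, dotProduct] at h2
  have h3 : |∑ l, M⁻¹ i l * (M *ᵥ toReal z) l| ≤ (∑ l, |M⁻¹ i l|) * (1 / (C + 1)) := by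
    rw [Finset.sum_mul]
    refine (Finset.abs_sum_le_sum_abs _ _).trans (Finset.sum_le_sum fun l _ => ?_)
    rw [abs_mul]
    exact mul_le_mul_of_nonneg_left (hcon l).le (abs_nonneg _)
  have h4 : ∑ l, |M⁻¹ i l| ≤ C :=
    Finset.single_le_sum (f := fun i => ∑ l, |M⁻¹ i l|)
      (fun i _ => Finset.sum_nonneg fun l _ => abs_nonneg _) (Finset.mem_univ i)
  have h5 : C * (1 / (C + 1)) < 1 := by
    rw [mul_one_div, div_lt_one (by positivity)]; linarith
  have h6 : (∑ l, |M⁻¹ i l|) * (1 / (C + 1)) ≤ C * (1 / (C + 1)) := by gcongr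
  linarith

lemma mem_badlyApproximable_of_shortFree (ω : Weights m n) {A : Matrix (Fin m) (Fin n) ℝ} {t η : ℝ}
    {K : ℕ} (ht : 1 < t) (hη : 0 < η) (h : ∀ k ≥ K, ShortFree ω η A (t ^ k)) :
    A ∈ badlyApproximable ω := by
  have := ω.nonempty_left
  have := ω.nonempty_right
  have ht0 : 0 < t := zero_lt_one.trans ht
  have hev : ∀ a : ℝ, 0 < a → ∀ᶠ θ : ℝ in nhdsWithin 0 (Set.Ioi 0), θ ^ a < η := fun a ha => by
    have h1 := (Real.continuousAt_rpow_const 0 a (Or.inr ha.le)).tendsto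
    rw [Real.zero_rpow ha.ne'] at h1
    exact nhdsWithin_le_nhds (h1.eventually (gt_mem_nhds hη))
  obtain ⟨θ, hθα, hθβ, hθ0, hθ1⟩ := ((eventually_all.2 fun i => hev _ (ω.α_pos i)).and
    ((eventually_all.2 fun j => hev _ (ω.β_pos j)).and (Ioc_mem_nhdsGT zero_lt_one))).exists
  rw [mem_badlyApproximable_iff]
  refine ⟨θ ^ 2 / t ^ (K + 1), by positivity, fun p q hq => ?_⟩
  by_contra! hcon
  set Q := quasiNorm ω.β fun j => (q j : ℝ) with hQ
  have hQ1 : 1 ≤ Q := by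
    by_contra! hlt
    obtain ⟨j, hj⟩ := Function.ne_iff.1 hq
    have h1 := (quasiNorm_lt_iff ω.β_pos one_pos).1 hlt j
    rw [Real.one_rpow] at h1
    exact absurd (one_le_abs_intCast hj) h1.not_ge
  obtain ⟨k, hk, hk'⟩ := exists_nat_pow_near ((one_le_div hθ0).2 (hθ1.trans hQ1)) ht
  have hs0 : 0 < t ^ (K + (k + 1)) := by positivity
  have hQlt : Q < t ^ (K + (k + 1)) * θ := by
    rw [div_lt_iff₀ hθ0] at hk'
    exact hk'.trans_le (mul_le_mul_of_nonneg_right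
      (pow_le_pow_right₀ ht.le (by omega)) hθ0.le)
  have hrlt : quasiNorm ω.α (linForm A p q) < θ * (t ^ (K + (k + 1)))⁻¹ := by
    rw [← div_eq_mul_inv, lt_div_iff₀ hs0]
    have h1 : t ^ (K + (k + 1)) ≤ t ^ (K + 1) * (Q / θ) := by
      rw [show K + (k + 1) = K + 1 + k by ring, pow_add]
      gcongr
    calc quasiNorm ω.α (linForm A p q) * t ^ (K + (k + 1))
        ≤ quasiNorm ω.α (linForm A p q) * (t ^ (K + 1) * (Q / θ)) :=
          mul_le_mul_of_nonneg_left h1 (quasiNorm_nonneg _ _)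
      _ = quasiNorm ω.α (linForm A p q) * Q * (t ^ (K + 1) / θ) := by ring
      _ < θ ^ 2 / t ^ (K + 1) * (t ^ (K + 1) / θ) := by gcongr
      _ = θ := by field_simp
  obtain ⟨l, hl⟩ := h (K + (k + 1)) (by omega) (Sum.elim p q) fun h0 => hq <| by
    have := congrArg (fun z => z ∘ Sum.inr) h0
    simpa using this
  refine hl.not_gt ?_
  rcases l with i | j
  · have h1 := (quasiNorm_lt_iff ω.α_pos (by positivity)).1 hrlt i
    rw [Real.mul_rpow hθ0.le (by positivity), Real.inv_rpow hs0.le] at h1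
    have hp := Real.rpow_pos_of_pos hs0 (ω.α i)
    rw [flowMatrix_mulVec_inl, abs_mul, abs_of_pos hp, Sum.elim_comp_inl, Sum.elim_comp_inr]
    rw [← div_eq_mul_inv, lt_div_iff₀' hp] at h1
    exact h1.trans (hθα i)
  · have h1 := (quasiNorm_lt_iff ω.β_pos (by positivity)).1 hQlt j
    rw [Real.mul_rpow hs0.le hθ0.le] at h1
    have hp := Real.rpow_pos_of_pos hs0 (ω.β j)
    rw [flowMatrix_mulVec_inr, abs_mul, Real.rpow_neg hs0.le, abs_of_pos (inv_pos.2 hp),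
      inv_mul_lt_iff₀ hp, Sum.elim_inr]
    exact h1.trans (mul_lt_mul_of_pos_left (hθβ j) hp)

end Thick

section Dimension

variable {m n : ℕ}

lemma tendsto_natCast_add_mul_rpow_neg (c : ℕ) {b : ℝ} (hb : 0 < b) :
    Tendsto (fun k : ℕ => ((k + c : ℕ) : ℝ) * ((2 : ℝ) ^ k) ^ (-b)) atTop (nhds 0) := by
  have hr0 : (0 : ℝ) ≤ 2 ^ (-b) := by positivity
  have hr1 : (2 : ℝ) ^ (-b) < 1 := Real.rpow_lt_one_of_one_lt_of_neg one_lt_two (by linarith)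
  have h1 := tendsto_pow_const_mul_const_pow_of_lt_one 1 hr0 hr1
  have h2 := (tendsto_pow_atTop_nhds_zero_of_lt_one hr0 hr1).const_mul (c : ℝ)
  have h3 := h1.add h2
  rw [mul_zero, add_zero] at h3
  refine h3.congr fun k => ?_
  rw [← Real.rpow_natCast 2 k, ← Real.rpow_mul zero_le_two, mul_comm (k : ℝ),
    Real.rpow_mul zero_le_two, Real.rpow_natCast]
  push_cast
  ring

lemma tendsto_two_pow_rpow_atTop {a : ℝ} (ha : 0 < a) :
    Tendsto (fun k : ℕ => ((2 : ℝ) ^ k) ^ a) atTop atTop :=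
  (tendsto_rpow_atTop ha).comp (tendsto_pow_atTop_atTop_of_one_lt one_lt_two)

lemma exists_pos_forall_le {k : ℕ} (f : Fin k → ℝ) (hf : ∀ i, 0 < f i) :
    ∃ a > 0, ∀ i, a ≤ f i := by
  rcases isEmpty_or_nonempty (Fin k) with h | h
  · exact ⟨1, one_pos, fun i => h.elim i⟩
  · obtain ⟨i, hi⟩ := Finite.exists_min f
    exact ⟨f i, hf i, hi⟩

/-- The scale `t` of the tree can be chosen so large that the proportion of bad digits is small and
the loss in the number of the children is negligible. -/
lemma exists_scale (ω : Weights m n) {e : ℝ} (he : 0 < e) : ∃ (t b τ : ℝ) (L : ℕ), 1 < t ∧ 1 < τ ∧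
    (∀ j, b ≤ ω.β j) ∧ (∀ i, 2 ≤ t ^ ω.α i) ∧ 2 * n * t ≤ 2 ^ L ∧
    2 * ((4 * ((m + n : ℕ) : ℝ)) ^ (m + n) * (24 * n) ^ m * L * t ^ (-b)) ≤ 1 ∧
    (∀ i j, τ ≤ t ^ (ω.α i + ω.β j)) ∧ 2 ^ (m * n + 1) ≤ τ ^ e := by
  obtain ⟨a, ha, haα⟩ := exists_pos_forall_le ω.α ω.α_pos
  obtain ⟨b, hb, hbβ⟩ := exists_pos_forall_le ω.β ω.β_pos
  have h1 : ∀ᶠ k : ℕ in atTop, 2 * ((4 * ((m + n : ℕ) : ℝ)) ^ (m + n) * (24 * n) ^ m *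
      ((k + 2 * n : ℕ) : ℝ) * ((2 : ℝ) ^ k) ^ (-b)) ≤ 1 := by
    have h := (tendsto_natCast_add_mul_rpow_neg (2 * n) hb).const_mul
      (2 * ((4 * ((m + n : ℕ) : ℝ)) ^ (m + n) * (24 * n) ^ m))
    rw [mul_zero] at h
    filter_upwards [h.eventually (gt_mem_nhds one_pos)] with k hk
    refine le_trans (le_of_eq ?_) hk.le
    ring
  have h2 := (tendsto_two_pow_rpow_atTop ha).eventually_ge_atTop 2
  have h3 := (tendsto_two_pow_rpow_atTop (mul_pos ha he)).eventually_ge_atTop (2 ^ (m * n + 1))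
  obtain ⟨k, hk1, hk2, hk3, hk4⟩ :=
    (h1.and (h2.and (h3.and (eventually_ge_atTop 1)))).exists
  have ht1 : (1 : ℝ) < 2 ^ k := one_lt_pow₀ one_lt_two (by omega)
  refine ⟨2 ^ k, b, ((2 : ℝ) ^ k) ^ a, k + 2 * n, ht1, by linarith, hbβ, fun i => hk2.trans ?_, ?_,
    hk1, fun i j => ?_, ?_⟩
  · exact Real.rpow_le_rpow_of_exponent_le ht1.le (haα i)
  · have : (2 * n : ℝ) ≤ 2 ^ (2 * n) := by exact_mod_cast (Nat.lt_two_pow_self (n := 2 * n)).le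
    rw [pow_add, mul_comm]
    gcongr
  · exact Real.rpow_le_rpow_of_exponent_le ht1.le ((haα i).trans (by linarith [ω.β_pos j]))
  · rwa [← Real.rpow_mul (by positivity)]

lemma exists_pow_rpow_neg_lt (ω : Weights m n) {t ρ : ℝ} (ht : 1 < t) (hρ : 0 < ρ) :
    ∃ K : ℕ, ∀ i j, (t ^ K) ^ (-(ω.α i + ω.β j)) < ρ := by
  have h : ∀ i j, ∀ᶠ K : ℕ in atTop, (t ^ K) ^ (-(ω.α i + ω.β j)) < ρ := fun i j =>
    ((tendsto_rpow_neg_atTop (add_pos (ω.α_pos i) (ω.β_pos j))).comp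
      (tendsto_pow_atTop_atTop_of_one_lt ht)).eventually (gt_mem_nhds hρ)
  exact (eventually_all.2 fun i => eventually_all.2 fun j => h i j).exists

lemma exists_factorial_mul_pow_lt_one {k : ℕ} (hk : k ≠ 0) (C : ℝ) {δ₀ : ℝ} (hδ₀ : 0 < δ₀) :
    ∃ δ, 0 < δ ∧ δ ≤ δ₀ ∧ (k.factorial : ℝ) * (C * δ) ^ k < 1 := by
  have h : Tendsto (fun δ : ℝ => (k.factorial : ℝ) * (C * δ) ^ k) (nhds 0) (nhds 0) := by
    have h1 : Continuous fun δ : ℝ => (k.factorial : ℝ) * (C * δ) ^ k := by fun_prop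
    have h2 := h1.tendsto 0
    rwa [mul_zero, zero_pow hk, mul_zero] at h2
  have h0 : ∀ᶠ δ : ℝ in nhdsWithin 0 (Set.Ioi 0), (k.factorial : ℝ) * (C * δ) ^ k < 1 :=
    nhdsWithin_le_nhds (h.eventually (gt_mem_nhds one_pos))
  obtain ⟨δ, h1, h2, h3⟩ := (h0.and (Ioc_mem_nhdsGT hδ₀)).exists
  exact ⟨δ, h2, h3, h1⟩

lemma exists_good_digits (ω : Weights m n) {t δ b : ℝ} (L : ℕ) (hb : ∀ j, b ≤ ω.β j) (ht : 1 < t)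
    (htα : ∀ i, 2 ≤ t ^ ω.α i) (hδ : 0 < δ) (hL : 2 * n * t ≤ 2 ^ L)
    (hsmall : ((m + n).factorial : ℝ) * ((n + 1) * t * δ) ^ (m + n) < 1)
    (hC : 2 * ((4 * ((m + n : ℕ) : ℝ)) ^ (m + n) * (24 * n) ^ m * L * t ^ (-b)) ≤ 1)
    {A : Matrix (Fin m) (Fin n) ℝ} {s : ℝ} (hs : 0 < s) (hA : ShortFree ω δ A s) :
    ∃ F : Finset (Fin m → Fin n → ℕ), ((digits ω t).card + 1) / 2 ≤ F.card ∧ ∀ κ ∈ F,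
      (∀ i j, (κ i j : ℝ) + 1 ≤ t ^ (ω.α i + ω.β j)) ∧
        ShortFree ω δ (A + Matrix.of fun i j => κ i j * (s * t) ^ (-(ω.α i + ω.β j))) (s * t) := by
  classical
  have ht0 : 0 < t := zero_lt_one.trans ht
  have h1 := two_mul_card_bad_le ω L hb ht.le htα hδ hL hsmall hC (abs_det_flowMatrix ω A hs) hA
  set P : (Fin m → Fin n → ℕ) → Prop := fun κ => ∃ z, z ≠ 0 ∧
    (∀ j, |(flowMatrix ω A s *ᵥ toReal z) (Sum.inr j)| < δ * t ^ ω.β j) ∧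
      Hits ω t δ κ (flowMatrix ω A s *ᵥ toReal z) with hP
  have h2 := Finset.card_filter_add_card_filter_not (s := digits ω t) P
  refine ⟨(digits ω t).filter fun κ => ¬P κ, ?_, fun κ hκ => ⟨fun i j => ?_, ?_⟩⟩
  · have h3 : 2 * ((digits ω t).filter P).card ≤ (digits ω t).card := by convert h1
    omega
  · have h3 := (Finset.mem_filter.1 hκ).1
    simp only [digits, Fintype.mem_piFinset, Finset.mem_range] at h3
    have h4 : ((κ i j + 1 : ℕ) : ℝ) ≤ gridSize ω t i j := by exact_mod_cast h3 i j
    push_cast at h4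
    exact h4.trans (gridSize_le ω ht0.le i j)
  · exact shortFree_of_not_hits ω hs ht0 (Finset.mem_filter.1 hκ).2

theorem le_dimH_badlyApproximable_inter (ω : Weights m n) {U : Set (Matrix (Fin m) (Fin n) ℝ)}
    (hU : IsOpen U) (hne : U.Nonempty) {d : NNReal} {e : ℝ} (hd : 0 < d) (he : 0 < e)
    (hde : d + e = (m * n : ℕ)) : (d : ℝ≥0∞) ≤ dimH (badlyApproximable ω ∩ U) := by
  have := ω.nonempty_left
  have := ω.nonempty_right
  obtain ⟨A₀, hA₀⟩ := hne
  obtain ⟨ρ, hρ, hball⟩ := Metric.isOpen_iff.1 hU A₀ hA₀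
  obtain ⟨t, b, τ, L, ht, hτ, hb, htα, hL, hC, hτT, hτe⟩ := exists_scale ω he
  have ht0 : 0 < t := zero_lt_one.trans ht
  obtain ⟨K, hK⟩ := exists_pow_rpow_neg_lt ω ht hρ
  obtain ⟨δ₀, hδ₀, hA₀δ⟩ := exists_forall_le_abs_mulVec (M := flowMatrix ω A₀ (t ^ K)) (by
    have := abs_det_flowMatrix ω A₀ (pow_pos ht0 K)
    intro h0
    rw [h0, abs_zero] at this
    exact zero_ne_one this)
  have hmn : m + n ≠ 0 := by
    have : 0 < m := Fin.pos_iff_nonempty.2 ‹_›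
    omega
  obtain ⟨δ, hδ, hδδ₀, hsmall⟩ := exists_factorial_mul_pow_lt_one hmn ((n + 1) * t) hδ₀
  have hside : ∀ k i j, (t ^ K) ^ (-(ω.α i + ω.β j)) / (t ^ (ω.α i + ω.β j)) ^ k =
      (t ^ (K + k)) ^ (-(ω.α i + ω.β j)) := fun k i j => by
    rw [← Real.rpow_natCast (t ^ (ω.α i + ω.β j)), ← Real.rpow_mul ht0.le, mul_comm _ (k : ℝ),
      Real.rpow_mul ht0.le, Real.rpow_natCast, div_eq_mul_inv, ← Real.rpow_neg (by positivity),
      ← Real.mul_rpow (by positivity) (by positivity), ← pow_add]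
  have hcard : 2 * (((digits ω t).card + 1) / 2) ≥ (digits ω t).card := by omega
  have hprod : ∏ i, ∏ j, t ^ (ω.α i + ω.β j) ≤ 2 ^ (m * n) * ((digits ω t).card : ℝ) := by
    rw [card_digits]
    calc ∏ i, ∏ j, t ^ (ω.α i + ω.β j) ≤ ∏ i, ∏ j, 2 * (gridSize ω t i j : ℝ) :=
          Finset.prod_le_prod (fun i _ => by positivity) fun i _ =>
            Finset.prod_le_prod (fun j _ => by positivity) fun j _ => le_two_mul_gridSize ω ht.le i j
      _ = _ := by
          simp only [Finset.prod_mul_distrib, Finset.prod_const, Finset.card_univ, Fintype.card_fin]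
          rw [← pow_mul, mul_comm n m]
  have hprod0 : 0 < ∏ i, ∏ j, t ^ (ω.α i + ω.β j) := by positivity
  have hpos : 0 < (digits ω t).card := by
    have := hprod0.trans_le hprod
    rw [mul_pos_iff_of_pos_left (by positivity)] at this
    exact_mod_cast this
  refine le_dimH_of_tree (b := ((digits ω t).card + 1) / 2) (by omega)
    (σ := fun i j => (t ^ K) ^ (-(ω.α i + ω.β j))) (T := fun i j => t ^ (ω.α i + ω.β j)) (τ := τ)
    (Good := fun k A => ShortFree ω δ A (t ^ (K + k)) ∧ (k = 0 → A = A₀)) (x₀ := A₀)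
    (fun i j => by positivity) hτ hτT ⟨fun z hz => ?_, fun _ => rfl⟩ (fun k A hA => ?_) hd he.le hde ?_
    fun A hA => ?_
  · obtain ⟨l, hl⟩ := hA₀δ z hz
    exact ⟨l, hδδ₀.trans hl⟩
  · obtain ⟨F, hF, hF'⟩ := exists_good_digits ω L hb ht htα hδ hL hsmall hC (pow_pos ht0 _) hA.1
    refine ⟨F, hF, fun κ hκ => ⟨(hF' κ hκ).1, ?_⟩⟩
    have h1 := (hF' κ hκ).2
    rw [← pow_succ, add_assoc] at h1
    simp only [hside]
    exact ⟨h1, fun h => absurd h k.succ_ne_zero⟩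
  · have h1 : ((digits ω t).card : ℝ) ≤ 2 * ((((digits ω t).card + 1) / 2 : ℕ) : ℝ) := by
      exact_mod_cast hcard
    calc ∏ i, ∏ j, t ^ (ω.α i + ω.β j)
        ≤ 2 ^ (m * n) * (2 * ((((digits ω t).card + 1) / 2 : ℕ) : ℝ)) :=
          hprod.trans (mul_le_mul_of_nonneg_left h1 (by positivity))
      _ = ((((digits ω t).card + 1) / 2 : ℕ) : ℝ) * 2 ^ (m * n + 1) := by ring
      _ ≤ _ := mul_le_mul_of_nonneg_left hτe (Nat.cast_nonneg _)
  · obtain ⟨c, hc⟩ := hA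
    simp only [hside] at hc
    refine ⟨mem_badlyApproximable_of_shortFree ω (η := δ / (n + 1)) (K := K) ht (by positivity)
      fun k hk => ?_, hball ?_⟩
    · obtain ⟨l, rfl⟩ := Nat.exists_eq_add_of_le hk
      exact (hc l).1.1.of_le_of_le (pow_pos ht0 _) hδ (hc l).2
    · have h0 := (hc 0).2
      rw [(hc 0).1.2 rfl, add_zero] at h0
      refine (dist_pi_lt_iff hρ).2 fun i => (dist_pi_lt_iff hρ).2 fun j => ?_
      have h1 := hK i j
      rw [Real.dist_eq, abs_of_nonneg (by linarith [(h0 i j).1])]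
      linarith [(h0 i j).2]

lemma dimH_matrix_le (S : Set (Matrix (Fin m) (Fin n) ℝ)) : dimH S ≤ ((m * n : ℕ) : ℝ≥0∞) := by
  let _ : NormedSpace ℝ (Matrix (Fin m) (Fin n) ℝ) := Matrix.normedSpace
  refine (dimH_mono (Set.subset_univ S)).trans_eq ?_
  rw [Real.dimH_univ_eq_finrank, Module.finrank_matrix]
  simp

theorem isThick_badlyApproximable (ω : Weights m n) : IsThick (badlyApproximable ω) := by
  intro U hU hne
  refine le_antisymm (dimH_matrix_le _) ?_
  refine ENNReal.le_of_forall_nnreal_lt fun d hd => ?_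
  have hd' : (d : ℝ) < (m * n : ℕ) := by exact_mod_cast hd
  rcases eq_or_ne d 0 with rfl | h0
  · exact zero_le
  · exact le_dimH_badlyApproximable_inter ω hU hne (pos_iff_ne_zero.2 h0)
      (e := (m * n : ℕ) - d) (by linarith) (by ring)

lemma IsThick.mono {S S' : Set (Matrix (Fin m) (Fin n) ℝ)} (h : IsThick S) (hS : S ⊆ S') :
    IsThick S' := fun U hU hne =>
  le_antisymm (dimH_matrix_le _)
    ((h U hU hne).ge.trans (dimH_mono (Set.inter_subset_inter_left U hS)))

end Dimension

end WeightedDirichlet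

theorem mainTheorem4 {m n : ℕ} (ω : WeightedDirichlet.Weights m n) :
    WeightedDirichlet.badlyApproximable ω ⊆ WeightedDirichlet.dirichletImprovable ω ∧
      WeightedDirichlet.IsThick (WeightedDirichlet.badlyApproximable ω) ∧
      WeightedDirichlet.IsThick (WeightedDirichlet.dirichletImprovable ω) := by
  have h := WeightedDirichlet.badlyApproximable_subset_dirichletImprovable ω
  have hBA := WeightedDirichlet.isThick_badlyApproximable ω
  exact ⟨h, hBA, hBA.mono h⟩
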